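/- **Setting.** Let $n\ge 1$ and let $\gamma,\beta,\mu\in\mathbb R$, $1\le p\le\infty$ satisfy $$\gamma>\tfrac12,\qquad 0\le\beta<2\gamma<\frac{n+\beta+1}{2},\qquad 0\le\mu<n,\qquad \frac{n-\mu}{n+\beta+1-4\gamma}<p\le\infty ,$$ and put $s=n-\frac{n-\mu}{p}-(2\gamma-\beta)$. Let $\hat f(\xi)=\int e^{-ix\cdot\xi}f(x)\,dx$ be the Fourier transform. *Spaces.* The Morrey norm is $\|f\|_{M_{p,\mu}}=\sup_{x_0\in\mathbb R^n,\,R>0}R^{-\mu/p}\|f\|_{L^p(B_R(x_0))}$; for $p=1$, $f$ is a complex Radon measure and the $L^1$ norm is its total variation on $B_R(x_0)$. Let $\varphi\in\mathcal S(\mathbb R^n)$ be radial, supported in $\{\frac34\le|\xi|\le\frac83\}$, with $\sum_{k\in\mathbb Z}\varphi(2^{-k}\xi)=1$ for $\xi\ne0$, and put $\varphi_k=\varphi(2^{-k}\cdot)$. Then $\mathcal{FN}^s_{p,\mu,\infty}$ is the space of all $f\in\mathcal S'(\mathbb R^n)/\mathcal P$ ($\mathcal P$ the polynomials) with $\|f\|_{\mathcal{FN}^s_{p,\mu,\infty}}=\sup_{k\in\mathbb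 Z}2^{ks}\|\varphi_k\hat f\|_{M_{p,\mu}}<\infty$. For such $f$ the Fourier transform $\hat f$ is understood as the tempered complex measure without mass at $0$ that represents it away from the origin. *Equation.* Let $a_{jk}\in\mathbb C$ be constants and $P_1,\dots,P_n:\mathbb R^n\to\mathbb C$ measurable with $|P_j(\xi)|\le C|\xi|^\beta$ for a.e. $\xi$ (for every $\xi\ne0$ if $p=1$). Define $u=P[\theta]$ by $\hat u_k(\xi)=\sum_{j}a_{jk}\frac{i\xi_j}{|\xi|^2}P_j(\xi)\hat\theta(\xi)$, define $G_\gamma(t)$ by $\widehat{G_\gamma(t)f}=e^{-t|\xi|^{2\gamma}}\hat f$, and $$\mathcal B(\theta,\phi)(t)=-\int_0^tG_\gamma(t-\tau)\,\nabla\cdot(P[\theta]\phi)(\tau)\,d\tau ,$$ where the product has Fourier transform $(2\pi)^{-n}\hat u*\hat\phi$ and the time integral is taken in the sense of distributions. **Theorem.** There is $K>0$ such that $\mathcal B(\theta,\phi)$ is well defined and $$\sup_{t>0}\|\mathcal B(\theta,\phi)(t)\|_{\mathcal{FN}^s_{p,\mu,\infty}}\le K\sup_{t>0}\|\theta(t)\|_{\mathcal{FN}^s_{p,\mu,\infty}}\sup_{t>0}\|\phi(t)\|_{\mathcal{FN}^s_{p,\mu,\infty}}$$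 for all $\theta,\phi\in L^\infty((0,\infty);\mathcal{FN}^s_{p,\mu,\infty})$. For every such $K$ and every $0<\varepsilon<\frac1{4K}$ the following holds. Let $\theta_0,\phi_0\in\mathcal{FN}^s_{p,\mu,\infty}$ have norm at most $\varepsilon$, and let $\theta,\phi\in BC((0,\infty);\mathcal{FN}^s_{p,\mu,\infty})$ be global mild solutions with data $\theta_0$ and $\phi_0$, that is, $$\theta(t)=G_\gamma(t)\theta_0+\mathcal B(\theta,\theta)(t),\qquad \phi(t)=G_\gamma(t)\phi_0+\mathcal B(\phi,\phi)(t)\qquad(t>0),$$ with $\sup_{t>0}\|\theta(t)\|_{\mathcal{FN}^s_{p,\mu,\infty}}\le2\varepsilon$ and $\sup_{t>0}\|\phi(t)\|_{\mathcal{FN}^s_{p,\mu,\infty}}\le2\varepsilon$. Then $$\lim_{t\to\infty}\|\theta(t)-\phi(t)\|_{\mathcal{FN}^s_{p,\mu,\infty}}=0\quad\Longleftrightarrow\quad\lim_{t\to\infty}\|G_\gamma(t)(\theta_0-\phi_0)\|_{\mathcal{FN}^s_{p,\mu,\infty}}=0 .$$ -/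

import Mathlib

open MeasureTheory Filter Topology SchwartzMap FourierTransform
open scoped ENNReal SchwartzMap LineDeriv

noncomputable section

namespace ActiveScalar

/-- The space `ℝⁿ` with the Euclidean norm. -/
abbrev Space (n : ℕ) := EuclideanSpace ℝ (Fin n)

/-! ### The Fourier transform with kernel `exp (-i x·ξ)` -/

/-- The dilation `x ↦ c x` of `ℝⁿ`. -/
def dilation (n : ℕ) (c : ℝ) (hc : c ≠ 0) : Space n ≃L[ℝ] Space n :=
  ContinuousLinearEquiv.smulLeft (Units.mk0 c hc)

theorem dilation_apply {n : ℕ} (c : ℝ) (hc : c ≠ 0) (x : Space n) :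
    dilation n c hc x = c • x := rfl

/-- The Fourier transform `ψ̂(x) = ∫ exp (-i x·ξ) ψ(ξ) dξ` on Schwartz functions
(see `ftTest_apply`), obtained from Mathlib's by rescaling. -/
def ftTest (n : ℕ) : 𝓢(Space n, ℂ) →L[ℂ] 𝓢(Space n, ℂ) :=
  compCLMOfContinuousLinearEquiv ℂ
      (dilation n (2 * Real.pi)⁻¹ (inv_ne_zero Real.two_pi_pos.ne')) ∘L
    fourierCLM ℂ 𝓢(Space n, ℂ)

/-- The inverse of `ftTest` (see `ftTest_ftTestInv`, `ftTestInv_ftTest`). -/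
def ftTestInv (n : ℕ) : 𝓢(Space n, ℂ) →L[ℂ] 𝓢(Space n, ℂ) :=
  fourierInvCLM ℂ 𝓢(Space n, ℂ) ∘L
    compCLMOfContinuousLinearEquiv ℂ (dilation n (2 * Real.pi) Real.two_pi_pos.ne')

theorem ftTest_eq {n : ℕ} (ψ : 𝓢(Space n, ℂ)) (x : Space n) :
    ftTest n ψ x = 𝓕 ψ ((2 * Real.pi)⁻¹ • x) := by
  rfl

theorem ftTest_apply {n : ℕ} (ψ : 𝓢(Space n, ℂ)) (x : Space n) :
    ftTest n ψ x = ∫ ξ, Complex.exp (-(inner ℝ ξ x : ℝ) * Complex.I) * ψ ξ := by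
  rw [ftTest_eq, SchwartzMap.fourier_coe, Real.fourier_eq']
  refine integral_congr_ae (.of_forall fun ξ => ?_)
  simp only [inner_smul_right, smul_eq_mul]
  congr 2
  push_cast
  have : (Real.pi : ℂ) ≠ 0 := by exact_mod_cast Real.pi_ne_zero
  field_simp

theorem ftTest_ftTestInv {n : ℕ} (ψ : 𝓢(Space n, ℂ)) : ftTest n (ftTestInv n ψ) = ψ := by
  ext x
  rw [ftTest_eq]
  simp only [ftTestInv, ContinuousLinearMap.comp_apply, fourierInvCLM_apply,
    FourierTransform.fourier_fourierInv_eq, compCLMOfContinuousLinearEquiv_apply,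
    Function.comp_apply, dilation_apply, smul_smul]
  rw [mul_inv_cancel₀ Real.two_pi_pos.ne', one_smul]

theorem ftTestInv_ftTest {n : ℕ} (ψ : 𝓢(Space n, ℂ)) : ftTestInv n (ftTest n ψ) = ψ := by
  have : compCLMOfContinuousLinearEquiv ℂ (dilation n (2 * Real.pi) Real.two_pi_pos.ne')
      (ftTest n ψ) = 𝓕 ψ := by
    ext x
    simp only [ftTest_eq, compCLMOfContinuousLinearEquiv_apply,
      Function.comp_apply, dilation_apply, smul_smul]
    rw [inv_mul_cancel₀ Real.two_pi_pos.ne', one_smul]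
  simp only [ftTestInv, ContinuousLinearMap.comp_apply, this, fourierInvCLM_apply,
    FourierTransform.fourierInv_fourier_eq]

/-! ### Tempered distributions modulo polynomials -/

/-- The polynomial function on `ℝⁿ` with complex coefficients given by `q`. -/
def polyFun {n : ℕ} (q : MvPolynomial (Fin n) ℂ) (x : Space n) : ℂ :=
  MvPolynomial.eval (fun i => (x i : ℂ)) q

/-- Multiplication of a Schwartz function by the `i`-th coordinate. -/
def coordMul {n : ℕ} (i : Fin n) (ψ : 𝓢(Space n, ℂ)) : 𝓢(Space n, ℂ) :=
  smulLeftCLM ℂ (inner ℝ · (EuclideanSpace.single i (1 : ℝ))) ψ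

theorem coordMul_apply {n : ℕ} (i : Fin n) (ψ : 𝓢(Space n, ℂ)) (x : Space n) :
    coordMul i ψ x = (x i : ℂ) * ψ x := by
  have : (fun x : Space n => inner ℝ x (EuclideanSpace.single i (1 : ℝ))).HasTemperateGrowth :=
    ((innerSL ℝ).flip _).hasTemperateGrowth
  rw [coordMul, smulLeftCLM_apply_apply this]
  simp [EuclideanSpace.inner_single_right]

theorem integrable_polyFun_mul {n : ℕ} (q : MvPolynomial (Fin n) ℂ) :
    ∀ ψ : 𝓢(Space n, ℂ), Integrable fun x => polyFun q x * ψ x := by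
  induction q using MvPolynomial.induction_on with
  | C a => intro ψ; simpa [polyFun] using ψ.integrable.const_mul a
  | add p q hp hq =>
    intro ψ
    refine ((hp ψ).add (hq ψ)).congr (.of_forall fun x => ?_)
    simp [polyFun, add_mul]
  | mul_X p i hp =>
    intro ψ
    simpa [polyFun, coordMul_apply, mul_assoc] using hp (coordMul i ψ)

theorem coord_mul_ftTest {n : ℕ} (i : Fin n) (ψ : 𝓢(Space n, ℂ)) (x : Space n) :
    (x i : ℂ) * ftTest n ψ x =
      -Complex.I * ftTest n (∂_{(EuclideanSpace.single i (1 : ℝ) : Space n)} ψ) x := by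
  have h : (fun x : Space n => inner ℝ x (EuclideanSpace.single i (1 : ℝ))).HasTemperateGrowth :=
    ((innerSL ℝ).flip _).hasTemperateGrowth
  rw [ftTest_eq, ftTest_eq, SchwartzMap.fourier_lineDerivOp_eq, smul_apply,
    smulLeftCLM_apply_apply h]
  have : (Real.pi : ℂ) ≠ 0 := by exact_mod_cast Real.pi_ne_zero
  simp [EuclideanSpace.inner_single_right]
  field_simp
  simp

theorem integral_ftTest {n : ℕ} (ψ : 𝓢(Space n, ℂ)) (h : ψ 0 = 0) :
    ∫ x, ftTest n ψ x = 0 := by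
  simp only [ftTest_eq]
  rw [MeasureTheory.Measure.integral_comp_smul]
  have h1 : ∫ x, 𝓕 ψ x = ψ 0 := by
    have : 𝓕⁻ (𝓕 ψ) 0 = ψ 0 := by rw [FourierTransform.fourierInv_fourier_eq]
    rw [← this, SchwartzMap.fourierInv_coe, Real.fourierInv_eq']
    simp
  rw [h1, h, smul_zero]

theorem integral_polyFun_ftTest {n : ℕ} (q : MvPolynomial (Fin n) ℂ) :
    ∀ ψ : 𝓢(Space n, ℂ), 0 ∉ tsupport ψ → ∫ x, polyFun q x * ftTest n ψ x = 0 := by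
  induction q using MvPolynomial.induction_on with
  | C a =>
    intro ψ h
    simp [polyFun, integral_const_mul, integral_ftTest ψ (image_eq_zero_of_notMem_tsupport h)]
  | add p q hp hq =>
    intro ψ h
    have := integral_add (integrable_polyFun_mul p (ftTest n ψ))
      (integrable_polyFun_mul q (ftTest n ψ))
    rw [hp ψ h, hq ψ h] at this
    simpa [polyFun, add_mul] using this
  | mul_X p i hp =>
    intro ψ h
    have h' : 0 ∉ tsupport (∂_{(EuclideanSpace.single i (1 : ℝ) : Space n)} ψ : 𝓢(Space n, ℂ)) :=
      fun hx => h (tsupport_lineDerivOp_subset (EuclideanSpace.single i (1 : ℝ) : Space n) ψ hx)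
    have e : ∀ x, polyFun (p * MvPolynomial.X i) x * ftTest n ψ x =
        -Complex.I *
          (polyFun p x * ftTest n (∂_{(EuclideanSpace.single i (1 : ℝ) : Space n)} ψ) x) := by
      intro x
      have := coord_mul_ftTest i ψ x
      simp only [polyFun, map_mul, MvPolynomial.eval_X, mul_assoc, this]
      ring
    simp only [e, integral_const_mul, hp _ h', mul_zero]

/-- The space `𝒫` of polynomials in `n` variables, as a subspace of `𝒮'(ℝⁿ)`. -/
def polynomials (n : ℕ) : Submodule ℂ 𝓢'(Space n, ℂ) where
  carrier := {f | ∃ q : MvPolynomial (Fin n) ℂ, ∀ ψ, f ψ = ∫ x, polyFun q x * ψ x}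
  zero_mem' := ⟨0, fun ψ => by simp [polyFun]⟩
  add_mem' := by
    rintro f g ⟨q, hq⟩ ⟨r, hr⟩
    refine ⟨q + r, fun ψ => ?_⟩
    have := integral_add (integrable_polyFun_mul q ψ) (integrable_polyFun_mul r ψ)
    simp only [add_apply, hq ψ, hr ψ, ← this]
    simp [polyFun, add_mul]
  smul_mem' := by
    rintro c f ⟨q, hq⟩
    refine ⟨c • q, fun ψ => ?_⟩
    simp only [smul_apply, hq ψ]
    simp [polyFun, MvPolynomial.smul_eval, mul_assoc, integral_const_mul]

/-- The space `𝒮'(ℝⁿ)/𝒫`. -/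
abbrev DistModPoly (n : ℕ) := 𝓢'(Space n, ℂ) ⧸ polynomials n

/-- Schwartz functions that vanish in a neighbourhood of the origin. -/
def testAwayZero (n : ℕ) : Submodule ℂ 𝓢(Space n, ℂ) where
  carrier := {ψ | 0 ∉ tsupport ψ}
  zero_mem' := by simp [FunLike.coe_zero]
  add_mem' := by
    intro ψ χ hψ hχ h
    rcases tsupport_add (ψ : Space n → ℂ) χ h with h | h
    · exact hψ h
    · exact hχ h
  smul_mem' := by
    intro c ψ hψ h
    refine hψ (closure_mono (fun x hx => ?_) h)
    intro h0
    exact hx (by simp [h0])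

/-- The restriction to `ℝⁿ ∖ {0}` of the Fourier transform of a tempered distribution,
`⟨f̂, ψ⟩ = ⟨f, ψ̂⟩`. -/
def hatDist (n : ℕ) : 𝓢'(Space n, ℂ) →ₗ[ℂ] (testAwayZero n →ₗ[ℂ] ℂ) where
  toFun f := (f : 𝓢(Space n, ℂ) →ₗ[ℂ] ℂ) ∘ₗ (ftTest n : 𝓢(Space n, ℂ) →ₗ[ℂ] 𝓢(Space n, ℂ)) ∘ₗ
    (testAwayZero n).subtype
  map_add' f g := by ext; simp
  map_smul' c f := by ext; simp

/-- The Fourier transform of a class `F ∈ 𝒮'/𝒫`, as a functional on the Schwartz functions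
vanishing near the origin. Polynomials have Fourier transforms supported at the origin, so this
does not depend on the representative. -/
def hat {n : ℕ} : DistModPoly n →ₗ[ℂ] (testAwayZero n →ₗ[ℂ] ℂ) :=
  (polynomials n).liftQ (hatDist n) (by
    rintro f ⟨q, hq⟩
    rw [LinearMap.mem_ker]
    ext ψ
    exact (hq _).trans (integral_polyFun_ftTest q ψ.1 ψ.2))

/-! ### Complex Radon measures of temperate growth -/

/-- A complex Radon measure `ν = phase · var` on `ℝⁿ`, in polar decomposition: `var` is its total
variation `|ν|`, assumed to be a tempered measure (`∫ (1 + |ξ|)^(-N) d|ν| < ∞` for some `N`), and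
`phase` is a measurable function of modulus one. -/
structure RadonMeasure (n : ℕ) where
  /-- the total variation -/
  var : Measure (Space n)
  /-- the phase -/
  phase : Space n → ℂ
  temperate : var.HasTemperateGrowth
  measurable_phase : Measurable phase
  norm_phase : ∀ ξ, ‖phase ξ‖ = 1

/-- The zero measure. -/
instance (n : ℕ) : Inhabited (RadonMeasure n) :=
  ⟨⟨0, fun _ => 1, inferInstance, measurable_const, fun _ => norm_one⟩⟩

/-- The pairing `∫ χ dν`. -/
def RadonMeasure.pair {n : ℕ} (ν : RadonMeasure n) (χ : Space n → ℂ) : ℂ :=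
  ∫ ξ, χ ξ * ν.phase ξ ∂ν.var

/-- The complex measure `ν`, without mass at the origin, is the Fourier transform of `F`.
There is at most one such `ν` (up to changing the phase on a `|ν|`-null set). -/
def IsFourierMeasure {n : ℕ} (F : DistModPoly n) (ν : RadonMeasure n) : Prop :=
  ν.var {0} = 0 ∧ ∀ ψ : testAwayZero n, hat F ψ = ν.pair ψ.1

open scoped Classical in
/-- The complex measure `F̂` (the zero measure if `F̂` is not a tempered complex measure). -/
def fourierMeasure {n : ℕ} (F : DistModPoly n) : RadonMeasure n :=
  if h : ∃ ν, IsFourierMeasure F ν then h.choose else default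

open scoped Classical in
/-- For a bounded Borel function `w`, the tempered distribution whose Fourier transform is the
complex measure `w ν`, that is, `⟨f, ψ⟩ = ∫ w ψ̌ dν` with `ψ̌` the inverse transform of `ψ`
(and `0` if `w` is not bounded and measurable). -/
def invFourierOf {n : ℕ} (w : Space n → ℂ) (ν : RadonMeasure n) : 𝓢'(Space n, ℂ) :=
  haveI := ν.temperate
  if h : MemLp (fun ξ => w ξ * ν.phase ξ) ∞ ν.var then
    PointwiseConvergenceCLM.precomp ℂ (ftTestInv n) (Lp.toTemperedDistribution (h.toLp _))
  else 0

/-- The semigroup `G_γ(t)`: convolution with the kernel whose Fourier transform is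
`exp (-t |ξ|^(2γ))`. -/
def heat {n : ℕ} (γ t : ℝ) (F : DistModPoly n) : DistModPoly n :=
  (polynomials n).mkQ
    (invFourierOf (fun ξ => (Real.exp (-t * ‖ξ‖ ^ (2 * γ)) : ℂ)) (fourierMeasure F))

/-! ### Fourier-Besov-Morrey spaces -/

/-- The Morrey norm `sup_{x₀, R} R^(-μ/p) ‖g‖_{L^p(B_R(x₀))}` of a function (for `p = ∞` the
exponent `μ/p` is `0`). -/
def morreyFun {n : ℕ} (p : ℝ≥0∞) (μ : ℝ) (g : Space n → ℂ) : ℝ≥0∞ :=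
  ⨆ (x₀ : Space n) (R : ℝ) (_ : 0 < R),
    ENNReal.ofReal (R ^ (-(μ / p.toReal))) * eLpNorm g p (volume.restrict (Metric.ball x₀ R))

/-- The Morrey norm `sup_{x₀, R} R^(-μ) |ν|(B_R(x₀))` of a complex measure. -/
def morreyMeasure {n : ℕ} (μ : ℝ) (ν : RadonMeasure n) : ℝ≥0∞ :=
  ⨆ (x₀ : Space n) (R : ℝ) (_ : 0 < R),
    ENNReal.ofReal (R ^ (-μ)) * ν.var (Metric.ball x₀ R)

open scoped Classical in
/-- The `M_{p,μ}` norm of a functional `T` on Schwartz functions: the Morrey norm of the function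
(for `p ≠ 1`) or complex measure (for `p = 1`) representing `T`, and `∞` if there is none. -/
def morreyNorm {n : ℕ} (p : ℝ≥0∞) (μ : ℝ) (T : 𝓢(Space n, ℂ) →ₗ[ℂ] ℂ) : ℝ≥0∞ :=
  if p = 1 then
    ⨅ (ν : RadonMeasure n) (_ : ∀ ψ : 𝓢(Space n, ℂ), T ψ = ν.pair ψ), morreyMeasure μ ν
  else
    ⨅ (g : Space n → ℂ) (_ : AEStronglyMeasurable g volume)
      (_ : ∀ ψ : 𝓢(Space n, ℂ), T ψ = ∫ ξ, g ξ * ψ ξ), morreyFun p μ g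

/-- A radially symmetric Schwartz function `φ`, supported in `3/4 ≤ |ξ| ≤ 8/3`, with
`∑_{k ∈ ℤ} φ(2^(-k) ξ) = 1` for `ξ ≠ 0`. -/
structure LittlewoodPaley (n : ℕ) where
  /-- the function `φ` -/
  φ : 𝓢(Space n, ℂ)
  radial : ∀ ξ η : Space n, ‖ξ‖ = ‖η‖ → φ ξ = φ η
  support : ∀ ξ : Space n, φ ξ ≠ 0 → 3 / 4 ≤ ‖ξ‖ ∧ ‖ξ‖ ≤ 8 / 3
  sum_eq_one : ∀ ξ : Space n, ξ ≠ 0 → HasSum (fun k : ℤ => φ ((2 : ℝ) ^ (-k) • ξ)) 1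

/-- The function `φ_k(ξ) = φ(2^(-k) ξ)`. -/
def LittlewoodPaley.piece {n : ℕ} (Φ : LittlewoodPaley n) (k : ℤ) : 𝓢(Space n, ℂ) :=
  compCLMOfContinuousLinearEquiv ℂ (dilation n ((2 : ℝ) ^ (-k)) (by positivity)) Φ.φ

theorem LittlewoodPaley.piece_apply {n : ℕ} (Φ : LittlewoodPaley n) (k : ℤ) (ξ : Space n) :
    Φ.piece k ξ = Φ.φ ((2 : ℝ) ^ (-k) • ξ) := rfl

theorem LittlewoodPaley.zero_notMem_tsupport {n : ℕ} (Φ : LittlewoodPaley n) (k : ℤ) :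
    (0 : Space n) ∉ tsupport (Φ.piece k) := by
  rw [notMem_tsupport_iff_eventuallyEq]
  have hc : Tendsto (fun ξ : Space n => ‖(2 : ℝ) ^ (-k) • ξ‖) (𝓝 0) (𝓝 0) := by
    have : Continuous fun ξ : Space n => ‖(2 : ℝ) ^ (-k) • ξ‖ := by fun_prop
    simpa using this.tendsto 0
  filter_upwards [hc.eventually (gt_mem_nhds (show (0 : ℝ) < 3 / 4 by norm_num))] with ξ hξ
  by_contra h
  exact absurd (Φ.support _ h).1 (not_le.mpr hξ)

/-- Multiplication by `φ_k`. -/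
def LittlewoodPaley.cut {n : ℕ} (Φ : LittlewoodPaley n) (k : ℤ) :
    𝓢(Space n, ℂ) →ₗ[ℂ] testAwayZero n :=
  LinearMap.codRestrict (testAwayZero n)
    (smulLeftCLM ℂ (Φ.piece k : Space n → ℂ) : 𝓢(Space n, ℂ) →ₗ[ℂ] 𝓢(Space n, ℂ))
    (fun ψ h => Φ.zero_notMem_tsupport k (tsupport_smulLeftCLM_subset _ ψ h).2)

theorem LittlewoodPaley.cut_apply {n : ℕ} (Φ : LittlewoodPaley n) (k : ℤ)
    (ψ : 𝓢(Space n, ℂ)) (ξ : Space n) :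
    (Φ.cut k ψ).1 ξ = Φ.φ ((2 : ℝ) ^ (-k) • ξ) * ψ ξ :=
  smulLeftCLM_apply_apply (Φ.piece k).hasTemperateGrowth ψ ξ

/-- The norm of the homogeneous Fourier-Besov-Morrey space `𝓕𝓝^s_{p,μ,∞}`,
`sup_k 2^(ks) ‖φ_k f̂‖_{M_{p,μ}}`. The space consists of the `F ∈ 𝒮'/𝒫` of finite norm. -/
def fnNorm {n : ℕ} (Φ : LittlewoodPaley n) (p : ℝ≥0∞) (μ s : ℝ) (F : DistModPoly n) : ℝ≥0∞ :=
  ⨆ k : ℤ, ENNReal.ofReal ((2 : ℝ) ^ ((k : ℝ) * s)) * morreyNorm p μ (hat F ∘ₗ Φ.cut k)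

/-- The index `s = n - (n-μ)/p - (2γ-β)`. -/
def critIndex (n : ℕ) (γ β μ : ℝ) (p : ℝ≥0∞) : ℝ :=
  n - (n - μ) / p.toReal - (2 * γ - β)

/-- `sup_{t>0} ‖θ(t)‖`. -/
def supNorm {n : ℕ} (Φ : LittlewoodPaley n) (p : ℝ≥0∞) (μ s : ℝ) (θ : ℝ → DistModPoly n) :
    ℝ≥0∞ :=
  ⨆ (t : ℝ) (_ : 0 < t), fnNorm Φ p μ s (θ t)

/-- `θ ∈ L^∞((0,∞); 𝓕𝓝^s_{p,μ,∞})`: `θ` is bounded and strongly measurable, i.e. a.e. a limit in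
norm of simple functions. -/
def MemLinfty {n : ℕ} (Φ : LittlewoodPaley n) (p : ℝ≥0∞) (μ s : ℝ) (θ : ℝ → DistModPoly n) :
    Prop :=
  supNorm Φ p μ s θ < ∞ ∧
  ∃ u : ℕ → SimpleFunc ℝ (DistModPoly n), ∀ᵐ t ∂volume.restrict (Set.Ioi (0 : ℝ)),
    Tendsto (fun m => fnNorm Φ p μ s (u m t - θ t)) atTop (𝓝 0)

/-- `θ ∈ BC((0,∞); 𝓕𝓝^s_{p,μ,∞})`. -/
def MemBC {n : ℕ} (Φ : LittlewoodPaley n) (p : ℝ≥0∞) (μ s : ℝ) (θ : ℝ → DistModPoly n) : Prop :=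
  supNorm Φ p μ s θ < ∞ ∧
  ∀ t : ℝ, 0 < t → Tendsto (fun τ => fnNorm Φ p μ s (θ τ - θ t)) (𝓝 t) (𝓝 0)

/-! ### The active scalar equation -/

/-- The symbol `∑_j a_{jk} (i ξ_j / |ξ|²) P_j(ξ)` of the `k`-th component of the velocity. -/
def velocitySymbol {n : ℕ} (a : Fin n → Fin n → ℂ) (P : Fin n → Space n → ℂ) (k : Fin n)
    (ξ : Space n) : ℂ :=
  ∑ j, a j k * (Complex.I * (ξ j : ℂ) / ((‖ξ‖ ^ 2 : ℝ) : ℂ)) * P j ξ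

/-- The integrand of `∫∫ i(ξ+η)_k χ(ξ+η) dû_k(ξ) dĜ(η)`, where `u = P[F]`, with respect to
`|F̂| ⊗ |Ĝ|`. -/
def fluxIntegrand {n : ℕ} (a : Fin n → Fin n → ℂ) (P : Fin n → Space n → ℂ) (k : Fin n)
    (F G : DistModPoly n) (χ : Space n → ℂ) (z : Space n × Space n) : ℂ :=
  (Complex.I * ((z.1 + z.2) k : ℂ) * χ (z.1 + z.2)) *
    (velocitySymbol a P k z.1 * (fourierMeasure F).phase z.1) * (fourierMeasure G).phase z.2

/-- The pairing of the Fourier transform of `∇·(P[F] G)` with `χ`, where the Fourier transform of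
the product `u_k G` is the convolution `(2π)^(-n) û_k * Ĝ`. -/
def fluxPair {n : ℕ} (a : Fin n → Fin n → ℂ) (P : Fin n → Space n → ℂ)
    (F G : DistModPoly n) (χ : Space n → ℂ) : ℂ :=
  ((2 * Real.pi : ℝ) : ℂ)⁻¹ ^ n * ∑ k, ∫ z, fluxIntegrand a P k F G χ z
    ∂((fourierMeasure F).var.prod (fourierMeasure G).var)

/-- The pairing `fluxPair` is well defined: `F̂` and `Ĝ` are complex measures and the convolutions
converge absolutely. -/
def FluxDefined {n : ℕ} (a : Fin n → Fin n → ℂ) (P : Fin n → Space n → ℂ)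
    (F G : DistModPoly n) (χ : Space n → ℂ) : Prop :=
  (∃ ν, IsFourierMeasure F ν) ∧ (∃ ν, IsFourierMeasure G ν) ∧
  ∀ k, Integrable (fluxIntegrand a P k F G χ)
    ((fourierMeasure F).var.prod (fourierMeasure G).var)

/-- The function `exp (-r |ξ|^(2γ)) ψ(ξ)`. -/
def damped {n : ℕ} (γ r : ℝ) (ψ : testAwayZero n) (ξ : Space n) : ℂ :=
  (Real.exp (-r * ‖ξ‖ ^ (2 * γ)) : ℂ) * ψ.1 ξ

/-- `b = 𝓑(θ,φ)(t) = -∫_0^t G_γ(t-τ) (∇·(P[θ] φ))(τ) dτ`, the integral being taken in the sense of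
distributions. -/
def IsDuhamel {n : ℕ} (γ : ℝ) (a : Fin n → Fin n → ℂ) (P : Fin n → Space n → ℂ)
    (θ φ : ℝ → DistModPoly n) (t : ℝ) (b : DistModPoly n) : Prop :=
  ∀ ψ : testAwayZero n,
    (∀ᵐ τ ∂volume.restrict (Set.Ioc 0 t), FluxDefined a P (θ τ) (φ τ) (damped γ (t - τ) ψ)) ∧
    IntervalIntegrable (fun τ => fluxPair a P (θ τ) (φ τ) (damped γ (t - τ) ψ)) volume 0 t ∧
    hat b ψ = -∫ τ in (0 : ℝ)..t, fluxPair a P (θ τ) (φ τ) (damped γ (t - τ) ψ)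

/-- `K` is a constant in the bilinear estimate
`sup_{t>0} ‖𝓑(θ,φ)(t)‖ ≤ K sup_{t>0} ‖θ(t)‖ sup_{t>0} ‖φ(t)‖` on
`L^∞((0,∞); 𝓕𝓝^s_{p,μ,∞})`; in particular `𝓑(θ,φ)` is well defined there. -/
def BilinearEstimate {n : ℕ} (Φ : LittlewoodPaley n) (p : ℝ≥0∞) (μ s γ : ℝ)
    (a : Fin n → Fin n → ℂ) (P : Fin n → Space n → ℂ) (K : ℝ) : Prop :=
  ∀ θ φ : ℝ → DistModPoly n, MemLinfty Φ p μ s θ → MemLinfty Φ p μ s φ →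
    ∃ b : ℝ → DistModPoly n, (∀ t, 0 < t → IsDuhamel γ a P θ φ t (b t)) ∧
      supNorm Φ p μ s b ≤ ENNReal.ofReal K * supNorm Φ p μ s θ * supNorm Φ p μ s φ

/-- `θ(t) = G_γ(t) θ₀ + 𝓑(θ,θ)(t)` for all `t > 0`. -/
def IsMildSolution {n : ℕ} (γ : ℝ) (a : Fin n → Fin n → ℂ) (P : Fin n → Space n → ℂ)
    (θ₀ : DistModPoly n) (θ : ℝ → DistModPoly n) : Prop :=
  ∀ t, 0 < t → ∃ b, IsDuhamel γ a P θ θ t b ∧ θ t = heat γ t θ₀ + b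

/-- `θ ∈ BC((0,∞); 𝓕𝓝^s_{p,μ,∞})` is the global mild solution with data `θ₀` in the ball
`sup_{t>0} ‖θ(t)‖ ≤ 2ε`. -/
structure IsSmallSolution {n : ℕ} (Φ : LittlewoodPaley n) (p : ℝ≥0∞) (μ s γ : ℝ)
    (a : Fin n → Fin n → ℂ) (P : Fin n → Space n → ℂ) (ε : ℝ)
    (θ₀ : DistModPoly n) (θ : ℝ → DistModPoly n) : Prop where
  memBC : MemBC Φ p μ s θ
  bound : supNorm Φ p μ s θ ≤ ENNReal.ofReal (2 * ε)
  mild : IsMildSolution γ a P θ₀ θ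

end ActiveScalar

end

open ActiveScalar

noncomputable section

namespace ActiveScalar

open ProbabilityTheory

/-! Put d = θ - φ. Bilinearity turns the two mild equations into d(t) = G_γ(t)(θ₀ - φ₀) + 𝓑(d,θ)(t)
+ 𝓑(φ,d)(t). Split both time integrals at δt. On (δt, t] the bilinear estimate, applied to d cut off
to τ > δt, gives at most 4εK times the supremum of ‖d(τ)‖ over τ > δt. On (0, δt] the heat factor
has had time to act: |ξ|^(2γ) ∫₀^{δt} exp(-(t-τ)|ξ|^(2γ)) dτ ≤ δ/(1-δ), uniformly in ξ and t, so
this part is at most a constant times δ/(1-δ). This is `exists_remainder`. If d tends to zero,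
letting t → ∞ and then δ → 0 shows that the linear evolution does too
(`tendsto_zero_of_le_add_iSup`). If the linear evolution tends to zero, the upper limit l of ‖d(t)‖
is finite and satisfies l ≤ 4εK l, hence vanishes because 4εK < 1
(`tendsto_zero_of_le_add_mul_iSup`).

The bilinear estimate is proved for positive measures, which treats p = 1 and p > 1 together. A
Morrey bound is expressed by testing a positive measure against functions supported in a ball
(`MorreyLE`), and the norm of f becomes a bound for |f̂| on each dyadic shell (`ShellBound`). One
passes from the norm to the shell bound by `exists_shellBound_fourierMeasure` and back by
`exists_fnNorm_le_of_shellBound`. For the product û * φ̂, the larger of the two frequencies takes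
the Morrey bound and the smaller one is integrated over a ball (`exists_lintegral_conv_le`). With
the velocity symbol of order β - 1, convergence requires 2γ - β > 0, 2γ - 1 > 0 and 2γ - 1 < s, and
the last of these is the lower bound on p. The divergence costs one derivative, the flux lands at
index s - 2γ, and integration in time against the heat factor restores 2γ
(`ShellBound.of_time_integral`).

The Duhamel term itself is produced by duality: the functional ψ ↦ -∫ fluxPair is dominated by
integration against a positive measure with the right shell bound, so it is given by a complex
measure (`exists_radonMeasure_of_bound`, from Hahn-Banach and the Riesz theorem in L²).
Measurability in time is obtained from approximation by simple functions, because the phases of the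
Fourier measures are chosen separately at each time. -/

/-! ### Tempered complex measures and their densities. -/

theorem isLocallyFiniteMeasure_of_hasTemperateGrowth {n : ℕ} {m : Measure (Space n)}
    (hm : m.HasTemperateGrowth) : IsLocallyFiniteMeasure m := by
  refine ⟨fun x => ⟨Metric.ball x 1, Metric.ball_mem_nhds x one_pos, ?_⟩⟩
  obtain ⟨N, hN⟩ := hm.exists_integrable
  have hpos : (0 : ℝ) < (2 + ‖x‖) ^ (-(N : ℝ)) := Real.rpow_pos_of_pos (by positivity) _
  refine (measure_mono ?_).trans_lt (hN.measure_ge_lt_top hpos)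
  intro y hy
  refine Real.rpow_le_rpow_of_nonpos (by positivity) ?_ (by simp)
  have := norm_le_norm_add_norm_sub' y x
  rw [Metric.mem_ball, dist_eq_norm] at hy
  linarith

instance {n : ℕ} (ν : RadonMeasure n) : IsLocallyFiniteMeasure ν.var :=
  isLocallyFiniteMeasure_of_hasTemperateGrowth ν.temperate

theorem hasTemperateGrowth_mono {n : ℕ} {m m' : Measure (Space n)} (h : m ≤ m')
    (hm : m'.HasTemperateGrowth) : m.HasTemperateGrowth := by
  obtain ⟨N, hN⟩ := hm.exists_integrable
  exact ⟨N, hN.mono_measure h⟩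

theorem hasTemperateGrowth_add {n : ℕ} {m m' : Measure (Space n)}
    (hm : m.HasTemperateGrowth) (hm' : m'.HasTemperateGrowth) : (m + m').HasTemperateGrowth := by
  obtain ⟨N, hN⟩ := hm.exists_integrable
  obtain ⟨N', hN'⟩ := hm'.exists_integrable
  have key : ∀ (a b : ℕ), a ≤ b → ∀ m'' : Measure (Space n),
      Integrable (fun x : Space n => (1 + ‖x‖) ^ (-(a : ℝ))) m'' →
      Integrable (fun x : Space n => (1 + ‖x‖) ^ (-(b : ℝ))) m'' := by
    intro a b hab m'' h
    refine h.mono' (Continuous.aestronglyMeasurable ?_) (.of_forall fun x => ?_)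
    · exact (by fun_prop : Continuous fun x : Space n => 1 + ‖x‖).rpow_const
        fun x => Or.inl (by positivity)
    rw [Real.norm_of_nonneg (by positivity)]
    exact Real.rpow_le_rpow_of_exponent_le (by simp) (by simpa using hab)
  exact ⟨max N N', (key _ _ (le_max_left _ _) _ hN).add_measure (key _ _ (le_max_right _ _) _ hN')⟩

/-- The complex measure `w m`. -/
def RadonMeasure.ofDensity {n : ℕ} (m : Measure (Space n)) (hm : m.HasTemperateGrowth)
    (w : Space n → ℂ) (hw : Measurable w) (c : NNReal) (hc : ∀ ξ, ‖w ξ‖ ≤ c) : RadonMeasure n where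
  var := m.withDensity fun ξ => ‖w ξ‖ₑ
  phase ξ := if w ξ = 0 then 1 else w ξ / ‖w ξ‖
  temperate := by
    obtain ⟨N, hN⟩ := hm.exists_integrable
    refine ⟨N, (hN.smul_measure (c := c) ENNReal.coe_ne_top).mono_measure ?_⟩
    rw [← withDensity_const]
    refine withDensity_mono (.of_forall fun ξ => ?_)
    show ‖w ξ‖ₑ ≤ (c : ℝ≥0∞)
    rw [← ofReal_norm]
    exact ENNReal.ofReal_le_of_le_toReal (by simpa using hc ξ)
  measurable_phase := Measurable.ite (hw (measurableSet_singleton 0)) measurable_const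
    (hw.div (Complex.measurable_ofReal.comp hw.norm))
  norm_phase ξ := by
    split_ifs with h
    · simp
    · simp [h]

theorem RadonMeasure.pair_ofDensity {n : ℕ} (m : Measure (Space n))
    (hm : m.HasTemperateGrowth) (w : Space n → ℂ) (hw : Measurable w) (c : NNReal)
    (hc : ∀ ξ, ‖w ξ‖ ≤ c) (h : Space n → ℂ) :
    (RadonMeasure.ofDensity m hm w hw c hc).pair h = ∫ ξ, h ξ * w ξ ∂m := by
  simp only [RadonMeasure.pair, RadonMeasure.ofDensity]
  rw [integral_withDensity_eq_integral_toReal_smul hw.enorm (.of_forall fun _ => enorm_lt_top)]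
  refine integral_congr_ae (.of_forall fun ξ => ?_)
  by_cases h0 : w ξ = 0
  · simp [h0]
  · have : (‖w ξ‖ : ℂ) ≠ 0 := by simpa using h0
    simp only [h0, if_false, toReal_enorm, Complex.real_smul]
    field_simp

/-- The space of test functions contains the smooth functions with compact support in
`ℝⁿ ∖ {0}`. -/
theorem exists_testAwayZero_of_contDiff {n : ℕ} {g : Space n → ℝ} (hg : ContDiff ℝ ((⊤ : ℕ∞) : WithTop ℕ∞) g)
    (hc : HasCompactSupport g) (h0 : tsupport g ⊆ {0}ᶜ) :
    ∃ ψ : testAwayZero n, ∀ ξ, ψ.1 ξ = (g ξ : ℂ) := by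
  have hg₁ : HasCompactSupport (Complex.ofRealCLM ∘ g) := hc.comp_left rfl
  have hg₂ : ContDiff ℝ ((⊤ : ℕ∞) : WithTop ℕ∞) (Complex.ofRealCLM ∘ g) := by fun_prop
  refine ⟨⟨hg₁.toSchwartzMap hg₂, fun h => ?_⟩, fun ξ => rfl⟩
  exact h0 (tsupport_comp_subset (g := Complex.ofRealCLM) rfl g h) rfl

/-- A bounded density is determined by its pairings with test functions vanishing near zero. -/
theorem ae_eq_zero_of_forall_testAwayZero {n : ℕ} {m : Measure (Space n)}
    [IsLocallyFiniteMeasure m] (h0 : m {0} = 0) {w : Space n → ℂ} (hw : LocallyIntegrable w m)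
    (h : ∀ ψ : testAwayZero n, ∫ ξ, ψ.1 ξ * w ξ ∂m = 0) : ∀ᵐ ξ ∂m, w ξ = 0 := by
  have := (isOpen_compl_singleton (x := (0 : Space n))).ae_eq_zero_of_integral_contDiff_smul_eq_zero
    (f := w) (hw.locallyIntegrableOn _) (μ := m) (fun g hg hc hs => by
      obtain ⟨ψ, hψ⟩ := exists_testAwayZero_of_contDiff hg hc hs
      simpa [hψ] using h ψ)
  have h1 : ∀ᵐ ξ ∂m, ξ ≠ 0 := by
    rw [ae_iff]; simpa using h0
  filter_upwards [this, h1] with ξ h2 h3 using h2 h3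

/-- Expressing a complex measure with respect to a dominating measure. -/
theorem RadonMeasure.exists_density {n : ℕ} (ν : RadonMeasure n) {m : Measure (Space n)}
    [SigmaFinite m] (hm : ν.var ≤ m) :
    ∃ w : Space n → ℂ, Measurable w ∧ (∀ ξ, ‖w ξ‖ ≤ 1) ∧
      ν.var = m.withDensity (fun ξ => ‖w ξ‖ₑ) ∧
      ∀ h : Space n → ℂ, ν.pair h = ∫ ξ, h ξ * w ξ ∂m := by
  have hac : ν.var ≪ m := Measure.absolutelyContinuous_of_le hm
  have hle : ν.var.rnDeriv m ≤ᵐ[m] 1 := Measure.rnDeriv_le_one_of_le hm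
  set r : Space n → ℝ := fun ξ => min (ν.var.rnDeriv m ξ).toReal 1 with hr
  have hrm : Measurable r := ((Measure.measurable_rnDeriv _ _).ennreal_toReal).min measurable_const
  have hr0 : ∀ ξ, 0 ≤ r ξ := fun ξ => le_min ENNReal.toReal_nonneg zero_le_one
  have hrr : ∀ᵐ ξ ∂m, r ξ = (ν.var.rnDeriv m ξ).toReal := by
    filter_upwards [hle] with ξ h
    refine min_eq_left ?_
    have := ENNReal.toReal_mono (by simp) h
    simpa using this
  refine ⟨fun ξ => ν.phase ξ * r ξ, ν.measurable_phase.mul (Complex.measurable_ofReal.comp hrm),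
    fun ξ => ?_, ?_, fun h => ?_⟩
  · rw [norm_mul, ν.norm_phase, one_mul, Complex.norm_real, Real.norm_of_nonneg (hr0 ξ)]
    exact min_le_right _ _
  · conv_lhs => rw [← Measure.withDensity_rnDeriv_eq _ _ hac]
    refine withDensity_congr_ae ?_
    filter_upwards [hrr, hle] with ξ h h'
    rw [← ofReal_norm, norm_mul, ν.norm_phase, one_mul, Complex.norm_real,
      Real.norm_of_nonneg (hr0 ξ), h, ENNReal.ofReal_toReal]
    exact (h'.trans_lt (by simp)).ne
  · rw [RadonMeasure.pair, ← integral_rnDeriv_smul hac]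
    refine integral_congr_ae ?_
    filter_upwards [hrr] with ξ h
    rw [← h, Complex.real_smul]
    ring

theorem measurable_testAwayZero {n : ℕ} (ψ : testAwayZero n) : Measurable ψ.1 :=
  ψ.1.continuous.measurable

theorem integrable_testAwayZero {n : ℕ} (ψ : testAwayZero n) (ν : RadonMeasure n) :
    Integrable (ψ.1 : Space n → ℂ) ν.var :=
  haveI := ν.temperate
  ψ.1.integrable

/-- Uniqueness of the representing complex measure, in an additive form. -/
theorem RadonMeasure.add_unique {n : ℕ} (ν₁ ν₂ ν₃ : RadonMeasure n) (h₁ : ν₁.var {0} = 0)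
    (h₂ : ν₂.var {0} = 0) (h₃ : ν₃.var {0} = 0)
    (h : ∀ ψ : testAwayZero n, ν₃.pair ψ.1 = ν₁.pair ψ.1 + ν₂.pair ψ.1) :
    ν₃.var ≤ ν₁.var + ν₂.var ∧
      ∀ f : Space n → ℂ, Integrable f ν₁.var → Integrable f ν₂.var →
        ν₃.pair f = ν₁.pair f + ν₂.pair f := by
  -- With respect to a common dominating measure all three become bounded densities, and the claim
  -- reduces to w₃ = w₁ + w₂ almost everywhere.
  set m : Measure (Space n) := ν₁.var + ν₂.var + ν₃.var with hm
  have ht : m.HasTemperateGrowth :=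
    hasTemperateGrowth_add (hasTemperateGrowth_add ν₁.temperate ν₂.temperate) ν₃.temperate
  have := isLocallyFiniteMeasure_of_hasTemperateGrowth ht
  have l₁ : ν₁.var ≤ m := (Measure.le_add_right le_rfl).trans (Measure.le_add_right le_rfl)
  have l₂ : ν₂.var ≤ m := (Measure.le_add_left le_rfl).trans (Measure.le_add_right le_rfl)
  have l₃ : ν₃.var ≤ m := Measure.le_add_left le_rfl
  obtain ⟨w₁, m₁, b₁, v₁, p₁⟩ := ν₁.exists_density l₁
  obtain ⟨w₂, m₂, b₂, v₂, p₂⟩ := ν₂.exists_density l₂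
  obtain ⟨w₃, m₃, b₃, v₃, p₃⟩ := ν₃.exists_density l₃
  have hi : ∀ (w : Space n → ℂ), Measurable w → (∀ ξ, ‖w ξ‖ ≤ 1) → ∀ ψ : testAwayZero n,
      Integrable (fun ξ => ψ.1 ξ * w ξ) m := fun w hw hb ψ =>
    haveI := ht
    ψ.1.integrable.mul_bdd (c := 1) hw.aestronglyMeasurable (.of_forall hb)
  have hz : ∀ᵐ ξ ∂m, w₃ ξ - (w₁ ξ + w₂ ξ) = 0 := by
    refine ae_eq_zero_of_forall_testAwayZero (by simp [hm, h₁, h₂, h₃]) ?_ fun ψ => ?_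
    · have : LocallyIntegrable (fun _ : Space n => (3 : ℝ)) m := locallyIntegrable_const _
      refine this.mono (m₃.sub (m₁.add m₂)).aestronglyMeasurable (.of_forall fun ξ => ?_)
      have := norm_sub_le (w₃ ξ) (w₁ ξ + w₂ ξ)
      have := norm_add_le (w₁ ξ) (w₂ ξ)
      rw [Real.norm_of_nonneg (by norm_num)]
      linarith [b₁ ξ, b₂ ξ, b₃ ξ]
    · have := h ψ
      rw [p₁, p₂, p₃] at this
      simp only [mul_sub, mul_add]
      rw [integral_sub (hi w₃ m₃ b₃ ψ) (g := fun ξ => ψ.1 ξ * w₁ ξ + ψ.1 ξ * w₂ ξ)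
          ((hi w₁ m₁ b₁ ψ).add (hi w₂ m₂ b₂ ψ)),
        integral_add (hi w₁ m₁ b₁ ψ) (hi w₂ m₂ b₂ ψ), this, sub_self]
  refine ⟨?_, fun f hf₁ hf₂ => ?_⟩
  · rw [v₁, v₂, v₃, ← withDensity_add_left m₁.enorm]
    refine withDensity_mono ?_
    filter_upwards [hz] with ξ hξ
    rw [sub_eq_zero.1 hξ]
    exact enorm_add_le _ _
  · have key : ∀ (ν : RadonMeasure n) (w : Space n → ℂ), Measurable w →
        ν.var = m.withDensity (fun ξ => ‖w ξ‖ₑ) →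
        Integrable f ν.var → Integrable (fun ξ => f ξ * w ξ) m := by
      intro ν w hw hv hf
      rw [hv, integrable_withDensity_iff_integrable_smul' hw.enorm
        (.of_forall fun _ => enorm_lt_top)] at hf
      -- f is known to be measurable only for `ν.var`, which ignores the zeros of w. Measurability
      -- of f w for m is recovered by writing it as (‖w‖ f) times w/‖w‖.
      by_cases hdet : AEStronglyMeasurable (fun ξ => f ξ * w ξ) m
      · refine hf.mono hdet (.of_forall fun ξ => ?_)
        simp [mul_comm]
      · exfalso
        apply hdet
        have h1 : AEStronglyMeasurable (fun ξ => (‖w ξ‖ : ℝ) • f ξ) m := by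
          simpa using hf.aestronglyMeasurable
        have h2 : Measurable fun ξ => (w ξ / ‖w ξ‖ : ℂ) :=
          hw.div (Complex.measurable_ofReal.comp hw.norm)
        refine (h1.mul h2.aestronglyMeasurable).congr (.of_forall fun ξ => ?_)
        by_cases h0 : w ξ = 0
        · simp [h0]
        · have : (‖w ξ‖ : ℂ) ≠ 0 := by simpa using h0
          simp only [Pi.mul_apply, Complex.real_smul]
          field_simp
    rw [p₁, p₂, p₃, ← integral_add (key ν₁ w₁ m₁ v₁ hf₁) (key ν₂ w₂ m₂ v₂ hf₂)]
    refine integral_congr_ae ?_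
    filter_upwards [hz] with ξ hξ
    rw [sub_eq_zero.1 hξ]
    ring

/-! ### Representation of dominated functionals. -/

/-- A contraction on `L¹` of a finite measure is, on `L²`, integration against a function of
modulus at most one. -/
theorem exists_density_of_norm_le_one {X : Type*} [MeasurableSpace X] (m : Measure X)
    [IsFiniteMeasure m] (L : Lp ℂ 1 m →L[ℂ] ℂ) (hL : ‖L‖ ≤ 1) :
    ∃ w : X → ℂ, Measurable w ∧ (∀ x, ‖w x‖ ≤ 1) ∧
      ∀ (f : X → ℂ) (hf : MemLp f 2 m),
        L ((hf.mono_exponent one_le_two).toLp f) = ∫ x, f x * w x ∂m := by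
  have hmono : ∀ f : Lp ℂ 2 m, MemLp f 1 m := fun f => (Lp.memLp f).mono_exponent one_le_two
  let ι₀ : Lp ℂ 2 m →ₗ[ℂ] Lp ℂ 1 m :=
    { toFun := fun f => (hmono f).toLp f
      map_add' := fun f g => by
        rw [← MemLp.toLp_add]
        exact (MemLp.toLp_eq_toLp_iff _ _).2 (Lp.coeFn_add f g)
      map_smul' := fun c f => by
        rw [RingHom.id_apply, ← MemLp.toLp_const_smul]
        exact (MemLp.toLp_eq_toLp_iff _ _).2 (Lp.coeFn_smul c f) }
  let ι : Lp ℂ 2 m →L[ℂ] Lp ℂ 1 m := ι₀.mkContinuous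
    ((m Set.univ ^ (1 / (1 : ℝ≥0∞).toReal - 1 / (2 : ℝ≥0∞).toReal)).toReal) (fun f => by
      show ‖(hmono f).toLp f‖ ≤ _
      rw [Lp.norm_toLp, Lp.norm_def, mul_comm, ← ENNReal.toReal_mul]
      refine ENNReal.toReal_mono (ENNReal.mul_ne_top (Lp.eLpNorm_ne_top f) ?_) ?_
      · exact ENNReal.rpow_ne_top_of_nonneg (by norm_num) (measure_ne_top _ _)
      · exact eLpNorm_le_eLpNorm_mul_rpow_measure_univ one_le_two (Lp.aestronglyMeasurable f))
  -- As m is finite, L² embeds in L¹, and the Riesz theorem in L² supplies the density; the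
  -- contraction bound on L¹ then forces it to be at most one in modulus.
  set g : Lp ℂ 2 m := (InnerProductSpace.toDual ℂ (Lp ℂ 2 m)).symm (L ∘L ι) with hg
  obtain ⟨g', hg'm, hg'⟩ := (Lp.aestronglyMeasurable g).aemeasurable
  have hLf : ∀ (f : X → ℂ) (hf : MemLp f 2 m),
      L ((hf.mono_exponent one_le_two).toLp f) = ∫ x, f x * (starRingEnd ℂ) (g' x) ∂m := by
    intro f hf
    have h1 : inner ℂ g (hf.toLp f) = L (ι (hf.toLp f)) := by
      rw [hg, InnerProductSpace.toDual_symm_apply]; rfl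
    have h2 : ι (hf.toLp f) = (hf.mono_exponent one_le_two).toLp f :=
      (MemLp.toLp_eq_toLp_iff (hmono _) (hf.mono_exponent one_le_two)).2 hf.coeFn_toLp
    rw [← h2, ← h1, L2.inner_def]
    refine integral_congr_ae ?_
    filter_upwards [hg', hf.coeFn_toLp] with x h3 h4
    rw [h3, h4, RCLike.inner_apply]
  have hg2 : MemLp g' 2 m := (Lp.memLp g).ae_eq hg'
  have hg1 : Integrable g' m := hg2.integrable one_le_two
  set E : Set X := {x | 1 < ‖g' x‖} with hE
  have hEm : MeasurableSet E := measurableSet_lt measurable_const hg'm.norm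
  have hE0 : m E = 0 := by
    -- Testing L on the phase of g' over E gives ∫_E ‖g'‖ ≤ m(E). Since ‖g'‖ > 1 on E, this leaves
    -- no mass for E.
    set f : X → ℂ := E.indicator fun x => g' x / ‖g' x‖ with hf
    have hfm : Measurable f := (hg'm.div (Complex.measurable_ofReal.comp hg'm.norm)).indicator hEm
    have hfn : ∀ x, ‖f x‖ = E.indicator (fun _ => (1 : ℝ)) x := by
      intro x
      by_cases hx : x ∈ E
      · have : ‖g' x‖ ≠ 0 := by have : 1 < ‖g' x‖ := hx; linarith
        simp [hf, hx, this]
      · simp [hf, hx]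
    have hf2 : MemLp f 2 m := by
      refine MemLp.of_bound hfm.aestronglyMeasurable 1 (.of_forall fun x => ?_)
      rw [hfn]
      exact Set.indicator_le_self' (fun _ _ => zero_le_one) x |>.trans le_rfl
    have h1 : ‖∫ x, f x * (starRingEnd ℂ) (g' x) ∂m‖ ≤ m.real E := by
      rw [← hLf f hf2]
      refine (L.le_opNorm _).trans ?_
      refine (mul_le_of_le_one_left (norm_nonneg _) hL).trans ?_
      rw [Lp.norm_toLp, eLpNorm_one_eq_lintegral_enorm]
      have : ∀ x, ‖f x‖ₑ = E.indicator 1 x := by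
        intro x
        rw [← ofReal_norm, hfn]
        by_cases hx : x ∈ E <;> simp [hx]
      simp only [this, lintegral_indicator_one hEm]
      rfl
    have h2 : ∫ x, f x * (starRingEnd ℂ) (g' x) ∂m = ((∫ x in E, ‖g' x‖ ∂m : ℝ) : ℂ) := by
      rw [← integral_complex_ofReal, ← integral_indicator hEm]
      refine integral_congr_ae (.of_forall fun x => ?_)
      by_cases hx : x ∈ E
      · have : (‖g' x‖ : ℂ) ≠ 0 := by
          have : 1 < ‖g' x‖ := hx
          exact_mod_cast (by linarith : ‖g' x‖ ≠ 0)
        simp only [hf, Set.indicator_of_mem hx]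
        rw [div_mul_eq_mul_div, Complex.mul_conj, Complex.normSq_eq_norm_sq]
        push_cast
        field_simp
      · simp [hf, hx]
    rw [h2, Complex.norm_real] at h1
    have h3 : ∫ x in E, (‖g' x‖ - 1) ∂m ≤ 0 := by
      rw [integral_sub hg1.norm.integrableOn (integrable_const _)]
      have := (le_abs_self _).trans h1
      simpa using this
    have h4 : 0 ≤ᵐ[m.restrict E] fun x => ‖g' x‖ - 1 := by
      filter_upwards [ae_restrict_mem hEm] with x hx
      exact sub_nonneg.2 (le_of_lt hx)
    have h5 := (integral_eq_zero_iff_of_nonneg_ae h4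
      (hg1.norm.integrableOn.sub (integrable_const _))).1
      (le_antisymm h3 (integral_nonneg_of_ae h4))
    have h6 : ∀ᵐ x ∂m.restrict E, False := by
      filter_upwards [h5, ae_restrict_mem hEm] with x h7 h8
      have h8 : 1 < ‖g' x‖ := h8
      have h7 : ‖g' x‖ - 1 = 0 := h7
      linarith
    simpa using h6
  refine ⟨fun x => if x ∈ E then 0 else (starRingEnd ℂ) (g' x), ?_, fun x => ?_, fun f hf => ?_⟩
  · exact Measurable.ite hEm measurable_const (Complex.continuous_conj.measurable.comp hg'm)
  · show ‖if x ∈ E then 0 else (starRingEnd ℂ) (g' x)‖ ≤ 1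
    split_ifs with h
    · simp
    · simpa [hE] using h
  · rw [hLf f hf]
    have : ∀ᵐ x ∂m, x ∉ E := by rw [ae_iff]; simpa using hE0
    refine integral_congr_ae ?_
    filter_upwards [this] with x hx
    simp [hx]

/-- A functional on the test functions vanishing near zero which is bounded by integration against
a tempered measure is represented by a complex measure. -/
theorem exists_radonMeasure_of_bound {n : ℕ} {m : Measure (Space n)} (hm : m.HasTemperateGrowth)
    (T : testAwayZero n →ₗ[ℂ] ℂ) (hT : ∀ ψ, ‖T ψ‖ ≤ ∫ ξ, ‖ψ.1 ξ‖ ∂m) :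
    ∃ ν : RadonMeasure n, ν.var ≤ m ∧ ∀ ψ, T ψ = ν.pair ψ.1 := by
  obtain ⟨N, hN⟩ := hm.exists_integrable
  set ρ : Space n → ℝ := fun x => (1 + ‖x‖) ^ (-(N : ℝ)) with hρ
  have hρ0 : ∀ x, 0 < ρ x := fun x => Real.rpow_pos_of_pos (by positivity) _
  have hρm : Measurable ρ := (Continuous.rpow_const (by fun_prop) fun x =>
    Or.inl (by positivity : (1 : ℝ) + ‖x‖ ≠ 0)).measurable
  -- The weight ρ makes the measure finite, and ψ ↦ ψ/ρ carries the L¹(m) norm of a test function to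
  -- the L¹(m') norm.
  set m' : Measure (Space n) := m.withDensity fun x => ENNReal.ofReal (ρ x) with hm'
  have : IsFiniteMeasure m' := isFiniteMeasure_withDensity_ofReal hN.2
  have hint : ∀ f : Space n → ℂ, ∫ x, f x / ρ x ∂m' = ∫ x, f x ∂m := by
    intro f
    rw [hm', integral_withDensity_eq_integral_toReal_smul hρm.ennreal_ofReal
      (.of_forall fun _ => ENNReal.ofReal_lt_top)]
    refine integral_congr_ae (.of_forall fun x => ?_)
    have : (ρ x : ℂ) ≠ 0 := by exact_mod_cast (hρ0 x).ne'
    simp only [ENNReal.toReal_ofReal (hρ0 x).le, Complex.real_smul]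
    field_simp
  have hb : ∀ (ψ : testAwayZero n) (q : ℝ≥0∞), MemLp (fun x => ψ.1 x / ρ x) q m' := by
    intro ψ q
    obtain ⟨c, hc⟩ := ψ.1.decay 0 0
    obtain ⟨c', hc'⟩ := ψ.1.decay N 0
    refine MemLp.of_bound ?_ (2 ^ N * (c + c')) (.of_forall fun x => ?_)
    · exact (ψ.1.continuous.measurable.div
        (Complex.measurable_ofReal.comp hρm)).aestronglyMeasurable
    · have h1 := pow_mul_le_of_le_of_pow_mul_le (k := 0) (l := N) (norm_nonneg x)
        (norm_nonneg (ψ.1 x)) (by simpa using hc.2 x) (by simpa using hc'.2 x)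
      rw [norm_div, Complex.norm_real, Real.norm_of_nonneg (hρ0 x).le, div_le_iff₀ (hρ0 x)]
      simpa [hρ] using h1
  let j : testAwayZero n →ₗ[ℂ] Lp ℂ 1 m' :=
    { toFun := fun ψ => (hb ψ 1).toLp _
      map_add' := fun ψ χ => by
        rw [← MemLp.toLp_add]
        refine (MemLp.toLp_eq_toLp_iff _ _).2 (.of_forall fun x => ?_)
        simp [add_div]
      map_smul' := fun c ψ => by
        rw [RingHom.id_apply, ← MemLp.toLp_const_smul]
        refine (MemLp.toLp_eq_toLp_iff _ _).2 (.of_forall fun x => ?_)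
        simp [mul_div_assoc] }
  have hjn : ∀ ψ, ‖j ψ‖ = ∫ x, ‖ψ.1 x‖ ∂m := by
    intro ψ
    show ‖(hb ψ 1).toLp _‖ = _
    rw [Lp.norm_toLp, eLpNorm_one_eq_lintegral_enorm, ← integral_norm_eq_lintegral_enorm
      (hb ψ 1).aestronglyMeasurable]
    have := hint fun x => (‖ψ.1 x‖ : ℂ)
    rw [integral_complex_ofReal] at this
    rw [← Complex.ofReal_inj, ← this, ← integral_complex_ofReal]
    refine integral_congr_ae (.of_forall fun x => ?_)
    simp [abs_of_pos (hρ0 x)]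
  -- The domination makes T a contraction for the L¹ seminorm, so it descends to the range of j and
  -- extends to L¹(m') by Hahn-Banach without increase of norm.
  have hker : LinearMap.ker j ≤ LinearMap.ker T := by
    intro ψ hψ
    rw [LinearMap.mem_ker] at hψ ⊢
    have := hT ψ
    rw [← hjn, hψ, norm_zero] at this
    exact norm_le_zero_iff.1 this
  let T₀ : LinearMap.range j →ₗ[ℂ] ℂ :=
    (LinearMap.ker j).liftQ T hker ∘ₗ (j.quotKerEquivRange.symm : _ →ₗ[ℂ] _)
  have hT₀ : ∀ ψ, T₀ ⟨j ψ, LinearMap.mem_range_self j ψ⟩ = T ψ := by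
    intro ψ
    have : j.quotKerEquivRange.symm ⟨j ψ, LinearMap.mem_range_self j ψ⟩ =
        (LinearMap.ker j).mkQ ψ := by
      rw [LinearEquiv.symm_apply_eq]; rfl
    simp only [T₀, LinearMap.comp_apply, LinearEquiv.coe_coe, this]
    rfl
  let T₁ : LinearMap.range j →L[ℂ] ℂ := T₀.mkContinuous 1 (by
    rintro ⟨_, ψ, rfl⟩
    rw [hT₀, one_mul]
    exact (hT ψ).trans_eq (hjn ψ).symm)
  obtain ⟨L, hL, hLn⟩ := exists_extension_norm_eq (LinearMap.range j) T₁
  have hL1 : ‖L‖ ≤ 1 := hLn.trans_le (T₀.mkContinuous_norm_le zero_le_one _)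
  obtain ⟨w, hwm, hwb, hw⟩ := exists_density_of_norm_le_one m' L hL1
  refine ⟨RadonMeasure.ofDensity m hm w hwm 1 (by simpa using hwb), ?_, fun ψ => ?_⟩
  · show m.withDensity _ ≤ m
    conv_rhs => rw [← withDensity_one (μ := m)]
    refine withDensity_mono (.of_forall fun x => ?_)
    show ‖w x‖ₑ ≤ 1
    rw [← ofReal_norm]
    exact ENNReal.ofReal_le_one.2 (hwb x)
  · rw [RadonMeasure.pair_ofDensity, ← hint]
    have h1 : L (j ψ) = T ψ := by
      rw [← hT₀ ψ]
      exact hL ⟨j ψ, LinearMap.mem_range_self j ψ⟩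
    rw [← h1]
    refine (hw _ (hb ψ 2)).trans (integral_congr_ae (.of_forall fun x => ?_))
    simp only
    ring

/-! ### Morrey bounds of positive measures, by duality. -/

/-- The norm dual to `L^p`: the supremum for `p = 1`, and the norm of `L^q`, `1/p + 1/q = 1`,
otherwise. -/
def dualNorm {n : ℕ} (p : ℝ≥0∞) (h : Space n → ℝ≥0∞) : ℝ≥0∞ :=
  open scoped Classical in
  if p = 1 then ⨆ x, h x else
    (∫⁻ x, h x ^ (1 - p.toReal⁻¹)⁻¹) ^ (1 - p.toReal⁻¹)

/-- The positive measure `m` has Morrey norm at most `A`, expressed by duality. -/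
def MorreyLE {n : ℕ} (p : ℝ≥0∞) (μ : ℝ) (m : Measure (Space n)) (A : ℝ≥0∞) : Prop :=
  ∀ (x : Space n) (R : ℝ), 0 < R → ∀ h : Space n → ℝ≥0∞, Measurable h →
    (∀ y, h y ≠ 0 → y ∈ Metric.ball x R) → dualNorm p h ≠ ∞ →
    ∫⁻ y, h y ∂m ≤ A * ENNReal.ofReal (R ^ (μ / p.toReal)) * dualNorm p h

/-- By the conventions `∞.toReal = 0` and `0⁻¹ = 0`, the quantity 1 - 1/p is the reciprocal of the
conjugate exponent for p = ∞ as well, where it equals 1. -/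
theorem one_sub_inv_toReal_pos {p : ℝ≥0∞} (hp : 1 ≤ p) (hp1 : p ≠ 1) : 0 < 1 - p.toReal⁻¹ := by
  rcases eq_or_ne p ∞ with rfl | h
  · simp
  · have : 1 < p.toReal := by
      rw [← ENNReal.toReal_one]
      exact (ENNReal.toReal_lt_toReal (by simp) h).2 (lt_of_le_of_ne hp hp1.symm)
    have := inv_lt_one_of_one_lt₀ this
    linarith

/-- Translation invariance makes Morrey bounds uniform under the shifts that occur in a convolution.
-/
theorem dualNorm_translate {n : ℕ} (p : ℝ≥0∞) (h : Space n → ℝ≥0∞) (z : Space n) :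
    dualNorm p (fun y => h (z + y)) = dualNorm p h := by
  unfold dualNorm
  split_ifs with hp
  · exact (Equiv.addLeft z).iSup_comp (g := h)
  · rw [lintegral_add_left_eq_self (fun x => h x ^ (1 - p.toReal⁻¹)⁻¹) z]

theorem exists_dualNorm_ball_le (n : ℕ) {p : ℝ≥0∞} (hp : 1 ≤ p) :
    ∃ D : NNReal, ∀ R : ℝ, 0 < R →
      dualNorm p ((Metric.ball (0 : Space n) R).indicator 1) ≤
        D * ENNReal.ofReal (R ^ (n * (1 - p.toReal⁻¹))) := by
  rcases eq_or_ne p 1 with rfl | hp1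
  · refine ⟨1, fun R hR => ?_⟩
    simp only [dualNorm, if_true, ENNReal.toReal_one, inv_one, sub_self, mul_zero, Real.rpow_zero,
      ENNReal.ofReal_one, ENNReal.coe_one, mul_one]
    exact iSup_le fun x => Set.indicator_le_self' (by simp) x
  · have h1 := one_sub_inv_toReal_pos hp hp1
    set c := 1 - p.toReal⁻¹ with hc
    refine ⟨((volume (Metric.ball (0 : Space n) 1)) ^ c).toNNReal, fun R hR => ?_⟩
    rw [ENNReal.coe_toNNReal (ENNReal.rpow_ne_top_of_nonneg h1.le measure_ball_lt_top.ne)]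
    simp only [dualNorm, hp1, if_false, ← hc]
    have h2 : ∀ x, (Metric.ball (0 : Space n) R).indicator (1 : Space n → ℝ≥0∞) x ^ c⁻¹ =
        (Metric.ball (0 : Space n) R).indicator 1 x := by
      intro x
      by_cases hx : x ∈ Metric.ball (0 : Space n) R
      · simp [hx]
      · simp [hx, h1]
    simp only [h2]
    rw [lintegral_indicator_one measurableSet_ball, Measure.addHaar_ball_of_pos _ _ hR,
      ENNReal.mul_rpow_of_nonneg _ _ h1.le, mul_comm, ENNReal.ofReal_rpow_of_nonneg (by positivity) h1.le]
    simp only [finrank_euclideanSpace, Fintype.card_fin]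
    rw [← Real.rpow_natCast, ← Real.rpow_mul hR.le]

theorem MorreyLE.mono {n : ℕ} {p : ℝ≥0∞} {μ : ℝ} {m m' : Measure (Space n)} {A A' : ℝ≥0∞}
    (h : MorreyLE p μ m A) (hm : m' ≤ m) (hA : A ≤ A') : MorreyLE p μ m' A' :=
  fun x R hR g hg hs hd => (lintegral_mono' hm le_rfl).trans ((h x R hR g hg hs hd).trans
    (by gcongr))

theorem MorreyLE.zero {n : ℕ} {p : ℝ≥0∞} {μ : ℝ} {A : ℝ≥0∞} :
    MorreyLE p μ (0 : Measure (Space n)) A :=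
  fun x R hR g hg hs hd => by simp

theorem MorreyLE.add {n : ℕ} {p : ℝ≥0∞} {μ : ℝ} {m m' : Measure (Space n)} {A A' : ℝ≥0∞}
    (h : MorreyLE p μ m A) (h' : MorreyLE p μ m' A') : MorreyLE p μ (m + m') (A + A') :=
  fun x R hR g hg hs hd => by
    rw [lintegral_add_measure, add_mul, add_mul]
    exact add_le_add (h x R hR g hg hs hd) (h' x R hR g hg hs hd)

theorem MorreyLE.finset_sum {n : ℕ} {p : ℝ≥0∞} {μ : ℝ} {ι : Type*} (s : Finset ι)
    {m : ι → Measure (Space n)} {A : ι → ℝ≥0∞} (h : ∀ i ∈ s, MorreyLE p μ (m i) (A i)) :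
    MorreyLE p μ (∑ i ∈ s, m i) (∑ i ∈ s, A i) := by
  classical
  induction s using Finset.induction_on with
  | empty => simpa using MorreyLE.zero
  | insert i s hi ih =>
    rw [Finset.sum_insert hi, Finset.sum_insert hi]
    exact (h i (by simp)).add (ih fun j hj => h j (by simp [hj]))

theorem MorreyLE.smul {n : ℕ} {p : ℝ≥0∞} {μ : ℝ} {m : Measure (Space n)} {A : ℝ≥0∞}
    (h : MorreyLE p μ m A) (c : ℝ≥0∞) : MorreyLE p μ (c • m) (c * A) :=
  fun x R hR g hg hs hd => by
    rw [lintegral_smul_measure, smul_eq_mul, mul_assoc, mul_assoc, ← mul_assoc A]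
    gcongr
    exact h x R hR g hg hs hd

/-- The Morrey norm of a functional is an infimum, so bounds are first available for every larger
constant. Letting A' decrease to A is continuous because the tests have finite dual norm. -/
theorem MorreyLE.of_forall_lt {n : ℕ} {p : ℝ≥0∞} {μ : ℝ} {m : Measure (Space n)} {c A : ℝ≥0∞}
    (hA : A ≠ ∞) (hc : c ≠ ∞) (h : ∀ A' > A, MorreyLE p μ m (c * A')) : MorreyLE p μ m (c * A) := by
  intro x R hR g hg hs hd
  have h1 : ENNReal.ofReal (R ^ (μ / p.toReal)) * dualNorm p g ≠ ∞ :=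
    ENNReal.mul_ne_top ENNReal.ofReal_ne_top hd
  have h2 : Tendsto (fun A' => c * A' * ENNReal.ofReal (R ^ (μ / p.toReal)) * dualNorm p g)
      (𝓝[>] A) (𝓝 (c * A * ENNReal.ofReal (R ^ (μ / p.toReal)) * dualNorm p g)) := by
    simp only [mul_assoc]
    refine (ENNReal.Tendsto.const_mul ?_ (Or.inr hc))
    exact ENNReal.Tendsto.mul_const (tendsto_id.mono_left nhdsWithin_le_nhds) (Or.inr h1)
  have : (𝓝[>] A).NeBot := nhdsGT_neBot_of_exists_gt ⟨∞, lt_top_iff_ne_top.2 hA⟩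
  refine ge_of_tendsto h2 ?_
  filter_upwards [self_mem_nhdsWithin] with A' hA'
  exact h A' hA' x R hR g hg hs hd

theorem MorreyLE.measure_ball_le {n : ℕ} {p : ℝ≥0∞} {μ : ℝ} (hp : 1 ≤ p) :
    ∃ D : NNReal, ∀ (m : Measure (Space n)) (A : ℝ≥0∞), MorreyLE p μ m A → ∀ R : ℝ, 0 < R →
      m (Metric.ball 0 R) ≤ D * A * ENNReal.ofReal (R ^ (n - (n - μ) / p.toReal)) := by
  obtain ⟨D, hD⟩ := exists_dualNorm_ball_le n hp
  refine ⟨D, fun m A h R hR => ?_⟩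
  have h1 := h 0 R hR ((Metric.ball (0 : Space n) R).indicator 1)
    (measurable_one.indicator measurableSet_ball) (fun y hy => by
      by_contra h; simp [Set.indicator_of_notMem h] at hy)
    ((hD R hR).trans_lt (ENNReal.mul_lt_top ENNReal.coe_lt_top ENNReal.ofReal_lt_top)).ne
  rw [lintegral_indicator_one measurableSet_ball] at h1
  refine h1.trans ((mul_le_mul_right (hD R hR) _).trans_eq ?_)
  have h2 : (n : ℝ) - (n - μ) / p.toReal = μ / p.toReal + n * (1 - p.toReal⁻¹) := by ring
  rw [h2, Real.rpow_add hR, ENNReal.ofReal_mul (by positivity)]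
  ring

/-- For p ≠ 1 the indicator of a Lebesgue null set has dual norm zero. Intersecting with balls is
needed because only tests supported in a ball are allowed. -/
theorem MorreyLE.absolutelyContinuous {n : ℕ} {p : ℝ≥0∞} {μ : ℝ} (hp : 1 ≤ p) (hp1 : p ≠ 1)
    {m : Measure (Space n)} {A : ℝ≥0∞} (h : MorreyLE p μ m A) : m ≪ volume := by
  have h1 := one_sub_inv_toReal_pos hp hp1
  refine Measure.AbsolutelyContinuous.mk fun E hE h0 => ?_
  have h2 : ∀ k : ℕ, m (E ∩ Metric.ball 0 (k + 1 : ℝ)) = 0 := by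
    intro k
    have hm := hE.inter (measurableSet_ball (x := (0 : Space n)) (ε := (k + 1 : ℝ)))
    have h3 : dualNorm p ((E ∩ Metric.ball (0 : Space n) (k + 1 : ℝ)).indicator 1) = 0 := by
      simp only [dualNorm, hp1, if_false]
      rw [ENNReal.rpow_eq_zero_iff_of_pos h1, lintegral_eq_zero_iff
        ((measurable_one.indicator hm).pow_const _)]
      have : ∀ᵐ x, x ∉ E := by rw [ae_iff]; simpa using h0
      filter_upwards [this] with x hx
      simp [hx, h1]
    have h4 := h 0 (k + 1) (by positivity) ((E ∩ Metric.ball (0 : Space n) (k + 1 : ℝ)).indicator 1)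
      (measurable_one.indicator hm) (fun y hy => by
        by_contra h
        exact hy (Set.indicator_of_notMem (fun h' => h h'.2) _)) (by simp [h3])
    rw [lintegral_indicator_one hm, h3, mul_zero] at h4
    exact le_antisymm h4 (by simp)
  have h5 : E = ⋃ k : ℕ, E ∩ Metric.ball 0 (k + 1 : ℝ) := by
    rw [← Set.inter_iUnion]
    refine (Set.inter_eq_left.2 fun x _ => ?_).symm
    obtain ⟨k, hk⟩ := exists_nat_gt ‖x‖
    exact Set.mem_iUnion.2 ⟨k, by simp; linarith⟩
  rw [h5]
  exact measure_iUnion_null h2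

/-- This is the converse of Hölder's inequality: the density is tested against its own power
r^(p-1), or against indicators when p = ∞. -/
theorem eLpNorm_rnDeriv_le_of_morreyLE {n : ℕ} {p : ℝ≥0∞} {μ : ℝ} (hp : 1 ≤ p) (hp1 : p ≠ 1)
    {r : Space n → ℝ≥0∞} (hr : Measurable r) {A : ℝ≥0∞}
    (h : MorreyLE p μ (volume.withDensity r) A) (x : Space n) (R : ℝ) (hR : 0 < R) :
    eLpNorm (fun y => (r y).toReal) p (volume.restrict (Metric.ball x R)) ≤
      A * ENNReal.ofReal (R ^ (μ / p.toReal)) := by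
  have h1 := one_sub_inv_toReal_pos hp hp1
  set c := A * ENNReal.ofReal (R ^ (μ / p.toReal)) with hc
  have hle : ∀ y, ‖(r y).toReal‖ₑ ≤ r y := by
    intro y
    rw [Real.enorm_of_nonneg ENNReal.toReal_nonneg]
    exact ENNReal.ofReal_toReal_le
  rcases eq_or_ne p ∞ with rfl | hpt
  · rw [eLpNorm_exponent_top]
    have : r ≤ᵐ[volume.restrict (Metric.ball x R)] fun _ => c := by
      refine ae_le_of_forall_setLIntegral_le_of_sigmaFinite hr fun E hE hEf => ?_
      rw [Measure.restrict_restrict hE]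
      have hm := hE.inter (measurableSet_ball (x := x) (ε := R))
      have hd : dualNorm ∞ ((E ∩ Metric.ball x R).indicator 1) = volume (E ∩ Metric.ball x R) := by
        simp [dualNorm, lintegral_indicator_one hm]
      have h4 := h x R hR ((E ∩ Metric.ball x R).indicator 1)
        (measurable_one.indicator hm) (fun y hy => by
          by_contra h
          exact hy (Set.indicator_of_notMem (fun h' => h h'.2) _)) (by
          rw [hd]; rw [Measure.restrict_apply hE] at hEf; exact hEf.ne)
      rw [lintegral_indicator_one hm, withDensity_apply _ hm, hd] at h4
      simpa [hc] using h4
    refine essSup_le_of_ae_le _ ?_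
    filter_upwards [this] with y hy using (hle y).trans hy
  · have hp0 : p ≠ 0 := (zero_lt_one.trans_le hp).ne'
    have hpt1 : 1 < p.toReal := by
      rw [← ENNReal.toReal_one]
      exact (ENNReal.toReal_lt_toReal (by simp) hpt).2 (lt_of_le_of_ne hp hp1.symm)
    set P := p.toReal with hP
    have hP0 : 0 < P := by linarith
    rw [eLpNorm_eq_lintegral_rpow_enorm_toReal hp0 hpt, ← hP]
    set B := Metric.ball x R with hB
    have hBm : MeasurableSet B := measurableSet_ball
    -- Truncation at N makes I finite, which permits division by I^(1 - 1/P); monotone convergence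
    -- removes it afterwards.
    have key : ∀ N : ℕ, ∫⁻ y in B, (min (r y) N) ^ P ≤ c ^ P := by
      intro N
      set I := ∫⁻ y in B, (min (r y) N) ^ P with hI
      have hmm : Measurable fun y => min (r y) (N : ℝ≥0∞) := hr.min measurable_const
      have hIt : I ≠ ∞ := by
        have : I ≤ (N : ℝ≥0∞) ^ P * volume B := by
          rw [← setLIntegral_const]
          exact lintegral_mono fun y => ENNReal.rpow_le_rpow (min_le_right _ _) hP0.le
        exact (this.trans_lt (ENNReal.mul_lt_top
          (ENNReal.rpow_lt_top_of_nonneg hP0.le (ENNReal.natCast_ne_top N))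
          measure_ball_lt_top)).ne
      rcases eq_or_ne I 0 with hI0 | hI0
      · rw [hI0]; simp
      have hd : dualNorm p (B.indicator fun y => (min (r y) N) ^ (P - 1)) = I ^ (1 - P⁻¹) := by
        simp only [dualNorm, hp1, if_false, ← hP]
        congr 1
        rw [hI, ← lintegral_indicator hBm]
        refine lintegral_congr fun y => ?_
        by_cases hy : y ∈ B
        · simp only [Set.indicator_of_mem hy]
          rw [← ENNReal.rpow_mul]
          congr 1
          have : P - 1 ≠ 0 := by linarith
          field_simp
        · simp only [Set.indicator_of_notMem hy]
          rw [ENNReal.zero_rpow_of_pos (inv_pos.2 h1)]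
      have h4 := h x R hR (B.indicator fun y => (min (r y) N) ^ (P - 1))
        ((hmm.pow_const _).indicator hBm) (fun y hy => by
          by_contra h
          exact hy (Set.indicator_of_notMem h _)) (by
          rw [hd]; exact ENNReal.rpow_ne_top_of_nonneg h1.le hIt)
      rw [hd, ← hc, lintegral_withDensity_eq_lintegral_mul _ hr
        ((hmm.pow_const _).indicator hBm)] at h4
      have h5 : I ≤ c * I ^ (1 - P⁻¹) := by
        refine le_trans ?_ h4
        rw [hI, ← lintegral_indicator hBm]
        refine lintegral_mono fun y => ?_
        by_cases hy : y ∈ B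
        · simp only [Set.indicator_of_mem hy, Pi.mul_apply]
          have : (min (r y) N : ℝ≥0∞) ^ P = min (r y) N * min (r y) N ^ (P - 1) := by
            conv_rhs => enter [1]; rw [← ENNReal.rpow_one (min (r y) N)]
            rw [← ENNReal.rpow_add_of_nonneg _ _ zero_le_one (by linarith)]
            congr 1; ring
          rw [this]
          gcongr
          exact min_le_left _ _
        · simp [Set.indicator_of_notMem hy]
      have h6 : I ^ P⁻¹ ≤ c := by
        have h7 : I = I ^ P⁻¹ * I ^ (1 - P⁻¹) := by
          rw [← ENNReal.rpow_add _ _ hI0 hIt]; simp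
        have h8 : I ^ (1 - P⁻¹) ≠ 0 := by simp [hI0, hIt]
        have h9 : I ^ (1 - P⁻¹) ≠ ∞ := ENNReal.rpow_ne_top_of_nonneg h1.le hIt
        rw [h7] at h5
        rw [← h7] at h5
        exact (ENNReal.mul_le_mul_iff_left h8 h9).1 (by rw [← h7]; exact h5)
      calc I = (I ^ P⁻¹) ^ P := by rw [← ENNReal.rpow_mul, inv_mul_cancel₀ hP0.ne', ENNReal.rpow_one]
        _ ≤ c ^ P := ENNReal.rpow_le_rpow h6 hP0.le
    have hlim : ∫⁻ y in B, r y ^ P ≤ c ^ P := by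
      have ht := lintegral_tendsto_of_tendsto_of_monotone (μ := volume.restrict B)
        (f := fun (N : ℕ) y => (min (r y) (N : ℝ≥0∞)) ^ P) (F := fun y => r y ^ P)
        (fun N => ((hr.min measurable_const).pow_const _).aemeasurable)
        (.of_forall fun y N N' hN => ENNReal.rpow_le_rpow
          (min_le_min_left _ (by exact_mod_cast hN)) hP0.le)
        (.of_forall fun y => by
          have h1 : Tendsto (fun N : ℕ => min (r y) (N : ℝ≥0∞)) atTop (𝓝 (min (r y) ∞)) :=
            tendsto_const_nhds.min ENNReal.tendsto_nat_nhds_top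
          rw [min_eq_left le_top] at h1
          exact (ENNReal.continuous_rpow_const.tendsto _).comp h1)
      exact le_of_tendsto' ht key
    calc (∫⁻ y in B, ‖(r y).toReal‖ₑ ^ P) ^ (1 / P) ≤ (c ^ P) ^ (1 / P) := by
          refine ENNReal.rpow_le_rpow (le_trans (lintegral_mono fun y =>
            ENNReal.rpow_le_rpow (hle y) hP0.le) hlim) (by positivity)
      _ = c := by rw [← ENNReal.rpow_mul, mul_one_div_cancel hP0.ne', ENNReal.rpow_one]

/-- The annulus k ≤ ‖x‖ < k + 1 has mass at most A (k+1)^d, and N > d + 1 makes the series of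
(k+1)^(d-N) converge. Both N and C are independent of the measure. -/
theorem exists_lintegral_one_add_norm_rpow_le (n : ℕ) (d : ℝ) :
    ∃ (N : ℕ) (C : NNReal), ∀ (m : Measure (Space n)) (A : ℝ≥0∞),
      (∀ R : ℝ, 1 ≤ R → m (Metric.ball 0 R) ≤ A * ENNReal.ofReal (R ^ d)) →
      ∫⁻ x, ENNReal.ofReal ((1 + ‖x‖) ^ (-(N : ℝ))) ∂m ≤ C * A := by
  obtain ⟨N, hN⟩ := exists_nat_gt (d + 1)
  have hs : Summable fun k : ℕ => ((k : ℝ) + 1) ^ (d - N) := by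
    have := (summable_nat_add_iff 1).2 (Real.summable_nat_rpow.2 (by linarith : d - N < -1))
    simpa using this
  refine ⟨N, (∑' k : ℕ, ((k : ℝ) + 1) ^ (d - N)).toNNReal, fun m A h => ?_⟩
  have h1 : ∀ x : Space n, ENNReal.ofReal ((1 + ‖x‖) ^ (-(N : ℝ))) ≤ ∑' k : ℕ,
      ENNReal.ofReal (((k : ℝ) + 1) ^ (-(N : ℝ))) *
        (Metric.ball (0 : Space n) ((k : ℝ) + 1)).indicator 1 x := by
    intro x
    refine le_trans ?_ (ENNReal.le_tsum ⌊‖x‖⌋₊)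
    rw [Set.indicator_of_mem (by simpa using Nat.lt_floor_add_one ‖x‖), Pi.one_apply, mul_one]
    refine ENNReal.ofReal_le_ofReal (Real.rpow_le_rpow_of_nonpos (by positivity) ?_ (by simp))
    have := Nat.floor_le (norm_nonneg x)
    linarith
  refine (lintegral_mono h1).trans ?_
  rw [lintegral_tsum fun k => ((measurable_one.indicator measurableSet_ball).const_mul _).aemeasurable]
  have h2 : ∀ k : ℕ, ∫⁻ x, ENNReal.ofReal (((k : ℝ) + 1) ^ (-(N : ℝ))) *
      (Metric.ball (0 : Space n) ((k : ℝ) + 1)).indicator 1 x ∂m ≤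
      A * ENNReal.ofReal (((k : ℝ) + 1) ^ (d - N)) := by
    intro k
    have hk : (0 : ℝ) < k + 1 := by positivity
    rw [lintegral_const_mul _ (measurable_one.indicator measurableSet_ball),
      lintegral_indicator_one measurableSet_ball]
    refine (mul_le_mul_right (h (k + 1) (by simp)) _).trans_eq ?_
    rw [mul_left_comm, ← ENNReal.ofReal_mul (by positivity), ← Real.rpow_add hk]
    congr 3
    ring
  refine (ENNReal.tsum_le_tsum h2).trans_eq ?_
  rw [ENNReal.tsum_mul_left, ← ENNReal.ofReal_tsum_of_nonneg (fun k => by positivity) hs, mul_comm]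
  rfl

theorem hasTemperateGrowth_of_measure_ball_le {n : ℕ} {m : Measure (Space n)} {A : ℝ≥0∞}
    (hA : A ≠ ∞) {d : ℝ}
    (h : ∀ R : ℝ, 1 ≤ R → m (Metric.ball 0 R) ≤ A * ENNReal.ofReal (R ^ d)) :
    m.HasTemperateGrowth := by
  obtain ⟨N, C, hC⟩ := exists_lintegral_one_add_norm_rpow_le n d
  have hc : Continuous fun x : Space n => (1 + ‖x‖) ^ (-(N : ℝ)) :=
    (by fun_prop : Continuous fun x : Space n => 1 + ‖x‖).rpow_const
      fun x => Or.inl (by positivity)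
  refine ⟨N, hc.aestronglyMeasurable, ?_⟩
  refine lt_of_le_of_lt ?_ (ENNReal.mul_lt_top ENNReal.coe_lt_top hA.lt_top : C * A < ∞)
  refine le_trans (le_of_eq (lintegral_congr fun x => ?_)) (hC m A h)
  rw [Real.enorm_of_nonneg (by positivity)]

/-! ### Morrey norms of functionals compared with Morrey bounds of measures. -/

theorem morreyLE_of_morreyMeasure {n : ℕ} (μ : ℝ) (ν : RadonMeasure n) :
    MorreyLE 1 μ ν.var (morreyMeasure μ ν) := by
  intro x R hR h hh hs hd
  simp only [dualNorm, if_true, ENNReal.toReal_one, div_one] at hd ⊢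
  have h1 : ∫⁻ y, h y ∂ν.var ≤ (⨆ x, h x) * ν.var (Metric.ball x R) := by
    rw [← setLIntegral_const, ← lintegral_indicator measurableSet_ball]
    refine lintegral_mono fun y => ?_
    by_cases hy : y ∈ Metric.ball x R
    · rw [Set.indicator_of_mem hy]; exact le_iSup h y
    · have : h y = 0 := by by_contra h0; exact hy (hs y h0)
      simp [this]
  refine h1.trans ?_
  rw [mul_comm]
  gcongr
  have h2 : ENNReal.ofReal (R ^ (-μ)) * ν.var (Metric.ball x R) ≤ morreyMeasure μ ν :=
    le_iSup_of_le x (le_iSup_of_le R (le_iSup_of_le hR le_rfl))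
  have h3 : ENNReal.ofReal (R ^ (-μ)) * ENNReal.ofReal (R ^ μ) = 1 := by
    rw [← ENNReal.ofReal_mul (by positivity), ← Real.rpow_add hR]; simp
  calc ν.var (Metric.ball x R)
      = ENNReal.ofReal (R ^ (-μ)) * ν.var (Metric.ball x R) * ENNReal.ofReal (R ^ μ) := by
        rw [mul_right_comm, h3, one_mul]
    _ ≤ _ := by gcongr

theorem morreyLE_of_morreyFun {n : ℕ} {p : ℝ≥0∞} (hp : 1 ≤ p) (hp1 : p ≠ 1) (μ : ℝ)
    {g : Space n → ℂ} (hg : AEStronglyMeasurable g volume) :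
    MorreyLE p μ (volume.withDensity fun ξ => ‖g ξ‖ₑ) (morreyFun p μ g) := by
  have h1 := one_sub_inv_toReal_pos hp hp1
  intro x R hR h hh hs hd
  set B := Metric.ball x R with hB
  have h2 : ∫⁻ y, h y ∂(volume.withDensity fun ξ => ‖g ξ‖ₑ) = ∫⁻ y in B, ‖g y‖ₑ * h y := by
    rw [lintegral_withDensity_eq_lintegral_mul₀ hg.enorm hh.aemeasurable,
      ← lintegral_indicator measurableSet_ball]
    refine lintegral_congr fun y => ?_
    by_cases hy : y ∈ B
    · rw [Set.indicator_of_mem hy]; rfl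
    · have : h y = 0 := by by_contra h0; exact hy (hs y h0)
      rw [Set.indicator_of_notMem hy]
      simp [this]
  have h3 : ∫⁻ y in B, ‖g y‖ₑ * h y ≤ eLpNorm g p (volume.restrict B) * dualNorm p h := by
    rcases eq_or_ne p ∞ with rfl | hpt
    · have : dualNorm ∞ h = ∫⁻ y, h y := by simp [dualNorm]
      rw [this, eLpNorm_exponent_top]
      calc ∫⁻ y in B, ‖g y‖ₑ * h y
          ≤ ∫⁻ y in B, eLpNormEssSup g (volume.restrict B) * h y := by
            refine lintegral_mono_ae ?_
            filter_upwards [enorm_ae_le_eLpNormEssSup g (volume.restrict B)] with y hy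
            gcongr
        _ = eLpNormEssSup g (volume.restrict B) * ∫⁻ y in B, h y := lintegral_const_mul _ hh
        _ ≤ _ := by gcongr; exact Measure.restrict_le_self
    · have hp0 : p ≠ 0 := (zero_lt_one.trans_le hp).ne'
      have hpt1 : 1 < p.toReal := by
        rw [← ENNReal.toReal_one]
        exact (ENNReal.toReal_lt_toReal (by simp) hpt).2 (lt_of_le_of_ne hp hp1.symm)
      have hc : p.toReal.HolderConjugate (1 - p.toReal⁻¹)⁻¹ :=
        Real.holderConjugate_iff.2 ⟨hpt1, by rw [inv_inv]; ring⟩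
      refine (ENNReal.lintegral_mul_le_Lp_mul_Lq (volume.restrict B) hc hg.enorm.restrict
        hh.aemeasurable).trans ?_
      rw [eLpNorm_eq_lintegral_rpow_enorm_toReal hp0 hpt]
      simp only [dualNorm, hp1, if_false, one_div, inv_inv]
      gcongr
      exact Measure.restrict_le_self
  rw [h2]
  refine h3.trans ?_
  gcongr
  have h4 : ENNReal.ofReal (R ^ (-(μ / p.toReal))) * eLpNorm g p (volume.restrict B) ≤
      morreyFun p μ g :=
    le_iSup_of_le x (le_iSup_of_le R (le_iSup_of_le hR le_rfl))
  have h5 : ENNReal.ofReal (R ^ (-(μ / p.toReal))) * ENNReal.ofReal (R ^ (μ / p.toReal)) = 1 := by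
    rw [← ENNReal.ofReal_mul (by positivity), ← Real.rpow_add hR]; simp
  calc eLpNorm g p (volume.restrict B)
      = ENNReal.ofReal (R ^ (-(μ / p.toReal))) * eLpNorm g p (volume.restrict B) *
          ENNReal.ofReal (R ^ (μ / p.toReal)) := by
        rw [mul_right_comm, h5, one_mul]
    _ ≤ _ := by gcongr

/-- A functional of finite Morrey norm is bounded by integration against a positive measure with
the same Morrey norm. -/
theorem exists_morreyLE_of_morreyNorm_lt {n : ℕ} {p : ℝ≥0∞} (hp : 1 ≤ p) {μ : ℝ}
    {T : 𝓢(Space n, ℂ) →ₗ[ℂ] ℂ} {A : ℝ≥0∞} (h : morreyNorm p μ T < A) :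
    ∃ m : Measure (Space n), MorreyLE p μ m A ∧ ∀ ψ, ‖T ψ‖ₑ ≤ ∫⁻ ξ, ‖ψ ξ‖ₑ ∂m := by
  unfold morreyNorm at h
  split_ifs at h with hp1
  · subst hp1
    simp only [iInf_lt_iff] at h
    obtain ⟨ν, hν, h⟩ := h
    refine ⟨ν.var, (morreyLE_of_morreyMeasure μ ν).mono le_rfl h.le, fun ψ => ?_⟩
    rw [hν]
    refine (enorm_integral_le_lintegral_enorm _).trans (lintegral_mono fun ξ => ?_)
    simp [enorm_mul, ← ofReal_norm (ν.phase ξ), ν.norm_phase]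
  · simp only [iInf_lt_iff] at h
    obtain ⟨g, hg, hT, h⟩ := h
    refine ⟨_, (morreyLE_of_morreyFun hp hp1 μ hg).mono le_rfl h.le, fun ψ => ?_⟩
    rw [hT, lintegral_withDensity_eq_lintegral_mul₀ hg.enorm
      ψ.continuous.measurable.enorm.aemeasurable]
    refine (enorm_integral_le_lintegral_enorm _).trans (lintegral_mono fun ξ => ?_)
    simp [enorm_mul]

/-- For p = 1 the complex measure w m represents T. Otherwise m has a Lebesgue density, w times that
density represents T, and the converse of Hölder's inequality bounds its L^p norms on balls. -/
theorem morreyNorm_le_of_morreyLE {n : ℕ} {p : ℝ≥0∞} (hp : 1 ≤ p) {μ : ℝ}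
    {T : 𝓢(Space n, ℂ) →ₗ[ℂ] ℂ} {A : ℝ≥0∞} {m : Measure (Space n)} (hm : m.HasTemperateGrowth)
    (hA : MorreyLE p μ m A) {w : Space n → ℂ} (hw : Measurable w) {c : NNReal}
    (hc : ∀ ξ, ‖w ξ‖ ≤ c) (hT : ∀ ψ, T ψ = ∫ ξ, ψ ξ * w ξ ∂m) :
    morreyNorm p μ T ≤ c * A := by
  have := isLocallyFiniteMeasure_of_hasTemperateGrowth hm
  have hcw : ∀ ξ, ‖w ξ‖ₑ ≤ c := fun ξ => by
    rw [← ofReal_norm]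
    exact ENNReal.ofReal_le_of_le_toReal (by simpa using hc ξ)
  unfold morreyNorm
  split_ifs with hp1
  · subst hp1
    refine iInf₂_le_of_le (RadonMeasure.ofDensity m hm w hw c hc) (fun ψ => ?_) ?_
    · rw [RadonMeasure.pair_ofDensity, hT]
    · refine iSup_le fun x => iSup_le fun R => iSup_le fun hR => ?_
      have h1 : (RadonMeasure.ofDensity m hm w hw c hc).var (Metric.ball x R) ≤
          c * m (Metric.ball x R) := by
        show (m.withDensity _) _ ≤ _
        rw [withDensity_apply _ measurableSet_ball, ← setLIntegral_const]
        exact lintegral_mono hcw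
      have h2 := hA x R hR ((Metric.ball x R).indicator 1)
        (measurable_one.indicator measurableSet_ball) (fun y hy => by
          by_contra h; simp [Set.indicator_of_notMem h] at hy)
      have h3 : dualNorm 1 ((Metric.ball x R).indicator (1 : Space n → ℝ≥0∞)) ≤ 1 := by
        simp only [dualNorm, if_true]
        exact iSup_le fun x => Set.indicator_le_self' (by simp) x
      have h4 := (h2 (h3.trans_lt (by simp)).ne).trans (mul_le_mul_right h3 _)
      rw [lintegral_indicator_one measurableSet_ball, mul_one, ENNReal.toReal_one, div_one] at h4
      calc ENNReal.ofReal (R ^ (-μ)) * (RadonMeasure.ofDensity m hm w hw c hc).var (Metric.ball x R)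
          ≤ ENNReal.ofReal (R ^ (-μ)) * (c * (A * ENNReal.ofReal (R ^ μ))) := by
            gcongr; exact h1.trans (by gcongr)
        _ = (ENNReal.ofReal (R ^ (-μ)) * ENNReal.ofReal (R ^ μ)) * (c * A) := by ring
        _ = c * A := by
          rw [← ENNReal.ofReal_mul (by positivity), ← Real.rpow_add hR]; simp
  · have hac := hA.absolutelyContinuous hp hp1
    set r := m.rnDeriv volume with hr
    have hrm : Measurable r := Measure.measurable_rnDeriv _ _
    have hA' : MorreyLE p μ (volume.withDensity r) A := by
      rwa [hr, Measure.withDensity_rnDeriv_eq _ _ hac]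
    have hgm : Measurable fun ξ => w ξ * ((r ξ).toReal : ℂ) :=
      hw.mul (Complex.measurable_ofReal.comp hrm.ennreal_toReal)
    refine iInf_le_of_le (fun ξ => w ξ * ((r ξ).toReal : ℂ)) (iInf₂_le_of_le
      hgm.aestronglyMeasurable (fun ψ => ?_) ?_)
    · rw [hT, ← integral_rnDeriv_smul hac]
      refine integral_congr_ae (.of_forall fun ξ => ?_)
      simp only [Complex.real_smul, ← hr]
      ring
    · refine iSup_le fun x => iSup_le fun R => iSup_le fun hR => ?_
      have h1 : eLpNorm (fun ξ => w ξ * ((r ξ).toReal : ℂ)) p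
          (volume.restrict (Metric.ball x R)) ≤ c * (A * ENNReal.ofReal (R ^ (μ / p.toReal))) := by
        refine le_trans ?_ (mul_le_mul_right
          (eLpNorm_rnDeriv_le_of_morreyLE hp hp1 hrm hA' x R hR) (c : ℝ≥0∞))
        refine (eLpNorm_le_nnreal_smul_eLpNorm_of_ae_le_mul (c := c)
          (g := fun y => (r y).toReal) (.of_forall fun ξ => ?_) p)
        rw [← NNReal.coe_le_coe]
        push_cast
        rw [norm_mul, Complex.norm_real]
        gcongr
        exact hc ξ
      calc _ ≤ ENNReal.ofReal (R ^ (-(μ / p.toReal))) *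
            (c * (A * ENNReal.ofReal (R ^ (μ / p.toReal)))) := by gcongr
        _ = (ENNReal.ofReal (R ^ (-(μ / p.toReal))) * ENNReal.ofReal (R ^ (μ / p.toReal))) *
            (c * A) := by ring
        _ = c * A := by
          rw [← ENNReal.ofReal_mul (by positivity), ← Real.rpow_add hR]; simp

/-- The integrals in `morreyNorm` come with no integrability requirement, so two representations can
be added only after deducing it from the finite Morrey norm: the measure |g| dx grows at most
polynomially on balls. -/
theorem integrable_mul_of_morreyFun_ne_top {n : ℕ} {p : ℝ≥0∞} (hp : 1 ≤ p) (hp1 : p ≠ 1) {μ : ℝ}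
    {g : Space n → ℂ} (hg : AEStronglyMeasurable g volume) (hfin : morreyFun p μ g ≠ ∞)
    (ψ : 𝓢(Space n, ℂ)) : Integrable fun ξ => g ξ * ψ ξ := by
  obtain ⟨D, hD⟩ := MorreyLE.measure_ball_le (n := n) (μ := μ) hp
  have ht : (volume.withDensity fun ξ => ‖g ξ‖ₑ).HasTemperateGrowth :=
    hasTemperateGrowth_of_measure_ball_le (ENNReal.mul_ne_top ENNReal.coe_ne_top hfin)
      fun R hR => hD _ _ (morreyLE_of_morreyFun hp hp1 μ hg) R (by linarith)
  have hi : Integrable ψ (volume.withDensity fun ξ => ‖g ξ‖ₑ) := ψ.integrable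
  refine ⟨hg.mul ψ.continuous.aestronglyMeasurable, ?_⟩
  have h1 := hi.2
  rw [HasFiniteIntegral, lintegral_withDensity_eq_lintegral_mul₀ hg.enorm
    ψ.continuous.measurable.enorm.aemeasurable] at h1
  simpa [HasFiniteIntegral, enorm_mul] using h1

theorem morreyNorm_add_le {n : ℕ} {p : ℝ≥0∞} (hp : 1 ≤ p) (μ : ℝ)
    (T T' : 𝓢(Space n, ℂ) →ₗ[ℂ] ℂ) :
    morreyNorm p μ (T + T') ≤ morreyNorm p μ T + morreyNorm p μ T' := by
  unfold morreyNorm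
  split_ifs with hp1
  · simp only [ENNReal.iInf_add, ENNReal.add_iInf, le_iInf_iff]
    intro ν' hν' ν hν
    set m := ν.var + ν'.var with hm
    have ht : m.HasTemperateGrowth := hasTemperateGrowth_add ν.temperate ν'.temperate
    have := isLocallyFiniteMeasure_of_hasTemperateGrowth ht
    obtain ⟨w, hwm, hwb, hwv, hwp⟩ := ν.exists_density (m := m) (Measure.le_add_right le_rfl)
    obtain ⟨w', hwm', hwb', hwv', hwp'⟩ := ν'.exists_density (m := m) (Measure.le_add_left le_rfl)
    -- The bound 2 only serves to form the measure; the Morrey estimate uses ‖w + w'‖ ≤ ‖w‖ + ‖w'‖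
    -- and loses no constant.
    have hb : ∀ ξ, ‖w ξ + w' ξ‖ ≤ (2 : NNReal) := fun ξ =>
      (norm_add_le _ _).trans (by have := hwb ξ; have := hwb' ξ; push_cast; linarith)
    refine iInf₂_le_of_le (RadonMeasure.ofDensity m ht _ (hwm.add hwm') 2 hb) (fun ψ => ?_) ?_
    · have hi : ∀ (w : Space n → ℂ), Measurable w → (∀ ξ, ‖w ξ‖ ≤ 1) →
          Integrable (fun ξ => ψ ξ * w ξ) m := fun w hw hb =>
        haveI := ht
        ψ.integrable.mul_bdd (c := 1) hw.aestronglyMeasurable (.of_forall hb)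
      rw [RadonMeasure.pair_ofDensity, LinearMap.add_apply, hν, hν', hwp, hwp',
        ← integral_add (hi w hwm hwb) (hi w' hwm' hwb')]
      simp only [Pi.add_apply, mul_add]
    · refine iSup_le fun x => iSup_le fun R => iSup_le fun hR => ?_
      have h1 : (RadonMeasure.ofDensity m ht _ (hwm.add hwm') 2 hb).var ≤ ν.var + ν'.var := by
        rw [hwv, hwv', ← withDensity_add_left hwm.enorm]
        exact withDensity_mono (.of_forall fun ξ => enorm_add_le _ _)
      refine (mul_le_mul_right (h1 _) _).trans ?_
      rw [Measure.add_apply, mul_add]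
      exact add_le_add
        (le_iSup_of_le x (le_iSup_of_le R (le_iSup_of_le hR le_rfl)))
        (le_iSup_of_le x (le_iSup_of_le R (le_iSup_of_le hR le_rfl)))
  · simp only [ENNReal.iInf_add, ENNReal.add_iInf, le_iInf_iff]
    intro g' hg' hT' g hg hT
    by_cases hfin : morreyFun p μ g' = ∞ ∨ morreyFun p μ g = ∞
    · rcases hfin with h | h <;> simp [h]
    push Not at hfin
    refine iInf_le_of_le (g + g') (iInf₂_le_of_le (hg.add hg') (fun ψ => ?_) ?_)
    · rw [LinearMap.add_apply, hT, hT', ← integral_add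
        (integrable_mul_of_morreyFun_ne_top hp hp1 hg hfin.2 ψ)
        (integrable_mul_of_morreyFun_ne_top hp hp1 hg' hfin.1 ψ)]
      simp only [Pi.add_apply, add_mul]
    · refine iSup_le fun x => iSup_le fun R => iSup_le fun hR => ?_
      refine (mul_le_mul_right (eLpNorm_add_le hg.restrict hg'.restrict hp) _).trans ?_
      rw [mul_add]
      refine add_le_add ?_ ?_ <;>
      exact le_iSup_of_le x (le_iSup_of_le R (le_iSup_of_le hR le_rfl))

theorem morreyNorm_neg {n : ℕ} (p : ℝ≥0∞) (μ : ℝ) (T : 𝓢(Space n, ℂ) →ₗ[ℂ] ℂ) :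
    morreyNorm p μ (-T) = morreyNorm p μ T := by
  have key : ∀ T : 𝓢(Space n, ℂ) →ₗ[ℂ] ℂ, morreyNorm p μ (-T) ≤ morreyNorm p μ T := by
    intro T
    unfold morreyNorm
    split_ifs with hp1
    · simp only [le_iInf_iff]
      intro ν hν
      refine iInf₂_le_of_le ⟨ν.var, fun ξ => -ν.phase ξ, ν.temperate, ν.measurable_phase.neg,
        fun ξ => by rw [norm_neg, ν.norm_phase]⟩ (fun ψ => ?_) le_rfl
      simp [RadonMeasure.pair, hν, integral_neg]
    · simp only [le_iInf_iff]
      intro g hg hT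
      refine iInf_le_of_le (-g) (iInf₂_le_of_le hg.neg (fun ψ => ?_) ?_)
      · simp [hT, integral_neg]
      · unfold morreyFun
        simp only [eLpNorm_neg]
        exact le_rfl
  exact le_antisymm (key T) (by simpa using key (-T))

/-! ### Dyadic shells and growth of measures with shell bounds. -/

/-- The number `2^x`. -/
def twoPow (x : ℝ) : ℝ≥0∞ := ENNReal.ofReal ((2 : ℝ) ^ x)

theorem twoPow_add (x y : ℝ) : twoPow (x + y) = twoPow x * twoPow y := by
  rw [twoPow, Real.rpow_add two_pos, ENNReal.ofReal_mul (by positivity)]; rfl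

theorem twoPow_ne_top (x : ℝ) : twoPow x ≠ ∞ := ENNReal.ofReal_ne_top

theorem twoPow_neg_mul (x : ℝ) : twoPow (-x) * twoPow x = 1 := by
  rw [← twoPow_add]; simp [twoPow]

theorem tsum_twoPow_sub_mul (α x : ℝ) :
    ∑' k : ℕ, twoPow (x - k * α) = twoPow x * (1 - twoPow (-α))⁻¹ := by
  have : ∀ k : ℕ, twoPow (x - k * α) = twoPow x * twoPow (-α) ^ k := by
    intro k
    rw [sub_eq_add_neg, twoPow_add]
    congr 1
    rw [twoPow, twoPow, ← ENNReal.ofReal_pow (by positivity), ← Real.rpow_natCast,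
      ← Real.rpow_mul (by norm_num)]
    congr 2; ring
  simp only [this, ENNReal.tsum_mul_left, ENNReal.tsum_geometric]

theorem one_sub_twoPow_inv_ne_top {α : ℝ} (hα : 0 < α) : (1 - twoPow (-α))⁻¹ ≠ ∞ := by
  rw [ENNReal.inv_ne_top]
  refine (tsub_pos_of_lt ?_).ne'
  rw [twoPow, ENNReal.ofReal_lt_one]
  exact Real.rpow_lt_one_of_one_lt_of_neg one_lt_two (by linarith)

/-- The dyadic shell `2^j ≤ |ξ| < 2^(j+1)`. -/
def shell (n : ℕ) (j : ℤ) : Set (Space n) := {ξ | (2 : ℝ) ^ j ≤ ‖ξ‖ ∧ ‖ξ‖ < (2 : ℝ) ^ (j + 1)}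

theorem measurableSet_shell {n : ℕ} (j : ℤ) : MeasurableSet (shell n j) :=
  (measurableSet_le measurable_const measurable_norm).inter
    (measurableSet_lt measurable_norm measurable_const)

theorem exists_mem_shell {n : ℕ} {ξ : Space n} (h : ξ ≠ 0) : ∃ j : ℤ, ξ ∈ shell n j :=
  exists_mem_Ico_zpow (norm_pos_iff.2 h) one_lt_two

theorem shell_subset_ball {n : ℕ} (j : ℤ) : shell n j ⊆ Metric.ball 0 ((2 : ℝ) ^ (j + 1)) :=
  fun ξ h => by simpa using h.2

/-- On the shell ‖ξ‖ lies within a factor 2 of 2^j, which 2^|σ| absorbs for either sign of σ. -/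
theorem ofReal_norm_rpow_le_of_mem_shell {n : ℕ} {j : ℤ} {ξ : Space n} (h : ξ ∈ shell n j)
    (σ : ℝ) : ENNReal.ofReal (‖ξ‖ ^ σ) ≤ twoPow |σ| * twoPow (j * σ) := by
  have h0 : (0 : ℝ) < (2 : ℝ) ^ (j : ℝ) := by positivity
  have h1 : (2 : ℝ) ^ (j : ℝ) ≤ ‖ξ‖ := by rw [Real.rpow_intCast]; exact h.1
  have h2 : ‖ξ‖ ≤ 2 * (2 : ℝ) ^ (j : ℝ) := by
    rw [Real.rpow_intCast, mul_comm, ← zpow_add_one₀ two_ne_zero]; exact h.2.le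
  rw [← twoPow_add]
  refine ENNReal.ofReal_le_ofReal ?_
  rw [Real.rpow_add two_pos, Real.rpow_mul two_pos.le]
  rcases le_total 0 σ with hσ | hσ
  · rw [abs_of_nonneg hσ, ← Real.mul_rpow two_pos.le h0.le]
    exact Real.rpow_le_rpow (norm_nonneg _) h2 hσ
  · refine (Real.rpow_le_rpow_of_nonpos h0 h1 hσ).trans (le_mul_of_one_le_left (by positivity) ?_)
    exact Real.one_le_rpow one_le_two (abs_nonneg _)

/-- The measure `m` has no mass at zero and its restriction to the `j`-th shell has Morrey norm at
most `2^(-js) A`. -/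
def ShellBound {n : ℕ} (p : ℝ≥0∞) (μ s : ℝ) (m : Measure (Space n)) (A : ℝ≥0∞) : Prop :=
  m {0} = 0 ∧ ∀ j : ℤ, MorreyLE p μ (m.restrict (shell n j)) (A * twoPow (-(j * s)))

theorem ShellBound.mono {n : ℕ} {p : ℝ≥0∞} {μ s : ℝ} {m m' : Measure (Space n)} {A A' : ℝ≥0∞}
    (h : ShellBound p μ s m A) (hm : m' ≤ m) (hA : A ≤ A') : ShellBound p μ s m' A' :=
  ⟨le_antisymm ((hm _).trans h.1.le) (by simp), fun j =>
    (h.2 j).mono (Measure.restrict_mono le_rfl hm) (by gcongr)⟩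

theorem ShellBound.measure_shell_le {n : ℕ} {p : ℝ≥0∞} {μ : ℝ} (hp : 1 ≤ p) (s : ℝ) :
    ∃ C : NNReal, ∀ (m : Measure (Space n)) (A : ℝ≥0∞), ShellBound p μ s m A →
      ∀ j : ℤ, m (shell n j) ≤ C * A * twoPow (j * (n - (n - μ) / p.toReal - s)) := by
  obtain ⟨D, hD⟩ := MorreyLE.measure_ball_le (n := n) (μ := μ) hp
  set d := (n : ℝ) - (n - μ) / p.toReal with hd
  refine ⟨D * (twoPow d).toNNReal, fun m A h j => ?_⟩
  have h1 := hD _ _ (h.2 j) ((2 : ℝ) ^ (j + 1)) (by positivity)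
  rw [Measure.restrict_apply measurableSet_ball,
    Set.inter_eq_right.2 (shell_subset_ball j)] at h1
  refine h1.trans_eq ?_
  have h2 : ENNReal.ofReal (((2 : ℝ) ^ (j + 1)) ^ d) = twoPow d * twoPow (j * d) := by
    rw [← twoPow_add, twoPow, ← Real.rpow_intCast, ← Real.rpow_mul (by norm_num)]
    congr 2; push_cast; ring
  have h3 : (j : ℝ) * (d - s) = -(j * s) + j * d := by ring
  rw [h2, h3, twoPow_add, ENNReal.coe_mul, ENNReal.coe_toNNReal (twoPow_ne_top _)]
  ring

/-- Up to the null set {0} the ball is a union of shells of index i ≤ j. The i-th contributes a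
multiple of 2^(i(α+σ)), and positivity of α + σ makes the sum towards the origin a convergent
geometric series. -/
theorem ShellBound.lintegral_ball_le {n : ℕ} {p : ℝ≥0∞} {μ : ℝ} (hp : 1 ≤ p) {s σ : ℝ}
    (hσ : 0 < n - (n - μ) / p.toReal - s + σ) :
    ∃ C : NNReal, ∀ (m : Measure (Space n)) (A : ℝ≥0∞), ShellBound p μ s m A →
      ∀ j : ℤ, ∫⁻ z in Metric.ball 0 ((2 : ℝ) ^ (j + 1)), ENNReal.ofReal (‖z‖ ^ σ) ∂m ≤
        C * A * twoPow (j * (n - (n - μ) / p.toReal - s + σ)) := by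
  obtain ⟨D, hD⟩ := ShellBound.measure_shell_le (n := n) (μ := μ) hp s
  set α := (n : ℝ) - (n - μ) / p.toReal - s with hα
  refine ⟨D * (twoPow |σ|).toNNReal * ((1 - twoPow (-(α + σ)))⁻¹).toNNReal, fun m A h j => ?_⟩
  have hsub : Metric.ball (0 : Space n) ((2 : ℝ) ^ (j + 1)) ⊆ {0} ∪ ⋃ k : ℕ, shell n (j - k) := by
    intro z hz
    by_cases h0 : z = 0
    · exact Or.inl h0
    · obtain ⟨i, hi⟩ := exists_mem_shell h0
      have h1 : (2 : ℝ) ^ i < 2 ^ (j + 1) := hi.1.trans_lt (by simpa using hz)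
      have h2 : i < j + 1 := (zpow_lt_zpow_iff_right₀ one_lt_two).1 h1
      refine Or.inr (Set.mem_iUnion.2 ⟨(j - i).toNat, ?_⟩)
      rw [Int.toNat_of_nonneg (by omega)]
      simpa using hi
  have h1 : ∀ i : ℤ, ∫⁻ z in shell n i, ENNReal.ofReal (‖z‖ ^ σ) ∂m ≤
      D * twoPow |σ| * A * twoPow (i * (α + σ)) := by
    intro i
    calc ∫⁻ z in shell n i, ENNReal.ofReal (‖z‖ ^ σ) ∂m
        ≤ ∫⁻ z in shell n i, twoPow |σ| * twoPow (i * σ) ∂m :=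
          setLIntegral_mono' (measurableSet_shell i) fun z hz => ofReal_norm_rpow_le_of_mem_shell hz σ
      _ = twoPow |σ| * twoPow (i * σ) * m (shell n i) := setLIntegral_const _ _
      _ ≤ twoPow |σ| * twoPow (i * σ) * (D * A * twoPow (i * α)) := by gcongr; exact hD m A h i
      _ = D * twoPow |σ| * A * twoPow (i * (α + σ)) := by
          rw [mul_add, twoPow_add]; ring
  calc ∫⁻ z in Metric.ball 0 ((2 : ℝ) ^ (j + 1)), ENNReal.ofReal (‖z‖ ^ σ) ∂m
      ≤ ∫⁻ z in {0} ∪ ⋃ k : ℕ, shell n (j - k), ENNReal.ofReal (‖z‖ ^ σ) ∂m :=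
        lintegral_mono_set hsub
    _ ≤ ∫⁻ z in {0}, ENNReal.ofReal (‖z‖ ^ σ) ∂m +
        ∫⁻ z in ⋃ k : ℕ, shell n (j - k), ENNReal.ofReal (‖z‖ ^ σ) ∂m := lintegral_union_le _ _ _
    _ = ∫⁻ z in ⋃ k : ℕ, shell n (j - k), ENNReal.ofReal (‖z‖ ^ σ) ∂m := by
        rw [setLIntegral_measure_zero _ _ h.1, zero_add]
    _ ≤ ∑' k : ℕ, ∫⁻ z in shell n (j - k), ENNReal.ofReal (‖z‖ ^ σ) ∂m := lintegral_iUnion_le _ _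
    _ ≤ ∑' k : ℕ, D * twoPow |σ| * A * twoPow (j * (α + σ) - k * (α + σ)) := by
        refine ENNReal.tsum_le_tsum fun k => (h1 _).trans_eq ?_
        congr 2; push_cast; ring
    _ = _ := by
        rw [ENNReal.tsum_mul_left, tsum_twoPow_sub_mul]
        push_cast
        rw [ENNReal.coe_toNNReal (twoPow_ne_top _),
          ENNReal.coe_toNNReal (one_sub_twoPow_inv_ne_top hσ)]
        ring

theorem ShellBound.measure_ball_le {n : ℕ} {p : ℝ≥0∞} {μ s : ℝ} (hp : 1 ≤ p)
    (hs : 0 < n - (n - μ) / p.toReal - s) :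
    ∃ C : NNReal, ∀ (m : Measure (Space n)) (A : ℝ≥0∞), ShellBound p μ s m A →
      ∀ R : ℝ, 1 ≤ R → m (Metric.ball 0 R) ≤
        C * A * ENNReal.ofReal (R ^ (n - (n - μ) / p.toReal - s)) := by
  obtain ⟨C, hC⟩ := ShellBound.lintegral_ball_le (n := n) (μ := μ) (s := s) (σ := 0) hp
    (by simpa using hs)
  simp only [Real.rpow_zero, ENNReal.ofReal_one, add_zero, lintegral_one,
    Measure.restrict_apply_univ] at hC
  set α := (n : ℝ) - (n - μ) / p.toReal - s with hα
  refine ⟨C, fun m A h R hR => ?_⟩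
  obtain ⟨j, hj⟩ := exists_mem_Ico_zpow (by linarith : 0 < R) one_lt_two
  refine (measure_mono (Metric.ball_subset_ball hj.2.le)).trans ((hC m A h j).trans ?_)
  gcongr
  refine ENNReal.ofReal_le_ofReal ?_
  rw [Real.rpow_mul two_pos.le, Real.rpow_intCast]
  exact Real.rpow_le_rpow (by positivity) hj.1 hs.le

theorem ShellBound.hasTemperateGrowth {n : ℕ} {p : ℝ≥0∞} {μ s : ℝ} (hp : 1 ≤ p)
    (hs : 0 < n - (n - μ) / p.toReal - s) {m : Measure (Space n)} {A : ℝ≥0∞} (hA : A ≠ ∞)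
    (h : ShellBound p μ s m A) : m.HasTemperateGrowth := by
  obtain ⟨C, hC⟩ := ShellBound.measure_ball_le (n := n) (μ := μ) hp hs
  exact hasTemperateGrowth_of_measure_ball_le (ENNReal.mul_ne_top ENNReal.coe_ne_top hA) (hC m A h)

/-- The measure of a large ball grows polynomially at a rate that depends only on the indices, so a
single seminorm bound on ψ serves all measures m. -/
theorem ShellBound.lintegral_schwartz_le {n : ℕ} {p : ℝ≥0∞} {μ s : ℝ} (hp : 1 ≤ p)
    (hs : 0 < n - (n - μ) / p.toReal - s) (ψ : 𝓢(Space n, ℂ)) :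
    ∃ C : NNReal, ∀ (m : Measure (Space n)) (A : ℝ≥0∞), ShellBound p μ s m A →
      ∫⁻ ξ, ‖ψ ξ‖ₑ ∂m ≤ C * A := by
  obtain ⟨C, hC⟩ := ShellBound.measure_ball_le (n := n) (μ := μ) hp hs
  obtain ⟨N, C', hC'⟩ := exists_lintegral_one_add_norm_rpow_le n (n - (n - μ) / p.toReal - s)
  obtain ⟨c, hc0, hc⟩ := ψ.decay 0 0
  obtain ⟨c', hc0', hc'⟩ := ψ.decay N 0
  refine ⟨(2 ^ N * (c + c')).toNNReal * (C' * C), fun m A h => ?_⟩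
  have h1 : ∀ ξ, ‖ψ ξ‖ₑ ≤ ((2 ^ N * (c + c')).toNNReal : ℝ≥0∞) *
      ENNReal.ofReal ((1 + ‖ξ‖) ^ (-(N : ℝ))) := by
    intro ξ
    have h1 := pow_mul_le_of_le_of_pow_mul_le (k := 0) (l := N) (norm_nonneg ξ)
      (norm_nonneg (ψ ξ)) (by simpa using hc ξ) (by simpa using hc' ξ)
    rw [pow_zero, one_mul] at h1
    rw [← ofReal_norm, ← ENNReal.ofReal, ← ENNReal.ofReal_mul (by positivity)]
    exact ENNReal.ofReal_le_ofReal h1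
  refine (lintegral_mono h1).trans ?_
  rw [lintegral_const_mul' _ _ ENNReal.coe_ne_top]
  refine (mul_le_mul_right (hC' m _ (hC m A h)) _).trans_eq ?_
  push_cast
  ring

/-! ### The convolution estimate. -/

set_option maxHeartbeats 600000 in
/-- The bilinear convolution estimate in Morrey spaces, on dyadic shells. -/
theorem exists_lintegral_conv_le {n : ℕ} {p : ℝ≥0∞} {μ : ℝ} (hp : 1 ≤ p) {s σ : ℝ}
    (h0 : 0 < n - (n - μ) / p.toReal - s) (h1 : 0 < n - (n - μ) / p.toReal - s + σ)
    (h2 : n - (n - μ) / p.toReal - s + σ < s) :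
    ∃ C : NNReal, ∀ (f g : Measure (Space n)) [SFinite f] [SFinite g] (A B : ℝ≥0∞),
      ShellBound p μ s f A → ShellBound p μ s g B →
      ∀ (k : ℤ) (x : Space n) (R : ℝ), 0 < R → ∀ h : Space n → ℝ≥0∞, Measurable h →
        (∀ y, h y ≠ 0 → y ∈ Metric.ball x R) → dualNorm p h ≠ ∞ →
        ∫⁻ z₁, ∫⁻ z₂, ENNReal.ofReal (‖z₁‖ ^ σ) * (shell n k).indicator h (z₁ + z₂) ∂g ∂f ≤
          C * A * B * twoPow (k * (n - (n - μ) / p.toReal - s + σ - s)) *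
            ENNReal.ofReal (R ^ (μ / p.toReal)) * dualNorm p h := by
  obtain ⟨C₁, hC₁⟩ := ShellBound.lintegral_ball_le (n := n) (μ := μ) hp h1
  obtain ⟨C₂, hC₂⟩ := ShellBound.lintegral_ball_le (n := n) (μ := μ) (s := s) (σ := 0) hp
    (by simpa using h0)
  simp only [Real.rpow_zero, ENNReal.ofReal_one, add_zero, lintegral_one,
    Measure.restrict_apply_univ] at hC₂
  set α := (n : ℝ) - (n - μ) / p.toReal - s with hα
  -- δ is the decay rate in the sum over the larger of the two frequencies; its positivity is the
  -- third index condition.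
  set δ := s - (α + σ) with hδ
  have hδ0 : 0 < δ := by linarith
  set G := (1 - twoPow (-δ))⁻¹ with hG
  refine ⟨(C₁ + (twoPow |σ|).toNNReal * C₂) * (twoPow δ).toNNReal * G.toNNReal,
    fun f g _ _ A B hf hg k x R hR h hh hs hd => ?_⟩
  set w : Space n → ℝ≥0∞ := fun z => ENNReal.ofReal (‖z‖ ^ σ) with hw
  have hwm : Measurable w := (measurable_norm.pow_const σ).ennreal_ofReal
  set E := ENNReal.ofReal (R ^ (μ / p.toReal)) * dualNorm p h with hE
  have hadd : Measurable fun z : Space n × Space n => h (z.1 + z.2) := hh.comp measurable_add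
  -- Shifting the test by z moves its ball to centre x - z but changes neither radius nor dual norm,
  -- so the bound is uniform in z.
  have htr : ∀ (m : Measure (Space n)) (D : ℝ≥0∞), ShellBound p μ s m D → ∀ (j : ℤ) (z : Space n),
      ∫⁻ y in shell n j, h (z + y) ∂m ≤ D * twoPow (-(j * s)) * E := by
    intro m D hm j z
    have := hm.2 j (x - z) R hR (fun y => h (z + y)) (hh.comp (measurable_const_add z))
      (fun y hy => by
        have := hs _ hy
        rw [Metric.mem_ball, dist_eq_norm] at this ⊢
        convert this using 2
        abel) (by rwa [dualNorm_translate])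
    rwa [dualNorm_translate, mul_assoc] at this
  let b : ℤ → Set (Space n) := fun j => Metric.ball 0 ((2 : ℝ) ^ (j + 1))
  have hb : ∀ j, MeasurableSet (b j) := fun j => measurableSet_ball
  -- The first term covers ‖z₁‖ ≤ ‖z₂‖ and the second the opposite case. The larger variable lies in
  -- shell j, where the Morrey bound is applied, and the smaller one ranges over the ball of radius
  -- 2^(j+1).
  let u : ℤ → Space n → Space n → ℝ≥0∞ := fun j z₁ z₂ =>
    (b j).indicator w z₁ * (shell n j).indicator (fun y => h (z₁ + y)) z₂ +
      (b j).indicator 1 z₂ * ((shell n j).indicator w z₁ * h (z₁ + z₂))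
  have hpt : ∀ z₁ z₂ : Space n, z₁ ≠ 0 → z₂ ≠ 0 →
      w z₁ * (shell n k).indicator h (z₁ + z₂) ≤ ∑' m : ℕ, u (k - 1 + m) z₁ z₂ := by
    intro z₁ z₂ hz₁ hz₂
    by_cases hk : z₁ + z₂ ∈ shell n k
    swap
    · simp [Set.indicator_of_notMem hk]
    rw [Set.indicator_of_mem hk]
    have hk1 := hk.1
    have hn := norm_add_le z₁ z₂
    -- Since ‖z₁ + z₂‖ ≥ 2^k, the larger of the two norms is at least 2^(k-1), so only shells with j
    -- ≥ k - 1 occur.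
    have hidx : ∀ j : ℤ, (2 : ℝ) ^ k < 2 * 2 ^ (j + 1) → ∃ m : ℕ, k - 1 + m = j := by
      intro j hj
      rw [mul_comm, ← zpow_add_one₀ two_ne_zero, zpow_lt_zpow_iff_right₀ one_lt_two] at hj
      exact ⟨(j - (k - 1)).toNat, by omega⟩
    rcases le_total ‖z₁‖ ‖z₂‖ with hle | hle
    · obtain ⟨j, hj⟩ := exists_mem_shell hz₂
      obtain ⟨m, hm⟩ := hidx j (by have := hj.2; linarith)
      refine le_trans ?_ (ENNReal.le_tsum m)
      rw [hm]
      refine le_trans ?_ le_self_add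
      rw [Set.indicator_of_mem hj, Set.indicator_of_mem]
      simp only [b, Metric.mem_ball, dist_zero_right]
      exact hle.trans_lt hj.2
    · obtain ⟨j, hj⟩ := exists_mem_shell hz₁
      obtain ⟨m, hm⟩ := hidx j (by have := hj.2; linarith)
      refine le_trans ?_ (ENNReal.le_tsum m)
      rw [hm]
      refine le_trans ?_ le_add_self
      rw [Set.indicator_of_mem hj, Set.indicator_of_mem, Pi.one_apply, one_mul]
      simp only [b, Metric.mem_ball, dist_zero_right]
      exact hle.trans_lt hj.2
  have hum : ∀ j, Measurable (Function.uncurry (u j)) := by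
    intro j
    refine Measurable.add ?_ ?_
    · refine ((hwm.indicator (hb j)).comp measurable_fst).mul ?_
      have : (fun z : Space n × Space n => (shell n j).indicator (fun y => h (z.1 + y)) z.2) =
          (Prod.snd ⁻¹' shell n j).indicator fun z : Space n × Space n => h (z.1 + z.2) := by
        ext z; rfl
      rw [this]
      exact hadd.indicator (measurable_snd (measurableSet_shell j))
    · exact ((measurable_one.indicator (hb j)).comp measurable_snd).mul
        (((hwm.indicator (measurableSet_shell j)).comp measurable_fst).mul hadd)
  have hne : ∀ m : Measure (Space n), m {0} = 0 → ∀ᵐ z ∂m, z ≠ 0 := fun m hm => by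
    rw [ae_iff]; simpa using hm
  have hu : ∀ j : ℤ, ∫⁻ z₁, ∫⁻ z₂, u j z₁ z₂ ∂g ∂f ≤
      (C₁ + twoPow |σ| * C₂) * A * B * E * twoPow (-(j * δ)) := by
    intro j
    have hsplit : ∫⁻ z₁, ∫⁻ z₂, u j z₁ z₂ ∂g ∂f =
        ∫⁻ z₁, ∫⁻ z₂, (b j).indicator w z₁ * (shell n j).indicator (fun y => h (z₁ + y)) z₂ ∂g ∂f +
        ∫⁻ z₁, ∫⁻ z₂, (b j).indicator 1 z₂ * ((shell n j).indicator w z₁ * h (z₁ + z₂)) ∂g ∂f := by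
      have hm2 : Measurable fun z : Space n × Space n =>
          (b j).indicator 1 z.2 * ((shell n j).indicator w z.1 * h (z.1 + z.2)) :=
        ((measurable_one.indicator (hb j)).comp measurable_snd).mul
          (((hwm.indicator (measurableSet_shell j)).comp measurable_fst).mul hadd)
      rw [← lintegral_add_right _ hm2.lintegral_prod_right']
      refine lintegral_congr fun z₁ => ?_
      have hm3 : Measurable fun z₂ => (b j).indicator 1 z₂ *
          ((shell n j).indicator w z₁ * h (z₁ + z₂)) :=
        (measurable_one.indicator (hb j)).mul ((hh.comp (measurable_const_add z₁)).const_mul _)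
      rw [← lintegral_add_right _ hm3]
    have hA1 : ∫⁻ z₁, ∫⁻ z₂, (b j).indicator w z₁ *
        (shell n j).indicator (fun y => h (z₁ + y)) z₂ ∂g ∂f ≤
        (C₁ * A * twoPow (j * (α + σ))) * (B * twoPow (-(j * s)) * E) := by
      calc _ ≤ ∫⁻ z₁, (b j).indicator w z₁ * (B * twoPow (-(j * s)) * E) ∂f := by
            refine lintegral_mono fun z₁ => ?_
            have hm3 : Measurable fun y => h (z₁ + y) := hh.comp (measurable_const_add z₁)
            rw [lintegral_const_mul _ (hm3.indicator (measurableSet_shell j)), lintegral_indicator (measurableSet_shell j)]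
            gcongr
            exact htr g B hg j z₁
        _ = (∫⁻ z₁ in b j, w z₁ ∂f) * (B * twoPow (-(j * s)) * E) := by
            rw [lintegral_mul_const _ (hwm.indicator (hb j)), lintegral_indicator (hb j)]
        _ ≤ _ := by gcongr; exact hC₁ f A hf j
    have hA2 : ∫⁻ z₁, ∫⁻ z₂, (b j).indicator 1 z₂ *
        ((shell n j).indicator w z₁ * h (z₁ + z₂)) ∂g ∂f ≤
        (C₂ * B * twoPow (j * α)) * (twoPow |σ| * twoPow (j * σ) * (A * twoPow (-(j * s)) * E)) := by
      -- Here z₁ is the larger variable, so it must be integrated first for the Morrey bound of f to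
      -- apply with z₂ frozen.
      rw [lintegral_lintegral_swap (((measurable_one.indicator (hb j)).comp measurable_snd).mul
        (((hwm.indicator (measurableSet_shell j)).comp measurable_fst).mul hadd)).aemeasurable]
      calc _ ≤ ∫⁻ z₂, (b j).indicator 1 z₂ *
            (twoPow |σ| * twoPow (j * σ) * (A * twoPow (-(j * s)) * E)) ∂g := by
            refine lintegral_mono fun z₂ => ?_
            have hm3 : Measurable fun z₁ => (shell n j).indicator w z₁ * h (z₁ + z₂) :=
              (hwm.indicator (measurableSet_shell j)).mul (hh.comp (measurable_add_const z₂))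
            have hm4 : Measurable fun z₁ => h (z₂ + z₁) := hh.comp (measurable_const_add z₂)
            rw [lintegral_const_mul _ hm3]
            gcongr
            calc ∫⁻ z₁, (shell n j).indicator w z₁ * h (z₁ + z₂) ∂f
                ≤ ∫⁻ z₁, twoPow |σ| * twoPow (j * σ) *
                    (shell n j).indicator (fun z₁ => h (z₂ + z₁)) z₁ ∂f := by
                  refine lintegral_mono fun z₁ => ?_
                  by_cases hz : z₁ ∈ shell n j
                  · rw [Set.indicator_of_mem hz, Set.indicator_of_mem hz, add_comm z₂]
                    gcongr
                    exact ofReal_norm_rpow_le_of_mem_shell hz σ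
                  · simp [Set.indicator_of_notMem hz]
              _ = twoPow |σ| * twoPow (j * σ) * ∫⁻ z₁ in shell n j, h (z₂ + z₁) ∂f := by
                  rw [lintegral_const_mul _ (hm4.indicator (measurableSet_shell j)), lintegral_indicator (measurableSet_shell j)]
              _ ≤ _ := by gcongr; exact htr f A hf j z₂
        _ = g (b j) * (twoPow |σ| * twoPow (j * σ) * (A * twoPow (-(j * s)) * E)) := by
            rw [lintegral_mul_const _ (measurable_one.indicator (hb j)),
              lintegral_indicator_one (hb j)]
        _ ≤ _ := by gcongr; exact hC₂ g B hg j
    rw [hsplit]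
    refine (add_le_add hA1 hA2).trans_eq ?_
    have e1 : twoPow (-(j * δ)) = twoPow (j * (α + σ)) * twoPow (-(j * s)) := by
      rw [← twoPow_add]; congr 1; rw [hδ]; ring
    have e2 : twoPow (j * (α + σ)) = twoPow (j * α) * twoPow (j * σ) := by
      rw [← twoPow_add]; congr 1; ring
    rw [e1, e2]
    ring
  calc ∫⁻ z₁, ∫⁻ z₂, w z₁ * (shell n k).indicator h (z₁ + z₂) ∂g ∂f
      ≤ ∫⁻ z₁, ∫⁻ z₂, ∑' m : ℕ, u (k - 1 + m) z₁ z₂ ∂g ∂f := by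
        refine lintegral_mono_ae ?_
        filter_upwards [hne f hf.1] with z₁ hz₁
        refine lintegral_mono_ae ?_
        filter_upwards [hne g hg.1] with z₂ hz₂
        exact hpt z₁ z₂ hz₁ hz₂
    _ = ∑' m : ℕ, ∫⁻ z₁, ∫⁻ z₂, u (k - 1 + m) z₁ z₂ ∂g ∂f := by
        have hm3 : ∀ m : ℕ, AEMeasurable (fun z₁ => ∫⁻ z₂, u (k - 1 + m) z₁ z₂ ∂g) f :=
          fun m => (hum _).lintegral_prod_right'.aemeasurable
        rw [← lintegral_tsum hm3]
        refine lintegral_congr fun z₁ => ?_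
        exact lintegral_tsum fun m => ((hum _).comp measurable_prodMk_left).aemeasurable
    -- The additional δ in the exponent comes from starting the sum at k - 1.
    _ ≤ ∑' m : ℕ, (C₁ + twoPow |σ| * C₂) * A * B * E * twoPow ((-(k * δ) + δ) - m * δ) := by
        refine ENNReal.tsum_le_tsum fun m => (hu _).trans_eq ?_
        congr 2; push_cast; ring
    _ = _ := by
        rw [ENNReal.tsum_mul_left, tsum_twoPow_sub_mul, twoPow_add]
        push_cast
        rw [ENNReal.coe_toNNReal (twoPow_ne_top _), ENNReal.coe_toNNReal (twoPow_ne_top _),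
          ENNReal.coe_toNNReal (one_sub_twoPow_inv_ne_top hδ0)]
        have : -((k : ℝ) * δ) = k * (α + σ - s) := by rw [hδ]; ring
        rw [this]
        ring

/-! ### Fourier measures of classes modulo polynomials. -/

theorem hat_mkQ {n : ℕ} (f : 𝓢'(Space n, ℂ)) (ψ : testAwayZero n) :
    hat ((polynomials n).mkQ f) ψ = f (ftTest n ψ.1) := rfl

theorem hat_invFourierOf {n : ℕ} {w : Space n → ℂ} (ν : RadonMeasure n) (hw : Measurable w)
    {c : ℝ} (hc : ∀ ξ, ‖w ξ‖ ≤ c) (ψ : testAwayZero n) :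
    hat ((polynomials n).mkQ (invFourierOf w ν)) ψ = ν.pair fun ξ => w ξ * ψ.1 ξ := by
  have := ν.temperate
  have h : MemLp (fun ξ => w ξ * ν.phase ξ) ∞ ν.var :=
    memLp_top_of_bound (hw.mul ν.measurable_phase).aestronglyMeasurable c
      (.of_forall fun ξ => by simpa [ν.norm_phase] using hc ξ)
  rw [hat_mkQ, invFourierOf, dif_pos h]
  show (Lp.toTemperedDistribution (h.toLp _)) (ftTestInv n (ftTest n ψ.1)) = _
  rw [ftTestInv_ftTest, Lp.toTemperedDistribution_apply, RadonMeasure.pair]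
  refine integral_congr_ae ?_
  filter_upwards [h.coeFn_toLp] with ξ hξ
  rw [hξ, smul_eq_mul]
  ring

theorem exists_hat_eq_pair {n : ℕ} (ν : RadonMeasure n) :
    ∃ F : DistModPoly n, ∀ ψ : testAwayZero n, hat F ψ = ν.pair ψ.1 :=
  ⟨_, fun ψ => by
    simpa using hat_invFourierOf ν (w := fun _ => 1) measurable_const (c := 1) (by simp) ψ⟩

theorem isFourierMeasure_fourierMeasure {n : ℕ} {F : DistModPoly n}
    (h : ∃ ν, IsFourierMeasure F ν) : IsFourierMeasure F (fourierMeasure F) := by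
  rw [fourierMeasure, dif_pos h]
  exact h.choose_spec

/-- The representing measures are chosen independently of one another, so the triangle inequality
for total variations rests on uniqueness of the representation. -/
theorem IsFourierMeasure.var_le_add {n : ℕ} {F G H : DistModPoly n} {ν ν' ν'' : RadonMeasure n}
    (hF : IsFourierMeasure F ν) (hG : IsFourierMeasure G ν') (hH : IsFourierMeasure H ν'')
    (h : H = F + G) : ν''.var ≤ ν.var + ν'.var :=
  (RadonMeasure.add_unique ν ν' ν'' hF.1 hG.1 hH.1 fun ψ => by
    rw [← hF.2, ← hG.2, ← hH.2, h, map_add, LinearMap.add_apply]).1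

theorem IsFourierMeasure.pair_add {n : ℕ} {F G H : DistModPoly n} {ν ν' ν'' : RadonMeasure n}
    (hF : IsFourierMeasure F ν) (hG : IsFourierMeasure G ν') (hH : IsFourierMeasure H ν'')
    (h : H = F + G) {f : Space n → ℂ} (hf : Integrable f ν.var) (hf' : Integrable f ν'.var) :
    ν''.pair f = ν.pair f + ν'.pair f :=
  (RadonMeasure.add_unique ν ν' ν'' hF.1 hG.1 hH.1 fun ψ => by
    rw [← hF.2, ← hG.2, ← hH.2, h, map_add, LinearMap.add_apply]).2 f hf hf'

theorem IsFourierMeasure.zero {n : ℕ} : IsFourierMeasure (0 : DistModPoly n) default :=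
  ⟨by show (0 : Measure (Space n)) {0} = 0; simp, fun ψ => by
    show _ = ∫ ξ, _ ∂(0 : Measure (Space n))
    simp⟩

theorem IsFourierMeasure.var_le {n : ℕ} {F : DistModPoly n} {ν ν' : RadonMeasure n}
    (hF : IsFourierMeasure F ν) (hF' : IsFourierMeasure F ν') : ν'.var ≤ ν.var := by
  have h := hF.var_le_add IsFourierMeasure.zero hF' (add_zero F).symm
  have h0 : (default : RadonMeasure n).var = 0 := rfl
  rwa [h0, add_zero] at h

/-! ### The Fourier-Besov-Morrey norm -/

section Norm

variable {n : ℕ} (Φ : LittlewoodPaley n) {p : ℝ≥0∞} {μ s : ℝ}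

/-- The norm sees a class only through its transform away from the origin, so identities between
classes need to be checked only after applying `hat`. -/
theorem fnNorm_congr {F G : DistModPoly n} (h : hat F = hat G) :
    fnNorm Φ p μ s F = fnNorm Φ p μ s G := by
  unfold fnNorm
  rw [h]

theorem fnNorm_add_le (hp : 1 ≤ p) (F G : DistModPoly n) :
    fnNorm Φ p μ s (F + G) ≤ fnNorm Φ p μ s F + fnNorm Φ p μ s G := by
  refine iSup_le fun k => ?_
  rw [map_add, LinearMap.add_comp]
  refine (mul_le_mul_right (morreyNorm_add_le hp μ _ _) _).trans ?_
  rw [mul_add]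
  exact add_le_add
    (le_iSup (fun k : ℤ => ENNReal.ofReal ((2 : ℝ) ^ ((k : ℝ) * s)) *
      morreyNorm p μ (hat F ∘ₗ Φ.cut k)) k)
    (le_iSup (fun k : ℤ => ENNReal.ofReal ((2 : ℝ) ^ ((k : ℝ) * s)) *
      morreyNorm p μ (hat G ∘ₗ Φ.cut k)) k)

theorem fnNorm_neg (F : DistModPoly n) : fnNorm Φ p μ s (-F) = fnNorm Φ p μ s F := by
  unfold fnNorm
  simp only [map_neg, LinearMap.neg_comp, morreyNorm_neg]

theorem fnNorm_sub_comm (F G : DistModPoly n) :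
    fnNorm Φ p μ s (F - G) = fnNorm Φ p μ s (G - F) := by
  rw [← neg_sub, fnNorm_neg]

theorem fnNorm_sub_le (hp : 1 ≤ p) (F G : DistModPoly n) :
    fnNorm Φ p μ s (F - G) ≤ fnNorm Φ p μ s F + fnNorm Φ p μ s G := by
  rw [sub_eq_add_neg, ← fnNorm_neg Φ G]
  exact fnNorm_add_le Φ hp _ _

theorem fnNorm_zero (hp : 1 ≤ p) : fnNorm Φ p μ s (0 : DistModPoly n) = 0 := by
  refine le_antisymm (iSup_le fun k => ?_) (by simp)
  have := morreyNorm_le_of_morreyLE (n := n) (p := p) (μ := μ) (T := 0) hp (m := 0) (A := 0)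
    inferInstance MorreyLE.zero (w := fun _ => 0) measurable_const (c := 0) (by simp) (by simp)
  rw [map_zero, LinearMap.zero_comp, le_antisymm this (by simp)]
  simp

theorem LittlewoodPaley.exists_bound : ∃ c : NNReal, ∀ ξ, ‖Φ.φ ξ‖ ≤ c := by
  obtain ⟨c, hc⟩ := Φ.φ.decay 0 0
  exact ⟨c.toNNReal, fun ξ => (by simpa using hc.2 ξ : ‖Φ.φ ξ‖ ≤ c).trans
    (Real.le_coe_toNNReal c)⟩

/-- The support of φ_k lies in 2^(k-1) < ‖ξ‖ < 2^(k+2), since 3/4 > 1/2 and 8/3 < 4; three shells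
cover it. -/
theorem LittlewoodPaley.mem_shell_of_ne_zero {k j : ℤ} {ξ : Space n}
    (h : Φ.φ ((2 : ℝ) ^ (-k) • ξ) ≠ 0) (hj : ξ ∈ shell n j) : j ∈ Finset.Icc (k - 1) (k + 1) := by
  have h1 := Φ.support _ h
  have hk : (0 : ℝ) < 2 ^ k := by positivity
  rw [norm_smul, norm_zpow, Real.norm_two, zpow_neg, inv_mul_eq_div, le_div_iff₀ hk,
    div_le_iff₀ hk] at h1
  have h2 : (2 : ℝ) ^ j < 2 ^ (k + 2) := by
    rw [zpow_add₀ two_ne_zero]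
    have := hj.1
    norm_num
    linarith
  have h3 : (2 : ℝ) ^ (k - 1) < 2 ^ (j + 1) := by
    rw [zpow_sub_one₀ two_ne_zero]
    have := hj.2
    linarith
  rw [zpow_lt_zpow_iff_right₀ one_lt_two] at h2 h3
  rw [Finset.mem_Icc]
  omega

theorem LittlewoodPaley.sum_eq_one_of_mem_shell {j : ℤ} {ξ : Space n} (hj : ξ ∈ shell n j)
    {S : Finset ℤ} (hS : Finset.Icc (j - 1) (j + 1) ⊆ S) :
    ∑ k ∈ S, Φ.φ ((2 : ℝ) ^ (-k) • ξ) = 1 := by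
  have h0 : ξ ≠ 0 := by
    rintro rfl
    have := hj.1
    rw [norm_zero] at this
    have : (0 : ℝ) < 2 ^ j := by positivity
    linarith
  refine (hasSum_sum_of_ne_finset_zero fun k hk => ?_).unique (Φ.sum_eq_one ξ h0)
  by_contra h
  have := Φ.mem_shell_of_ne_zero h hj
  rw [Finset.mem_Icc] at this
  exact hk (hS (Finset.mem_Icc.2 ⟨by omega, by omega⟩))

theorem restrict_biUnion_finset_le {X ι : Type*} [MeasurableSpace X] (m : Measure X)
    (S : Finset ι) (E : ι → Set X) : m.restrict (⋃ i ∈ S, E i) ≤ ∑ i ∈ S, m.restrict (E i) := by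
  classical
  induction S using Finset.induction_on with
  | empty => simp
  | insert i S hi ih =>
    rw [Finset.set_biUnion_insert, Finset.sum_insert hi]
    refine (Measure.restrict_union_le _ _).trans ?_
    gcongr

/-- The piece φ_k F̂ lives on the shells k - 1, k, k + 1, so its norm is bounded by three shell
bounds. The weights 2^(-is) with |i| ≤ 1 account for the change of index. -/
theorem exists_fnNorm_le_of_shellBound (hp : 1 ≤ p) :
    ∃ C : NNReal, ∀ (F : DistModPoly n) (ν : RadonMeasure n) (A : ℝ≥0∞),
      (∀ ψ : testAwayZero n, hat F ψ = ν.pair ψ.1) → ShellBound p μ s ν.var A →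
      fnNorm Φ p μ s F ≤ C * A := by
  obtain ⟨c, hc⟩ := Φ.exists_bound
  refine ⟨c * (∑ i ∈ Finset.Icc (-1 : ℤ) 1, twoPow (-(i * s))).toNNReal, fun F ν A hF hν => ?_⟩
  have hft : ∑ i ∈ Finset.Icc (-1 : ℤ) 1, twoPow (-(i * s)) ≠ ∞ :=
    ENNReal.sum_ne_top.2 fun i _ => twoPow_ne_top _
  refine iSup_le fun k => ?_
  set U : Set (Space n) := ⋃ i ∈ Finset.Icc (k - 1) (k + 1), shell n i with hU
  have hUm : MeasurableSet U := Finset.measurableSet_biUnion _ fun i _ => measurableSet_shell i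
  have hM : MorreyLE p μ (ν.var.restrict U)
      (A * twoPow (-(k * s)) * ∑ i ∈ Finset.Icc (-1 : ℤ) 1, twoPow (-(i * s))) := by
    refine (MorreyLE.finset_sum (Finset.Icc (k - 1) (k + 1)) fun i _ => hν.2 i).mono
      (restrict_biUnion_finset_le _ _ _) ?_
    rw [Finset.mul_sum]
    refine le_of_eq (Finset.sum_bij (fun i _ => i - k) ?_ ?_ ?_ ?_)
    · intro i hi; rw [Finset.mem_Icc] at hi ⊢; omega
    · intro i _ j _ h; simpa using h
    · intro i hi; rw [Finset.mem_Icc] at hi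
      exact ⟨i + k, by rw [Finset.mem_Icc]; omega, by ring⟩
    · intro i _
      rw [mul_assoc, ← twoPow_add]
      congr 2; push_cast; ring
  have hpm : Measurable fun ξ => Φ.piece k ξ * ν.phase ξ :=
    (Φ.piece k).continuous.measurable.mul ν.measurable_phase
  have h1 := morreyNorm_le_of_morreyLE hp (T := hat F ∘ₗ Φ.cut k)
    (hasTemperateGrowth_mono Measure.restrict_le_self ν.temperate) hM (w := fun ξ =>
      Φ.piece k ξ * ν.phase ξ) hpm (c := c) (fun ξ => by
        rw [norm_mul, ν.norm_phase, mul_one, Φ.piece_apply]; exact hc _) (fun ψ => by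
    rw [LinearMap.comp_apply, hF, RadonMeasure.pair]
    have h0 : ∀ᵐ ξ ∂ν.var, ξ ≠ 0 := by rw [ae_iff]; simpa using hν.1
    rw [← integral_indicator hUm]
    refine integral_congr_ae ?_
    filter_upwards [h0] with ξ hξ
    rw [Φ.cut_apply]
    by_cases hu : ξ ∈ U
    · rw [Set.indicator_of_mem hu, Φ.piece_apply]; ring
    · rw [Set.indicator_of_notMem hu]
      have : Φ.φ ((2 : ℝ) ^ (-k) • ξ) = 0 := by
        by_contra h
        obtain ⟨j, hj⟩ := exists_mem_shell hξ
        exact hu (Set.mem_biUnion (Φ.mem_shell_of_ne_zero h hj) hj)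
      rw [this]
      simp)
  refine (mul_le_mul_right h1 _).trans_eq ?_
  show twoPow (k * s) * _ = _
  push_cast
  rw [ENNReal.coe_toNNReal hft]
  calc _ = (twoPow (-(k * s)) * twoPow (k * s)) *
      (c * (∑ i ∈ Finset.Icc (-1 : ℤ) 1, twoPow (-(i * s))) * A) := by ring
    _ = _ := by rw [twoPow_neg_mul, one_mul]

end Norm

/-! ### From finite norm to a dominating measure. -/

/-- Test functions vanishing near zero are limits, in the Schwartz space, of test functions with
compact support away from zero that they dominate. -/
theorem exists_tendsto_hasCompactSupport {n : ℕ} (ψ : testAwayZero n) :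
    ∃ χ : ℕ → testAwayZero n, Tendsto (fun N => (χ N).1) atTop (𝓝 ψ.1) ∧
      (∀ N ξ, ‖(χ N).1 ξ‖ ≤ ‖ψ.1 ξ‖) ∧ ∀ N, HasCompactSupport ((χ N).1 : Space n → ℂ) := by
  let b : ContDiffBump (0 : Space n) := ⟨1, 2, one_pos, one_lt_two⟩
  let β : Space n → ℂ := fun x => (b x : ℂ)
  have hβs : ContDiff ℝ ((⊤ : ℕ∞) : WithTop ℕ∞) β :=
    Complex.ofRealCLM.contDiff.comp b.contDiff
  have hβc : HasCompactSupport β := b.hasCompactSupport.comp_left (g := Complex.ofReal) rfl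
  let r : ℕ → ℝ := fun N => ((N : ℝ) + 1)⁻¹
  have hr0 : ∀ N, 0 < r N := fun N => by positivity
  have hr1 : ∀ N, r N ≤ 1 := fun N => inv_le_one_of_one_le₀ (by simp)
  let βN : ℕ → Space n → ℂ := fun N x => β (r N • x)
  have hβNs : ∀ N, ContDiff ℝ ((⊤ : ℕ∞) : WithTop ℕ∞) (βN N) := fun N =>
    hβs.comp (contDiff_const_smul _)
  have hβNc : ∀ N, HasCompactSupport (βN N) := fun N => hβc.comp_smul (hr0 N).ne'
  have hprod : ∀ N, HasCompactSupport fun x => βN N x * ψ.1 x := fun N => (hβNc N).mul_right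
  have hprods : ∀ N, ContDiff ℝ ((⊤ : ℕ∞) : WithTop ℕ∞) fun x => βN N x * ψ.1 x := fun N =>
    (hβNs N).mul ψ.1.smooth'
  let χ : ℕ → testAwayZero n := fun N => ⟨(hprod N).toSchwartzMap (hprods N), fun h =>
    ψ.2 (closure_mono (Function.support_mul_subset_right (βN N) ψ.1) h)⟩
  have hχ : ∀ N x, (χ N).1 x = βN N x * ψ.1 x := fun N x => rfl
  refine ⟨χ, ?_, fun N x => ?_, fun N => hprod N⟩
  -- The derivatives are bounded uniformly in N because the dilation factor r N is at most 1.
  · have hD : ∀ i : ℕ, ∃ c : ℝ, 0 ≤ c ∧ ∀ N x, ‖iteratedFDeriv ℝ i (fun x => βN N x - 1) x‖ ≤ c := by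
      intro i
      let B := hβc.toSchwartzMap hβs
      obtain ⟨c, hc0, hc⟩ := B.decay 0 i
      refine ⟨c + 1, by linarith, fun N x => ?_⟩
      have h1 : iteratedFDeriv ℝ i (fun x => βN N x - 1) x =
          iteratedFDeriv ℝ i (βN N) x - iteratedFDeriv ℝ i (fun _ : Space n => (1 : ℂ)) x :=
        fun_iteratedFDeriv_sub_apply ((hβNs N).of_le (by exact_mod_cast le_top)).contDiffAt
          contDiffAt_const
      have h2 : ‖iteratedFDeriv ℝ i (βN N) x‖ ≤ c := by
        have : iteratedFDeriv ℝ i (βN N) x = (r N) ^ i • iteratedFDeriv ℝ i β (r N • x) :=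
          congrFun (iteratedFDeriv_comp_const_smul (r N) (hβs.of_le (by exact_mod_cast le_top))) x
        rw [this, norm_smul, Real.norm_of_nonneg (by have := hr0 N; positivity)]
        have h3 : ‖iteratedFDeriv ℝ i β (r N • x)‖ ≤ c := by
          have := hc (r N • x)
          rw [pow_zero, one_mul] at this
          exact this
        exact (mul_le_of_le_one_left (norm_nonneg _)
          (pow_le_one₀ (hr0 N).le (hr1 N))).trans h3
      have h3 : ‖iteratedFDeriv ℝ i (fun _ : Space n => (1 : ℂ)) x‖ ≤ 1 := by
        rcases Nat.eq_zero_or_pos i with rfl | hi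
        · simp
        · rw [iteratedFDeriv_const_of_ne hi.ne']; simp
      rw [h1]
      exact (norm_sub_le _ _).trans (add_le_add h2 h3)
    choose c hc0 hc using hD
    refine ((schwartz_withSeminorms ℝ (Space n) ℂ).tendsto_nhds_atTop _ _).2 ?_
    rintro ⟨k, l⟩ ε hε
    let S : ℝ := ∑ i ∈ Finset.range (l + 1), (l.choose i : ℝ) * c i *
      SchwartzMap.seminorm ℝ (k + 1) (l - i) ψ.1
    have hS0 : 0 ≤ S := Finset.sum_nonneg fun i _ => by
      have := hc0 i
      have := apply_nonneg (SchwartzMap.seminorm ℝ (k + 1) (l - i)) ψ.1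
      positivity
    obtain ⟨N₀, hN₀⟩ := exists_nat_gt (S / ε)
    refine ⟨N₀, fun N hN => ?_⟩
    -- The difference vanishes for ‖x‖ < N + 1; elsewhere one more power of ‖x‖, taken from the
    -- decay of ψ, pays for the factor 1/(N+1).
    have hbound : ∀ x, ‖x‖ ^ k * ‖iteratedFDeriv ℝ l ((χ N).1 - ψ.1 : 𝓢(Space n, ℂ)) x‖ ≤
        S / (N + 1) := by
      intro x
      have hN1 : (0 : ℝ) < N + 1 := by positivity
      have hfun : (((χ N).1 - ψ.1 : 𝓢(Space n, ℂ)) : Space n → ℂ) =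
          fun x => (βN N x - 1) * ψ.1 x := by
        ext x
        rw [sub_apply, hχ]
        ring
      rw [hfun]
      rcases lt_or_ge ‖x‖ (N + 1) with hx | hx
      · have : (fun x => (βN N x - 1) * ψ.1 x) =ᶠ[𝓝 x] fun _ => 0 := by
          filter_upwards [(isOpen_lt continuous_norm continuous_const).mem_nhds hx] with y hy
          have : b (r N • y) = 1 := by
            refine b.one_of_mem_closedBall ?_
            rw [mem_closedBall_zero_iff, norm_smul, Real.norm_of_nonneg (hr0 N).le]
            show ((N : ℝ) + 1)⁻¹ * ‖y‖ ≤ 1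
            rw [inv_mul_le_iff₀ hN1, mul_one]
            exact le_of_lt hy
          show (((b (r N • y) : ℝ) : ℂ) - 1) * ψ.1 y = 0
          rw [this]; simp
        rw [(this.iteratedFDeriv ℝ l).eq_of_nhds]
        simp only [iteratedFDeriv_fun_zero, Pi.zero_apply, norm_zero, mul_zero]
        positivity
      · have h1 := norm_iteratedFDeriv_mul_le (𝕜 := ℝ) (f := fun x => βN N x - 1) (g := ψ.1)
          ((hβNs N).sub contDiff_const) ψ.1.smooth' x (n := l) (by exact_mod_cast le_top)
        rw [le_div_iff₀ hN1]
        calc ‖x‖ ^ k * ‖iteratedFDeriv ℝ l (fun x => (βN N x - 1) * ψ.1 x) x‖ * (N + 1)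
            ≤ ‖x‖ ^ k * (∑ i ∈ Finset.range (l + 1), (l.choose i : ℝ) *
                ‖iteratedFDeriv ℝ i (fun x => βN N x - 1) x‖ *
                ‖iteratedFDeriv ℝ (l - i) ψ.1 x‖) * ‖x‖ := by gcongr
          _ = ∑ i ∈ Finset.range (l + 1), (l.choose i : ℝ) *
                ‖iteratedFDeriv ℝ i (fun x => βN N x - 1) x‖ *
                (‖x‖ ^ (k + 1) * ‖iteratedFDeriv ℝ (l - i) ψ.1 x‖) := by
              rw [Finset.mul_sum, Finset.sum_mul]
              refine Finset.sum_congr rfl fun i _ => ?_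
              ring
          _ ≤ S := by
              refine Finset.sum_le_sum fun i _ => ?_
              gcongr
              · have := hc0 i; positivity
              · exact hc i N x
              · exact SchwartzMap.le_seminorm ℝ (k + 1) (l - i) ψ.1 x
    have hN' : (N₀ : ℝ) ≤ N := by exact_mod_cast hN
    refine (SchwartzMap.seminorm_le_bound ℝ k l _ (by positivity) hbound).trans_lt ?_
    rw [div_lt_iff₀ (by positivity)]
    rw [div_lt_iff₀ hε] at hN₀
    nlinarith
  · rw [hχ, norm_mul]
    refine mul_le_of_le_one_left (norm_nonneg _) ?_
    show ‖((b (r N • x) : ℝ) : ℂ)‖ ≤ 1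
    rw [Complex.norm_real, Real.norm_of_nonneg b.nonneg]
    exact b.le_one

section Forward

variable {n : ℕ} (Φ : LittlewoodPaley n) {p : ℝ≥0∞} {μ s : ℝ}

/-- The support meets only shells with I ≤ j ≤ J, where the finitely many pieces near these indices
already sum to 1; the margin 3 is more than enough. -/
theorem exists_finset_cut_eq (χ : testAwayZero n)
    (hχ : HasCompactSupport (χ.1 : Space n → ℂ)) :
    ∃ S : Finset ℤ, χ = ∑ k ∈ S, Φ.cut k χ.1 := by
  obtain ⟨R, hR⟩ := hχ.isCompact.isBounded.exists_norm_le
  obtain ⟨r, hr0, hr⟩ := Metric.isOpen_iff.1 (isClosed_tsupport (χ.1 : Space n → ℂ)).isOpen_compl 0 χ.2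
  obtain ⟨J, hJ⟩ := exists_mem_Ico_zpow (by positivity : (0 : ℝ) < |R| + 1) one_lt_two
  obtain ⟨I, hI⟩ := exists_mem_Ico_zpow hr0 one_lt_two
  refine ⟨Finset.Icc (I - 3) (J + 3), ?_⟩
  ext ξ
  have hsum : (∑ k ∈ Finset.Icc (I - 3) (J + 3), Φ.cut k χ.1).1 ξ =
      ∑ k ∈ Finset.Icc (I - 3) (J + 3), Φ.φ ((2 : ℝ) ^ (-k) • ξ) * χ.1 ξ := by
    rw [Submodule.coe_sum, sum_apply]
    exact Finset.sum_congr rfl fun k _ => Φ.cut_apply k χ.1 ξ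
  rw [hsum, ← Finset.sum_mul]
  by_cases h0 : χ.1 ξ = 0
  · rw [h0, mul_zero]
  have hmem : ξ ∈ tsupport (χ.1 : Space n → ℂ) := subset_tsupport _ h0
  have h1 := hR ξ hmem
  have h2 : r ≤ ‖ξ‖ := by
    by_contra h
    exact hr (by simpa using h) hmem
  obtain ⟨j, hj⟩ := exists_mem_shell (norm_pos_iff.1 (hr0.trans_le h2))
  have h3 : (2 : ℝ) ^ j < 2 ^ (J + 1) := by
    have := hj.1; have := hJ.2; have := le_abs_self R; linarith
  have h4 : (2 : ℝ) ^ I < 2 ^ (j + 1) := by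
    have := hj.2; have := hI.1; linarith
  rw [zpow_lt_zpow_iff_right₀ one_lt_two] at h3 h4
  rw [Φ.sum_eq_one_of_mem_shell hj (Finset.Icc_subset_Icc (by omega) (by omega)), one_mul]

theorem LittlewoodPaley.apply_zero : Φ.φ (0 : Space n) = 0 := by
  by_contra h
  have := (Φ.support 0 h).1
  norm_num at this

/-- The Fourier transform of a distribution of finite norm is bounded by a positive measure of
the corresponding Morrey norm. -/
theorem exists_shellBound_of_fnNorm_lt (hp : 1 ≤ p) (hs : 0 < n - (n - μ) / p.toReal - s) :
    ∃ C : NNReal, ∀ (F : DistModPoly n) (A : ℝ≥0∞), A ≠ ∞ → fnNorm Φ p μ s F < A →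
      ∃ m : Measure (Space n), ShellBound p μ s m (C * A) ∧ m.HasTemperateGrowth ∧
        ∀ ψ : testAwayZero n, ‖hat F ψ‖ ≤ ∫ ξ, ‖ψ.1 ξ‖ ∂m := by
  obtain ⟨c, hc⟩ := Φ.exists_bound
  set D := ∑ i ∈ Finset.Icc (-2 : ℤ) 2, twoPow (-(i * s)) with hD
  have hDt : D ≠ ∞ := ENNReal.sum_ne_top.2 fun i _ => twoPow_ne_top _
  refine ⟨3 * c * D.toNNReal, fun F A hA hF => ?_⟩
  have hlt : ∀ k : ℤ, morreyNorm p μ (hat F ∘ₗ Φ.cut k) < A * twoPow (-(k * s)) := by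
    intro k
    by_contra h
    rw [not_lt] at h
    refine absurd hF (not_lt.2 ?_)
    calc A = twoPow (k * s) * (A * twoPow (-(k * s))) := by
          rw [mul_left_comm, mul_comm (twoPow _), twoPow_neg_mul, mul_one]
      _ ≤ twoPow (k * s) * morreyNorm p μ (hat F ∘ₗ Φ.cut k) := by gcongr
      _ ≤ _ := le_iSup (fun k : ℤ => ENNReal.ofReal ((2 : ℝ) ^ ((k : ℝ) * s)) *
          morreyNorm p μ (hat F ∘ₗ Φ.cut k)) k
  choose M hM hMT using fun k => exists_morreyLE_of_morreyNorm_lt hp (hlt k)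
  let V : ℤ → Set (Space n) := fun k => ⋃ i ∈ Finset.Icc (k - 2) (k + 2), shell n i
  have hVm : ∀ k, MeasurableSet (V k) := fun k =>
    Finset.measurableSet_biUnion _ fun i _ => measurableSet_shell i
  have hdisj : ∀ {i j : ℤ} {ξ : Space n}, ξ ∈ shell n i → ξ ∈ shell n j → i = j := by
    intro i j ξ hi hj
    have h1 := hi.1.trans_lt hj.2
    have h2 := hj.1.trans_lt hi.2
    rw [zpow_lt_zpow_iff_right₀ one_lt_two] at h1 h2
    omega
  -- Restriction to `V k` leaves at most five terms on each shell. The factor 3c bounds the sum of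
  -- three neighbouring cut-offs used below.
  set m : Measure (Space n) := Measure.sum fun k : ℤ => (3 * c : ℝ≥0∞) • (M k).restrict (V k) with hm
  have hm0 : m {0} = 0 := by
    rw [hm, Measure.sum_apply _ (measurableSet_singleton 0), ENNReal.tsum_eq_zero]
    intro k
    rw [Measure.smul_apply, Measure.restrict_apply (measurableSet_singleton 0)]
    have : ({0} : Set (Space n)) ∩ V k = ∅ := by
      ext ξ
      simp only [Set.mem_inter_iff, Set.mem_singleton_iff, Set.mem_empty_iff_false, iff_false,
        not_and]
      rintro rfl h
      obtain ⟨i, -, hi⟩ := Set.mem_iUnion₂.1 h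
      have h1 := hi.1
      rw [norm_zero] at h1
      have : (0 : ℝ) < 2 ^ i := by positivity
      linarith
    simp [this]
  have hsb : ShellBound p μ s m ((3 * c * D.toNNReal : NNReal) * A) := by
    refine ⟨hm0, fun j => ?_⟩
    have hle : m.restrict (shell n j) ≤
        ∑ k ∈ Finset.Icc (j - 2) (j + 2), (3 * c : ℝ≥0∞) • M k := by
      refine Measure.le_iff.2 fun E hE => ?_
      rw [Measure.restrict_apply hE, hm, Measure.sum_apply _ (hE.inter (measurableSet_shell j)),
        Measure.finsetSum_apply, tsum_eq_sum (s := Finset.Icc (j - 2) (j + 2))]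
      · refine Finset.sum_le_sum fun k _ => ?_
        rw [Measure.smul_apply, Measure.smul_apply]
        gcongr
        · exact Measure.restrict_le_self
        · exact Set.inter_subset_left
      · intro k hk
        rw [Measure.smul_apply, Measure.restrict_apply (hE.inter (measurableSet_shell j))]
        have : E ∩ shell n j ∩ V k = ∅ := by
          ext ξ
          simp only [Set.mem_inter_iff, Set.mem_empty_iff_false, iff_false, not_and]
          rintro ⟨-, h1⟩ h2
          obtain ⟨i, hi, hi'⟩ := Set.mem_iUnion₂.1 h2
          have := hdisj hi' h1
          subst this
          rw [Finset.mem_Icc] at hi hk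
          omega
        simp [this]
    refine (MorreyLE.finset_sum _ fun k _ => (hM k).smul (3 * c : ℝ≥0∞)).mono hle ?_
    have h1 : ∑ k ∈ Finset.Icc (j - 2) (j + 2), twoPow (-(k * s)) = twoPow (-(j * s)) * D := by
      rw [hD, Finset.mul_sum]
      refine Finset.sum_bij (fun i _ => i - j) ?_ ?_ ?_ ?_
      · intro i hi; rw [Finset.mem_Icc] at hi ⊢; omega
      · intro i _ j _ h; simpa using h
      · intro i hi; rw [Finset.mem_Icc] at hi
        exact ⟨i + j, by rw [Finset.mem_Icc]; omega, by ring⟩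
      · intro i _
        rw [← twoPow_add]
        congr 1; push_cast; ring
    rw [← Finset.mul_sum, ← Finset.mul_sum, h1]
    push_cast
    rw [ENNReal.coe_toNNReal hDt]
    apply le_of_eq
    ring
  have ht : m.HasTemperateGrowth := hsb.hasTemperateGrowth hp hs
    (ENNReal.mul_ne_top ENNReal.coe_ne_top hA)
  have hcomp : ∀ χ : testAwayZero n, HasCompactSupport (χ.1 : Space n → ℂ) →
      ‖hat F χ‖ₑ ≤ ∫⁻ ξ, ‖χ.1 ξ‖ₑ ∂m := by
    intro χ hχ
    obtain ⟨S, hS⟩ := exists_finset_cut_eq Φ χ hχ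
    -- `M k` dominates the k-th piece without localising it. As φ_{k-1} + φ_k + φ_{k+1} = 1 on the
    -- support of φ_k, replacing χ by `θ k` does not change that piece and confines the majorant to
    -- `V k`.
    let θ : ℤ → 𝓢(Space n, ℂ) := fun k => ∑ i ∈ Finset.Icc (k - 1) (k + 1), (Φ.cut i χ.1).1
    have hθ : ∀ k ξ, θ k ξ = (∑ i ∈ Finset.Icc (k - 1) (k + 1), Φ.φ ((2 : ℝ) ^ (-i) • ξ)) * χ.1 ξ := by
      intro k ξ
      rw [sum_apply, Finset.sum_mul]
      exact Finset.sum_congr rfl fun i _ => Φ.cut_apply i χ.1 ξ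
    have hcut : ∀ k, Φ.cut k χ.1 = Φ.cut k (θ k) := by
      intro k
      ext ξ
      rw [Φ.cut_apply, Φ.cut_apply, hθ]
      by_cases h0 : Φ.φ ((2 : ℝ) ^ (-k) • ξ) = 0
      · simp only [h0, zero_mul]
      · have hξ : ξ ≠ 0 := by rintro rfl; rw [smul_zero] at h0; exact h0 Φ.apply_zero
        obtain ⟨j, hj⟩ := exists_mem_shell hξ
        have h2 : ∑ i ∈ Finset.Icc (k - 2) (k + 2), Φ.φ ((2 : ℝ) ^ (-i) • ξ) = 1 := by
          refine Φ.sum_eq_one_of_mem_shell hj ?_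
          have := Finset.mem_Icc.1 (Φ.mem_shell_of_ne_zero h0 hj)
          exact Finset.Icc_subset_Icc (by omega) (by omega)
        have h3 : ∀ i, i ∉ Finset.Icc (k - 1) (k + 1) → Φ.φ ((2 : ℝ) ^ (-i) • ξ) = 0 := by
          intro i hi
          by_contra h
          have h4 := Φ.support _ h
          have h5 := Φ.support _ h0
          have hpi : (0 : ℝ) < 2 ^ i := by positivity
          have hpk : (0 : ℝ) < 2 ^ k := by positivity
          rw [norm_smul, norm_zpow, Real.norm_two, zpow_neg, inv_mul_eq_div, le_div_iff₀ hpi,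
            div_le_iff₀ hpi] at h4
          rw [norm_smul, norm_zpow, Real.norm_two, zpow_neg, inv_mul_eq_div, le_div_iff₀ hpk,
            div_le_iff₀ hpk] at h5
          have h6 : (2 : ℝ) ^ i < 2 ^ (k + 2) := by
            rw [zpow_add₀ two_ne_zero]; norm_num; linarith
          have h7 : (2 : ℝ) ^ k < 2 ^ (i + 2) := by
            rw [zpow_add₀ two_ne_zero]; norm_num; linarith
          rw [zpow_lt_zpow_iff_right₀ one_lt_two] at h6 h7
          rw [Finset.mem_Icc] at hi
          omega
        rw [Finset.sum_subset (Finset.Icc_subset_Icc (by omega : k - 2 ≤ k - 1)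
          (by omega : k + 1 ≤ k + 2)) fun i _ hi => h3 i hi, h2, one_mul]
    have hθb : ∀ k ξ, ‖θ k ξ‖ₑ ≤ (V k).indicator (fun ξ => (3 * c : ℝ≥0∞) * ‖χ.1 ξ‖ₑ) ξ := by
      intro k ξ
      rw [hθ, enorm_mul]
      by_cases hV : ξ ∈ V k
      · rw [Set.indicator_of_mem hV]
        gcongr
        refine (enorm_sum_le _ _).trans ?_
        calc ∑ i ∈ Finset.Icc (k - 1) (k + 1), ‖Φ.φ ((2 : ℝ) ^ (-i) • ξ)‖ₑ
            ≤ ∑ i ∈ Finset.Icc (k - 1) (k + 1), (c : ℝ≥0∞) := by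
              refine Finset.sum_le_sum fun i _ => ?_
              rw [← ofReal_norm]
              exact ENNReal.ofReal_le_of_le_toReal (by simpa using hc _)
          _ = 3 * c := by
              rw [Finset.sum_const, Int.card_Icc, nsmul_eq_mul]
              congr 1
              have : (k + 1 + 1 - (k - 1)).toNat = 3 := by omega
              rw [this]; rfl
      · rw [Set.indicator_of_notMem hV]
        have : ∀ i ∈ Finset.Icc (k - 1) (k + 1), Φ.φ ((2 : ℝ) ^ (-i) • ξ) = 0 := by
          intro i hi
          by_contra h0
          have hξ : ξ ≠ 0 := by rintro rfl; rw [smul_zero] at h0; exact h0 Φ.apply_zero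
          obtain ⟨j, hj⟩ := exists_mem_shell hξ
          have := Finset.mem_Icc.1 (Φ.mem_shell_of_ne_zero h0 hj)
          rw [Finset.mem_Icc] at hi
          exact hV (Set.mem_biUnion (by rw [Finset.mem_coe, Finset.mem_Icc]; omega) hj)
        rw [Finset.sum_eq_zero this]
        simp
    have hχm : Measurable fun ξ => ‖χ.1 ξ‖ₑ := χ.1.continuous.measurable.enorm
    have hterm : ∀ k, ‖hat F (Φ.cut k χ.1)‖ₑ ≤
        ∫⁻ ξ, ‖χ.1 ξ‖ₑ ∂((3 * c : ℝ≥0∞) • (M k).restrict (V k)) := by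
      intro k
      rw [hcut k]
      refine (hMT k (θ k)).trans ((lintegral_mono (hθb k)).trans_eq ?_)
      rw [lintegral_indicator (hVm k), lintegral_const_mul _ hχm, lintegral_smul_measure,
        smul_eq_mul]
    calc ‖hat F χ‖ₑ = ‖∑ k ∈ S, hat F (Φ.cut k χ.1)‖ₑ := by
          conv_lhs => rw [hS, map_sum]
      _ ≤ ∑ k ∈ S, ‖hat F (Φ.cut k χ.1)‖ₑ := enorm_sum_le _ _
      _ ≤ ∑ k ∈ S, ∫⁻ ξ, ‖χ.1 ξ‖ₑ ∂((3 * c : ℝ≥0∞) • (M k).restrict (V k)) :=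
          Finset.sum_le_sum fun k _ => hterm k
      _ ≤ ∑' k, ∫⁻ ξ, ‖χ.1 ξ‖ₑ ∂((3 * c : ℝ≥0∞) • (M k).restrict (V k)) := ENNReal.sum_le_tsum S
      _ = ∫⁻ ξ, ‖χ.1 ξ‖ₑ ∂m := by rw [hm, lintegral_sum_measure]
  refine ⟨m, hsb, ht, fun ψ => ?_⟩
  obtain ⟨χ, hχt, hχb, hχc⟩ := exists_tendsto_hasCompactSupport ψ
  have hint : Integrable (ψ.1 : Space n → ℂ) m := ψ.1.integrable
  have h1 : ∀ N, ‖hat F (χ N)‖ ≤ ∫ ξ, ‖ψ.1 ξ‖ ∂m := by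
    intro N
    have h2 : ‖hat F (χ N)‖ₑ ≤ ENNReal.ofReal (∫ ξ, ‖ψ.1 ξ‖ ∂m) := by
      rw [ofReal_integral_norm_eq_lintegral_enorm hint]
      refine (hcomp (χ N) (hχc N)).trans (lintegral_mono fun ξ => ?_)
      rw [← ofReal_norm, ← ofReal_norm]
      exact ENNReal.ofReal_le_ofReal (hχb N ξ)
    rw [← ofReal_norm] at h2
    exact (ENNReal.ofReal_le_ofReal_iff (integral_nonneg fun _ => norm_nonneg _)).1 h2
  -- `hat F` is merely a linear functional; the continuity needed for the limit comes from a
  -- representative f.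
  obtain ⟨f, rfl⟩ := (polynomials n).mkQ_surjective F
  have h3 : Tendsto (fun N => hat ((polynomials n).mkQ f) (χ N)) atTop
      (𝓝 (hat ((polynomials n).mkQ f) ψ)) := by
    simp only [hat_mkQ]
    have hcont : Continuous fun χ : 𝓢(Space n, ℂ) => f (ftTest n χ) :=
      (map_continuous f).comp (ftTest n).continuous
    exact (hcont.tendsto _).comp hχt
  exact le_of_tendsto' h3.norm h1

/-- Every A above the norm gives some representing measure with shell bound C A. By uniqueness its
total variation dominates that of the chosen measure, so A may decrease to the norm. -/
theorem exists_shellBound_fourierMeasure (hp : 1 ≤ p) (hs : 0 < n - (n - μ) / p.toReal - s) :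
    ∃ C : NNReal, ∀ F : DistModPoly n, fnNorm Φ p μ s F ≠ ∞ →
      IsFourierMeasure F (fourierMeasure F) ∧
        ShellBound p μ s (fourierMeasure F).var (C * fnNorm Φ p μ s F) := by
  obtain ⟨C, hC⟩ := exists_shellBound_of_fnNorm_lt Φ hp hs
  refine ⟨C, fun F hF => ?_⟩
  have key : ∀ A : ℝ≥0∞, A ≠ ∞ → fnNorm Φ p μ s F < A →
      ∃ ν, IsFourierMeasure F ν ∧ ShellBound p μ s ν.var (C * A) := by
    intro A hA hlt
    obtain ⟨m, hm, ht, hb⟩ := hC F A hA hlt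
    obtain ⟨ν, hν, hT⟩ := exists_radonMeasure_of_bound ht (hat F) hb
    have := hm.mono hν le_rfl
    exact ⟨ν, ⟨this.1, hT⟩, this⟩
  obtain ⟨A₀, hA₀, hA₀t⟩ := exists_between hF.lt_top
  obtain ⟨ν₀, hν₀, -⟩ := key A₀ hA₀t.ne hA₀
  have hFM := isFourierMeasure_fourierMeasure ⟨ν₀, hν₀⟩
  refine ⟨hFM, hFM.1, fun j => ?_⟩
  rw [mul_right_comm]
  refine MorreyLE.of_forall_lt hF (ENNReal.mul_ne_top ENNReal.coe_ne_top (twoPow_ne_top _))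
    fun A hA => ?_
  obtain ⟨A', hA', hA't⟩ := exists_between hA
  obtain ⟨ν, hν, hb⟩ := key A' (hA't.trans_le le_top).ne hA'
  have := (hb.mono (hν.var_le hFM) le_rfl).2 j
  rw [mul_right_comm] at this
  exact this.mono le_rfl (by gcongr)

end Forward

/-! ### The bilinear flux -/

/-- The image under `(z₁, z₂) ↦ z₁ + z₂` of `|z₁|^σ |z₁ + z₂| f(dz₁) g(dz₂)`. -/
def fluxMeasure {n : ℕ} (σ : ℝ) (f g : Measure (Space n)) : Measure (Space n) :=
  ((f.prod g).withDensity fun z => ENNReal.ofReal (‖z.1‖ ^ σ) * ‖z.1 + z.2‖ₑ).map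
    fun z => z.1 + z.2

theorem measurable_fluxWeight {n : ℕ} (σ : ℝ) :
    Measurable fun z : Space n × Space n => ENNReal.ofReal (‖z.1‖ ^ σ) * ‖z.1 + z.2‖ₑ :=
  ((measurable_fst.norm.pow_const σ).ennreal_ofReal).mul measurable_add.enorm

theorem lintegral_fluxMeasure_prod {n : ℕ} (σ : ℝ) (f g : Measure (Space n))
    {ω : Space n → ℝ≥0∞} (hω : Measurable ω) :
    ∫⁻ y, ω y ∂(fluxMeasure σ f g) =
      ∫⁻ z, ENNReal.ofReal (‖z.1‖ ^ σ) * ‖z.1 + z.2‖ₑ * ω (z.1 + z.2) ∂(f.prod g) := by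
  have hm : Measurable fun z : Space n × Space n => ω (z.1 + z.2) := hω.comp measurable_add
  rw [fluxMeasure, lintegral_map hω measurable_add,
    lintegral_withDensity_eq_lintegral_mul _ (measurable_fluxWeight σ) hm]
  rfl

theorem lintegral_fluxMeasure {n : ℕ} (σ : ℝ) (f g : Measure (Space n)) [SFinite g]
    {ω : Space n → ℝ≥0∞} (hω : Measurable ω) :
    ∫⁻ y, ω y ∂(fluxMeasure σ f g) =
      ∫⁻ z₁, ∫⁻ z₂, ENNReal.ofReal (‖z₁‖ ^ σ) * (‖z₁ + z₂‖ₑ * ω (z₁ + z₂)) ∂g ∂f := by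
  have hm : Measurable fun z : Space n × Space n =>
      ENNReal.ofReal (‖z.1‖ ^ σ) * ‖z.1 + z.2‖ₑ * ω (z.1 + z.2) :=
    (measurable_fluxWeight σ).mul (hω.comp measurable_add)
  rw [lintegral_fluxMeasure_prod σ f g hω, lintegral_prod _ hm.aemeasurable]
  simp only [mul_assoc]

/-- The divergence factor ‖z₁ + z₂‖ is at most 2^(k+1) on shell k, which costs one derivative beyond
the convolution estimate. It also removes any mass at the origin. -/
theorem exists_shellBound_fluxMeasure {n : ℕ} {p : ℝ≥0∞} {μ : ℝ} (hp : 1 ≤ p) {s σ : ℝ}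
    (h0 : 0 < n - (n - μ) / p.toReal - s) (h1 : 0 < n - (n - μ) / p.toReal - s + σ)
    (h2 : n - (n - μ) / p.toReal - s + σ < s) :
    ∃ C : NNReal, ∀ (f g : Measure (Space n)) [SFinite f] [SFinite g] (A B : ℝ≥0∞),
      ShellBound p μ s f A → ShellBound p μ s g B →
      ShellBound p μ (s - (n - (n - μ) / p.toReal - s + σ) - 1) (fluxMeasure σ f g)
        (C * A * B) := by
  obtain ⟨C, hC⟩ := exists_lintegral_conv_le (n := n) (μ := μ) hp h0 h1 h2
  set α := (n : ℝ) - (n - μ) / p.toReal - s + σ with hα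
  refine ⟨(twoPow 1).toNNReal * C, fun f g _ _ A B hf hg => ⟨?_, fun k x R hR h hh hs hd => ?_⟩⟩
  · rw [← lintegral_indicator_one (measurableSet_singleton 0), lintegral_fluxMeasure σ f g
      (measurable_one.indicator (measurableSet_singleton 0))]
    have : ∀ z₁ z₂ : Space n, ENNReal.ofReal (‖z₁‖ ^ σ) *
        (‖z₁ + z₂‖ₑ * ({0} : Set (Space n)).indicator 1 (z₁ + z₂)) = 0 := by
      intro z₁ z₂
      by_cases h : z₁ + z₂ = 0 <;> simp [h]
    simp only [this, lintegral_zero]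
  · rw [← lintegral_indicator (measurableSet_shell k), lintegral_fluxMeasure σ f g
      (hh.indicator (measurableSet_shell k))]
    have hpt : ∀ z₁ z₂ : Space n, ENNReal.ofReal (‖z₁‖ ^ σ) *
        (‖z₁ + z₂‖ₑ * (shell n k).indicator h (z₁ + z₂)) ≤
        twoPow (k + 1) * (ENNReal.ofReal (‖z₁‖ ^ σ) * (shell n k).indicator h (z₁ + z₂)) := by
      intro z₁ z₂
      rw [mul_left_comm (twoPow (k + 1))]
      refine mul_le_mul_right ?_ _
      by_cases hz : z₁ + z₂ ∈ shell n k
      · simp only [Set.indicator_of_mem hz]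
        refine mul_le_mul_left ?_ _
        rw [← ofReal_norm]
        refine ENNReal.ofReal_le_ofReal ?_
        have := hz.2.le
        rw [← Real.rpow_intCast] at this
        exact_mod_cast this
      · simp [Set.indicator_of_notMem hz]
    calc _ ≤ ∫⁻ z₁, ∫⁻ z₂, twoPow (k + 1) *
          (ENNReal.ofReal (‖z₁‖ ^ σ) * (shell n k).indicator h (z₁ + z₂)) ∂g ∂f :=
          lintegral_mono fun z₁ => lintegral_mono fun z₂ => hpt z₁ z₂
      _ = twoPow (k + 1) * ∫⁻ z₁, ∫⁻ z₂,
          ENNReal.ofReal (‖z₁‖ ^ σ) * (shell n k).indicator h (z₁ + z₂) ∂g ∂f := by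
          simp only [lintegral_const_mul' _ _ (twoPow_ne_top _)]
      _ ≤ twoPow (k + 1) * _ := mul_le_mul_right (hC f g A B hf hg k x R hR h hh hs hd) _
      _ = _ := by
          have e : -((k : ℝ) * (s - α - 1)) = k + k * (α - s) := by ring
          rw [e, twoPow_add, twoPow_add]
          push_cast
          rw [ENNReal.coe_toNNReal (twoPow_ne_top _)]
          ring

section Flux

variable {n : ℕ} (a : Fin n → Fin n → ℂ) (P : Fin n → Space n → ℂ)

theorem measurable_velocitySymbol (hPm : ∀ j, Measurable (P j)) (k : Fin n) :
    Measurable (velocitySymbol a P k) := by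
  unfold velocitySymbol
  refine Finset.measurable_sum _ fun j _ => ?_
  refine (Measurable.const_mul ?_ _).mul (hPm j)
  refine Measurable.div ?_ ?_
  · exact (Complex.measurable_ofReal.comp (EuclideanSpace.proj (𝕜 := ℝ) j).continuous.measurable).const_mul _
  · exact Complex.measurable_ofReal.comp (measurable_norm.pow_const 2)

theorem exists_norm_velocitySymbol_le (C β : ℝ) :
    ∃ c : NNReal, ∀ (k : Fin n) (ξ : Space n), ξ ≠ 0 → (∀ j, ‖P j ξ‖ ≤ C * ‖ξ‖ ^ β) →
      ‖velocitySymbol a P k ξ‖ ≤ c * ‖ξ‖ ^ (β - 1) := by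
  refine ⟨∑ k, ∑ j, ‖a j k‖₊ * ‖C‖₊, fun k ξ hξ hP => ?_⟩
  have hξ0 : 0 < ‖ξ‖ := norm_pos_iff.2 hξ
  have h1 : ‖velocitySymbol a P k ξ‖ ≤ ∑ j, ‖a j k‖ * |C| * ‖ξ‖ ^ (β - 1) := by
    refine (norm_sum_le _ _).trans (Finset.sum_le_sum fun j _ => ?_)
    rw [norm_mul, norm_mul, norm_div, norm_mul, Complex.norm_I, one_mul, Complex.norm_real,
      Complex.norm_real, Real.norm_of_nonneg (by positivity : 0 ≤ ‖ξ‖ ^ 2)]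
    have h2 : ‖ξ j‖ / ‖ξ‖ ^ 2 ≤ ‖ξ‖⁻¹ := by
      rw [div_le_iff₀ (by positivity)]
      have := PiLp.norm_apply_le ξ j
      calc ‖ξ j‖ ≤ ‖ξ‖ := this
        _ = ‖ξ‖⁻¹ * ‖ξ‖ ^ 2 := by field_simp
    have h3 : ‖P j ξ‖ ≤ |C| * ‖ξ‖ ^ β := (hP j).trans (by gcongr; exact le_abs_self C)
    calc ‖a j k‖ * (‖ξ j‖ / ‖ξ‖ ^ 2) * ‖P j ξ‖ ≤ ‖a j k‖ * ‖ξ‖⁻¹ * (|C| * ‖ξ‖ ^ β) := by gcongr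
      _ = ‖a j k‖ * |C| * ‖ξ‖ ^ (β - 1) := by
        rw [Real.rpow_sub hξ0, Real.rpow_one]
        field_simp
  refine h1.trans ?_
  rw [← Finset.sum_mul]
  gcongr
  push_cast
  exact Finset.single_le_sum (f := fun k => ∑ j, ‖a j k‖ * ‖C‖)
    (fun k _ => Finset.sum_nonneg fun j _ => by positivity) (Finset.mem_univ k)

variable {a P}

theorem measurable_fluxIntegrand (hPm : ∀ j, Measurable (P j)) (k : Fin n) (F G : DistModPoly n)
    {χ : Space n → ℂ} (hχ : Measurable χ) : Measurable (fluxIntegrand a P k F G χ) := by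
  unfold fluxIntegrand
  have hk : Measurable fun z : Space n × Space n => (((z.1 + z.2) k : ℝ) : ℂ) :=
    Complex.measurable_ofReal.comp
      ((EuclideanSpace.proj (𝕜 := ℝ) k).continuous.measurable.comp measurable_add)
  exact ((hk.const_mul _).mul (hχ.comp measurable_add)).mul
    (((measurable_velocitySymbol a P hPm k).comp measurable_fst).mul
      ((fourierMeasure F).measurable_phase.comp measurable_fst)) |>.mul
      ((fourierMeasure G).measurable_phase.comp measurable_snd)

theorem enorm_fluxIntegrand_le {σ : ℝ} {c : NNReal} {F : DistModPoly n} (G : DistModPoly n)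
    (hv : ∀ᵐ ξ ∂(fourierMeasure F).var, ∀ k, ‖velocitySymbol a P k ξ‖ ≤ c * ‖ξ‖ ^ σ)
    (k : Fin n) (χ : Space n → ℂ) :
    ∀ᵐ z ∂(fourierMeasure F).var.prod (fourierMeasure G).var,
      ‖fluxIntegrand a P k F G χ z‖ₑ ≤
        c * (ENNReal.ofReal (‖z.1‖ ^ σ) * ‖z.1 + z.2‖ₑ * ‖χ (z.1 + z.2)‖ₑ) := by
  filter_upwards [Measure.quasiMeasurePreserving_fst.ae hv] with z hz
  have h1 : ‖fluxIntegrand a P k F G χ z‖ ≤ c * (‖z.1‖ ^ σ * ‖z.1 + z.2‖ * ‖χ (z.1 + z.2)‖) := by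
    unfold fluxIntegrand
    rw [norm_mul, norm_mul, norm_mul, norm_mul, norm_mul, RadonMeasure.norm_phase,
      RadonMeasure.norm_phase, Complex.norm_I, Complex.norm_real, mul_one, mul_one, one_mul]
    have h2 := PiLp.norm_apply_le (z.1 + z.2) k
    calc _ ≤ ‖z.1 + z.2‖ * ‖χ (z.1 + z.2)‖ * (c * ‖z.1‖ ^ σ) := by gcongr; exact hz k
      _ = _ := by ring
  rw [← ofReal_norm, ← ofReal_norm, ← ofReal_norm, ← ENNReal.ofReal_mul (by positivity),
    ← ENNReal.ofReal_mul (by positivity)]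
  refine (ENNReal.ofReal_le_ofReal h1).trans_eq ?_
  rw [ENNReal.ofReal_mul (by positivity), ENNReal.ofReal_coe_nnreal]

theorem lintegral_fluxIntegrand_le {σ : ℝ} {c : NNReal} {F : DistModPoly n} (G : DistModPoly n)
    (hv : ∀ᵐ ξ ∂(fourierMeasure F).var, ∀ k, ‖velocitySymbol a P k ξ‖ ≤ c * ‖ξ‖ ^ σ)
    (k : Fin n) {χ : Space n → ℂ} (hχ : Measurable χ) :
    ∫⁻ z, ‖fluxIntegrand a P k F G χ z‖ₑ ∂(fourierMeasure F).var.prod (fourierMeasure G).var ≤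
      c * ∫⁻ y, ‖χ y‖ₑ ∂fluxMeasure σ (fourierMeasure F).var (fourierMeasure G).var := by
  rw [lintegral_fluxMeasure_prod _ _ _ hχ.enorm, ← lintegral_const_mul' _ _ ENNReal.coe_ne_top]
  exact lintegral_mono_ae (enorm_fluxIntegrand_le G hv k χ)

theorem integrable_fluxIntegrand (hPm : ∀ j, Measurable (P j)) {σ : ℝ} {c : NNReal}
    {F : DistModPoly n} (G : DistModPoly n)
    (hv : ∀ᵐ ξ ∂(fourierMeasure F).var, ∀ k, ‖velocitySymbol a P k ξ‖ ≤ c * ‖ξ‖ ^ σ)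
    (k : Fin n) {χ : Space n → ℂ} (hχ : Measurable χ)
    (hfin : ∫⁻ y, ‖χ y‖ₑ ∂fluxMeasure σ (fourierMeasure F).var (fourierMeasure G).var ≠ ∞) :
    Integrable (fluxIntegrand a P k F G χ)
      ((fourierMeasure F).var.prod (fourierMeasure G).var) :=
  ⟨(measurable_fluxIntegrand hPm k F G hχ).aestronglyMeasurable,
    (lintegral_fluxIntegrand_le G hv k hχ).trans_lt
      (ENNReal.mul_lt_top ENNReal.coe_lt_top hfin.lt_top)⟩

theorem enorm_fluxPair_le {σ : ℝ} {c : NNReal} {F : DistModPoly n} (G : DistModPoly n)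
    (hv : ∀ᵐ ξ ∂(fourierMeasure F).var, ∀ k, ‖velocitySymbol a P k ξ‖ ≤ c * ‖ξ‖ ^ σ)
    {χ : Space n → ℂ} (hχ : Measurable χ) :
    ‖fluxPair a P F G χ‖ₑ ≤ (n * c : NNReal) *
      ∫⁻ y, ‖χ y‖ₑ ∂fluxMeasure σ (fourierMeasure F).var (fourierMeasure G).var := by
  unfold fluxPair
  -- The normalising factor of the convolution is at most one and is discarded.
  have hpi : ‖((2 * Real.pi : ℝ) : ℂ)⁻¹ ^ n‖ₑ ≤ 1 := by
    rw [← ofReal_norm, ENNReal.ofReal_le_one, norm_pow, norm_inv, Complex.norm_real,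
      Real.norm_of_nonneg Real.two_pi_pos.le]
    refine pow_le_one₀ (by positivity) (inv_le_one_of_one_le₀ ?_)
    have := Real.pi_gt_three
    linarith
  rw [enorm_mul]
  refine (mul_le_of_le_one_left (by simp) hpi).trans ((enorm_sum_le _ _).trans ?_)
  refine (Finset.sum_le_sum fun k _ => (enorm_integral_le_lintegral_enorm _).trans
    (lintegral_fluxIntegrand_le G hv k hχ)).trans_eq ?_
  rw [Finset.sum_const, Finset.card_univ, Fintype.card_fin, nsmul_eq_mul]
  push_cast
  ring

/-- The part of the flux integrand that does not depend on the phases. -/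
def fluxKernel (a : Fin n → Fin n → ℂ) (P : Fin n → Space n → ℂ) (k : Fin n) (χ : Space n → ℂ)
    (z₁ z₂ : Space n) : ℂ :=
  (Complex.I * ((z₁ + z₂) k : ℂ) * χ (z₁ + z₂)) * velocitySymbol a P k z₁

theorem fluxIntegrand_eq (k : Fin n) (F G : DistModPoly n) (χ : Space n → ℂ)
    (z : Space n × Space n) : fluxIntegrand a P k F G χ z =
      fluxKernel a P k χ z.1 z.2 * (fourierMeasure F).phase z.1 * (fourierMeasure G).phase z.2 := by
  unfold fluxIntegrand fluxKernel
  ring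

theorem RadonMeasure.integrable_of_mul_phase (ν : RadonMeasure n) {h : Space n → ℂ}
    (hh : Integrable (fun ξ => h ξ * ν.phase ξ) ν.var) : Integrable h ν.var := by
  have h1 : Measurable fun ξ => (ν.phase ξ)⁻¹ := ν.measurable_phase.inv
  refine (hh.mul_bdd (c := 1) h1.aestronglyMeasurable (.of_forall fun ξ => ?_)).congr
    (.of_forall fun ξ => ?_)
  · rw [norm_inv, ν.norm_phase, inv_one]
  · have : ν.phase ξ ≠ 0 := by
      rw [← norm_ne_zero_iff, ν.norm_phase]; exact one_ne_zero
    field_simp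

/-- `FluxIntegrable a P F G χ` means that the integrals defining `fluxPair` converge
absolutely. -/
def FluxIntegrable (a : Fin n → Fin n → ℂ) (P : Fin n → Space n → ℂ) (F G : DistModPoly n)
    (χ : Space n → ℂ) : Prop :=
  ∀ k, Integrable (fluxIntegrand a P k F G χ) ((fourierMeasure F).var.prod (fourierMeasure G).var)

/-- The three Fourier measures are chosen independently, so additivity is not formal. Fubini freezes
z₂, and on almost every slice the kernel is integrable and `IsFourierMeasure.pair_add` applies. -/
theorem fluxPair_add_left {F F' F'' G : DistModPoly n} (hF : IsFourierMeasure F (fourierMeasure F))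
    (hF' : IsFourierMeasure F' (fourierMeasure F'))
    (hF'' : IsFourierMeasure F'' (fourierMeasure F'')) (h : F'' = F + F') {χ : Space n → ℂ}
    (hi : FluxIntegrable a P F G χ) (hi' : FluxIntegrable a P F' G χ)
    (hi'' : FluxIntegrable a P F'' G χ) :
    fluxPair a P F'' G χ = fluxPair a P F G χ + fluxPair a P F' G χ := by
  have key : ∀ {H : DistModPoly n} (k : Fin n),
      Integrable (fluxIntegrand a P k H G χ)
        ((fourierMeasure H).var.prod (fourierMeasure G).var) →
      Integrable (fun z₂ => (fourierMeasure H).pair (fun z₁ => fluxKernel a P k χ z₁ z₂) *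
        (fourierMeasure G).phase z₂) (fourierMeasure G).var ∧
      ∫ z, fluxIntegrand a P k H G χ z ∂((fourierMeasure H).var.prod (fourierMeasure G).var) =
        ∫ z₂, (fourierMeasure H).pair (fun z₁ => fluxKernel a P k χ z₁ z₂) *
          (fourierMeasure G).phase z₂ ∂(fourierMeasure G).var ∧
      ∀ᵐ z₂ ∂(fourierMeasure G).var,
        Integrable (fun z₁ => fluxKernel a P k χ z₁ z₂) (fourierMeasure H).var := by
    intro H k hk
    have h1 : ∀ z₂, ∫ z₁, fluxIntegrand a P k H G χ (z₁, z₂) ∂(fourierMeasure H).var =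
        (fourierMeasure H).pair (fun z₁ => fluxKernel a P k χ z₁ z₂) *
          (fourierMeasure G).phase z₂ := by
      intro z₂
      simp only [fluxIntegrand_eq, RadonMeasure.pair]
      rw [integral_mul_const]
    refine ⟨?_, ?_, ?_⟩
    · have := hk.integral_prod_right
      simpa only [h1] using this
    · rw [integral_prod_symm _ hk]
      simp only [h1]
    · filter_upwards [hk.prod_left_ae] with z₂ hz₂
      simp only [fluxIntegrand_eq] at hz₂
      refine (fourierMeasure H).integrable_of_mul_phase ?_
      have h2 : (fourierMeasure G).phase z₂ ≠ 0 := by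
        rw [← norm_ne_zero_iff, RadonMeasure.norm_phase]; exact one_ne_zero
      exact (integrable_mul_const_iff (Ne.isUnit h2) _).1 hz₂
  unfold fluxPair
  rw [← mul_add, ← Finset.sum_add_distrib]
  congr 1
  refine Finset.sum_congr rfl fun k _ => ?_
  obtain ⟨i1, e1, a1⟩ := key k (hi k)
  obtain ⟨i2, e2, a2⟩ := key k (hi' k)
  obtain ⟨-, e3, -⟩ := key k (hi'' k)
  rw [e1, e2, e3, ← integral_add i1 i2]
  refine integral_congr_ae ?_
  filter_upwards [a1, a2] with z₂ h1 h2
  rw [hF.pair_add hF' hF'' h h1 h2]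
  ring

theorem fluxPair_add_right {F G G' G'' : DistModPoly n} (hG : IsFourierMeasure G (fourierMeasure G))
    (hG' : IsFourierMeasure G' (fourierMeasure G'))
    (hG'' : IsFourierMeasure G'' (fourierMeasure G'')) (h : G'' = G + G') {χ : Space n → ℂ}
    (hi : FluxIntegrable a P F G χ) (hi' : FluxIntegrable a P F G' χ)
    (hi'' : FluxIntegrable a P F G'' χ) :
    fluxPair a P F G'' χ = fluxPair a P F G χ + fluxPair a P F G' χ := by
  have key : ∀ {H : DistModPoly n} (k : Fin n),
      Integrable (fluxIntegrand a P k F H χ)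
        ((fourierMeasure F).var.prod (fourierMeasure H).var) →
      Integrable (fun z₁ => (fourierMeasure H).pair (fun z₂ => fluxKernel a P k χ z₁ z₂) *
        (fourierMeasure F).phase z₁) (fourierMeasure F).var ∧
      ∫ z, fluxIntegrand a P k F H χ z ∂((fourierMeasure F).var.prod (fourierMeasure H).var) =
        ∫ z₁, (fourierMeasure H).pair (fun z₂ => fluxKernel a P k χ z₁ z₂) *
          (fourierMeasure F).phase z₁ ∂(fourierMeasure F).var ∧
      ∀ᵐ z₁ ∂(fourierMeasure F).var,
        Integrable (fun z₂ => fluxKernel a P k χ z₁ z₂) (fourierMeasure H).var := by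
    intro H k hk
    have h0 : ∀ z₁ z₂, fluxIntegrand a P k F H χ (z₁, z₂) =
        fluxKernel a P k χ z₁ z₂ * (fourierMeasure H).phase z₂ * (fourierMeasure F).phase z₁ := by
      intro z₁ z₂
      rw [fluxIntegrand_eq]
      ring
    have h1 : ∀ z₁, ∫ z₂, fluxIntegrand a P k F H χ (z₁, z₂) ∂(fourierMeasure H).var =
        (fourierMeasure H).pair (fun z₂ => fluxKernel a P k χ z₁ z₂) *
          (fourierMeasure F).phase z₁ := by
      intro z₁
      simp only [h0, RadonMeasure.pair]
      rw [integral_mul_const]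
    refine ⟨?_, ?_, ?_⟩
    · have := hk.integral_prod_left
      simpa only [h1] using this
    · rw [integral_prod _ hk]
      simp only [h1]
    · filter_upwards [hk.prod_right_ae] with z₁ hz₁
      simp only [h0] at hz₁
      refine (fourierMeasure H).integrable_of_mul_phase ?_
      have h2 : (fourierMeasure F).phase z₁ ≠ 0 := by
        rw [← norm_ne_zero_iff, RadonMeasure.norm_phase]; exact one_ne_zero
      exact (integrable_mul_const_iff (Ne.isUnit h2) _).1 hz₁
  unfold fluxPair
  rw [← mul_add, ← Finset.sum_add_distrib]
  congr 1
  refine Finset.sum_congr rfl fun k _ => ?_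
  obtain ⟨i1, e1, a1⟩ := key k (hi k)
  obtain ⟨i2, e2, a2⟩ := key k (hi' k)
  obtain ⟨-, e3, -⟩ := key k (hi'' k)
  rw [e1, e2, e3, ← integral_add i1 i2]
  refine integral_congr_ae ?_
  filter_upwards [a1, a2] with z₁ h1 h2
  rw [hG.pair_add hG' hG'' h h1 h2]
  ring

end Flux

/-! ### Pointwise in time estimates for the flux -/

theorem ShellBound.ae_ne_zero {n : ℕ} {p : ℝ≥0∞} {μ s : ℝ} {m : Measure (Space n)} {A : ℝ≥0∞}
    (h : ShellBound p μ s m A) : ∀ᵐ ξ ∂m, ξ ≠ 0 := by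
  rw [ae_iff]
  simpa using h.1

theorem ShellBound.absolutelyContinuous {n : ℕ} {p : ℝ≥0∞} {μ s : ℝ} (hp : 1 ≤ p) (hp1 : p ≠ 1)
    {m : Measure (Space n)} {A : ℝ≥0∞} (h : ShellBound p μ s m A) : m ≪ volume := by
  refine Measure.AbsolutelyContinuous.mk fun E hE h0 => ?_
  have hsub : E ⊆ {0} ∪ ⋃ j : ℤ, E ∩ shell n j := by
    intro ξ hξ
    by_cases h1 : ξ = 0
    · exact Or.inl h1
    · obtain ⟨j, hj⟩ := exists_mem_shell h1
      exact Or.inr (Set.mem_iUnion.2 ⟨j, hξ, hj⟩)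
  refine measure_mono_null hsub (measure_union_null h.1 (measure_iUnion_null fun j => ?_))
  have := (h.2 j).absolutelyContinuous hp hp1 h0
  rwa [Measure.restrict_apply hE] at this

/-- The standing assumptions on the parameters and the symbols. -/
structure Admissible (n : ℕ) (γ β μ : ℝ) (p : ℝ≥0∞) (a : Fin n → Fin n → ℂ)
    (P : Fin n → Space n → ℂ) : Prop where
  one_le : 1 ≤ p
  gap : 0 < 2 * γ - β
  gain : 0 < 2 * γ - 1
  gain_lt : 2 * γ - 1 < critIndex n γ β μ p
  measurable_symbol : ∀ j, Measurable (P j)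
  symbol_le : ∃ C : ℝ, (∀ j, ∀ᵐ ξ : Space n, ‖P j ξ‖ ≤ C * ‖ξ‖ ^ β) ∧
    (p = 1 → ∀ j, ∀ ξ : Space n, ξ ≠ 0 → ‖P j ξ‖ ≤ C * ‖ξ‖ ^ β)

theorem enorm_damped_le {n : ℕ} {γ r : ℝ} (hr : 0 ≤ r) (ψ : testAwayZero n) (ξ : Space n) :
    ‖damped γ r ψ ξ‖ₑ ≤ ‖ψ.1 ξ‖ₑ := by
  rw [damped, enorm_mul]
  refine mul_le_of_le_one_left (by simp) ?_
  rw [← ofReal_norm, Complex.norm_real, Real.norm_of_nonneg (Real.exp_pos _).le,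
    ENNReal.ofReal_le_one, Real.exp_le_one_iff]
  have : 0 ≤ ‖ξ‖ ^ (2 * γ) := by positivity
  nlinarith

theorem measurable_damped_uncurry {n : ℕ} (γ : ℝ) (ψ : testAwayZero n) :
    Measurable fun z : ℝ × Space n => damped γ z.1 ψ z.2 := by
  unfold damped
  refine Measurable.mul ?_ ((measurable_testAwayZero ψ).comp measurable_snd)
  refine Complex.measurable_ofReal.comp (Real.measurable_exp.comp ?_)
  exact measurable_fst.neg.mul (measurable_snd.norm.pow_const _)

theorem measurable_damped {n : ℕ} (γ r : ℝ) (ψ : testAwayZero n) : Measurable (damped γ r ψ) :=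
  (measurable_damped_uncurry γ ψ).comp measurable_prodMk_left

namespace Admissible

variable {n : ℕ} {γ β μ : ℝ} {p : ℝ≥0∞} {a : Fin n → Fin n → ℂ} {P : Fin n → Space n → ℂ}

theorem gap_eq (_h : Admissible n γ β μ p a P) :
    (n : ℝ) - (n - μ) / p.toReal - critIndex n γ β μ p = 2 * γ - β := by
  unfold critIndex; ring

theorem index_gap (h : Admissible n γ β μ p a P) :
    0 < (n : ℝ) - (n - μ) / p.toReal - critIndex n γ β μ p := by
  rw [h.gap_eq]; exact h.gap

/-- For p ≠ 1 a shell bound forces absolute continuity, so a Lebesgue almost everywhere bound on the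
symbols suffices. For p = 1 the measure may be singular, and the bound at every nonzero frequency is
used. -/
theorem exists_velocity_le (h : Admissible n γ β μ p a P) :
    ∃ c : NNReal, ∀ (m : Measure (Space n)) (s : ℝ) (A : ℝ≥0∞), ShellBound p μ s m A →
      ∀ᵐ ξ ∂m, ∀ k, ‖velocitySymbol a P k ξ‖ ≤ c * ‖ξ‖ ^ (β - 1) := by
  obtain ⟨C, hC, hC1⟩ := h.symbol_le
  obtain ⟨c, hc⟩ := exists_norm_velocitySymbol_le a P C β
  refine ⟨c, fun m s A hm => ?_⟩
  have : ∀ᵐ ξ ∂m, ∀ j, ‖P j ξ‖ ≤ C * ‖ξ‖ ^ β := by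
    by_cases hp1 : p = 1
    · filter_upwards [hm.ae_ne_zero] with ξ hξ j using hC1 hp1 j ξ hξ
    · exact (hm.absolutelyContinuous h.one_le hp1).ae_le (ae_all_iff.2 hC)
  filter_upwards [this, hm.ae_ne_zero] with ξ h1 h2 k using hc k ξ h2 h1

/-- With σ = β - 1 the index conditions of the convolution estimate become 2γ - β > 0, 2γ - 1 > 0
and 2γ - 1 < s. -/
theorem exists_flux (h : Admissible n γ β μ p a P) (Φ : LittlewoodPaley n) :
    ∃ C : NNReal, ∀ F G : DistModPoly n, fnNorm Φ p μ (critIndex n γ β μ p) F ≠ ∞ →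
      fnNorm Φ p μ (critIndex n γ β μ p) G ≠ ∞ →
      ShellBound p μ (critIndex n γ β μ p - 2 * γ)
        (fluxMeasure (β - 1) (fourierMeasure F).var (fourierMeasure G).var)
        (C * fnNorm Φ p μ (critIndex n γ β μ p) F * fnNorm Φ p μ (critIndex n γ β μ p) G) ∧
      ∀ χ : Space n → ℂ, Measurable χ →
        ‖fluxPair a P F G χ‖ₑ ≤ C *
          ∫⁻ y, ‖χ y‖ₑ ∂fluxMeasure (β - 1) (fourierMeasure F).var (fourierMeasure G).var ∧
        (∫⁻ y, ‖χ y‖ₑ ∂fluxMeasure (β - 1) (fourierMeasure F).var (fourierMeasure G).var ≠ ∞ →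
          FluxIntegrable a P F G χ) := by
  have e := h.gap_eq
  obtain ⟨c, hc⟩ := h.exists_velocity_le
  obtain ⟨C₁, h1⟩ := exists_shellBound_fourierMeasure Φ h.one_le h.index_gap
  obtain ⟨C₂, h2⟩ := exists_shellBound_fluxMeasure (σ := β - 1) h.one_le h.index_gap
    (by rw [e]; linarith [h.gain]) (by rw [e]; linarith [h.gain_lt])
  refine ⟨max (C₂ * C₁ * C₁) (n * c), fun F G hF hG => ?_⟩
  have hF1 := (h1 F hF).2
  have hG1 := (h1 G hG).2
  have hv := hc _ _ _ hF1
  refine ⟨?_, fun χ hχ => ⟨(enorm_fluxPair_le G hv hχ).trans ?_, fun hfin k =>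
    integrable_fluxIntegrand h.measurable_symbol G hv k hχ hfin⟩⟩
  · have h3 := h2 _ _ _ _ hF1 hG1
    rw [e] at h3
    have e2 : critIndex n γ β μ p - (2 * γ - β + (β - 1)) - 1 = critIndex n γ β μ p - 2 * γ := by
      ring
    rw [e2] at h3
    refine h3.mono le_rfl ?_
    calc (C₂ : ℝ≥0∞) * (C₁ * fnNorm Φ p μ (critIndex n γ β μ p) F) *
          (C₁ * fnNorm Φ p μ (critIndex n γ β μ p) G) =
          ((C₂ * C₁ * C₁ : NNReal) : ℝ≥0∞) * fnNorm Φ p μ (critIndex n γ β μ p) F *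
          fnNorm Φ p μ (critIndex n γ β μ p) G := by push_cast; ring
      _ ≤ _ := by gcongr; exact le_max_left _ _
  · gcongr
    exact le_max_right _ _

/-- Damping only decreases the test function, hence uniformity in r. At index s - 2γ the growth
exponent is 4γ - β > 0, so Schwartz functions are integrable against the flux measure. -/
theorem exists_fluxPair_damped_le (h : Admissible n γ β μ p a P) (Φ : LittlewoodPaley n)
    (ψ : testAwayZero n) :
    ∃ C : NNReal, ∀ F G : DistModPoly n, fnNorm Φ p μ (critIndex n γ β μ p) F ≠ ∞ →
      fnNorm Φ p μ (critIndex n γ β μ p) G ≠ ∞ → ∀ r : ℝ, 0 ≤ r →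
      FluxIntegrable a P F G (damped γ r ψ) ∧ ‖fluxPair a P F G (damped γ r ψ)‖ₑ ≤
        C * fnNorm Φ p μ (critIndex n γ β μ p) F * fnNorm Φ p μ (critIndex n γ β μ p) G := by
  obtain ⟨C, hC⟩ := h.exists_flux Φ
  have hs : 0 < (n : ℝ) - (n - μ) / p.toReal - (critIndex n γ β μ p - 2 * γ) := by
    linarith [h.gap_eq, h.gap, h.gain]
  obtain ⟨D, hD⟩ := ShellBound.lintegral_schwartz_le h.one_le hs ψ.1
  refine ⟨C * (D * C), fun F G hF hG r hr => ?_⟩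
  obtain ⟨h1, h2⟩ := hC F G hF hG
  obtain ⟨h3, h4⟩ := h2 _ (measurable_damped γ r ψ)
  have h5 := (lintegral_mono (enorm_damped_le (γ := γ) hr ψ)).trans (hD _ _ h1)
  have hfin : (D : ℝ≥0∞) * (C * fnNorm Φ p μ (critIndex n γ β μ p) F *
      fnNorm Φ p μ (critIndex n γ β μ p) G) ≠ ∞ := by finiteness
  refine ⟨h4 (ne_top_of_le_ne_top hfin h5), h3.trans ((mul_le_mul_right h5 _).trans_eq ?_)⟩
  push_cast
  ring

theorem isFourierMeasure (h : Admissible n γ β μ p a P) {Φ : LittlewoodPaley n} {F : DistModPoly n}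
    (hF : fnNorm Φ p μ (critIndex n γ β μ p) F ≠ ∞) : IsFourierMeasure F (fourierMeasure F) :=
  ((exists_shellBound_fourierMeasure Φ h.one_le h.index_gap).choose_spec F hF).1

theorem fnNorm_sub_ne_top (h : Admissible n γ β μ p a P) {Φ : LittlewoodPaley n}
    {F G : DistModPoly n} (hF : fnNorm Φ p μ (critIndex n γ β μ p) F ≠ ∞)
    (hG : fnNorm Φ p μ (critIndex n γ β μ p) G ≠ ∞) :
    fnNorm Φ p μ (critIndex n γ β μ p) (F - G) ≠ ∞ :=
  ne_top_of_le_ne_top (ENNReal.add_ne_top.2 ⟨hF, hG⟩) (fnNorm_sub_le Φ h.one_le F G)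

theorem fluxPair_sub (h : Admissible n γ β μ p a P) {Φ : LittlewoodPaley n}
    {F F' G G' : DistModPoly n} (hF : fnNorm Φ p μ (critIndex n γ β μ p) F ≠ ∞)
    (hF' : fnNorm Φ p μ (critIndex n γ β μ p) F' ≠ ∞)
    (hG : fnNorm Φ p μ (critIndex n γ β μ p) G ≠ ∞)
    (hG' : fnNorm Φ p μ (critIndex n γ β μ p) G' ≠ ∞) (ψ : testAwayZero n) {r : ℝ} (hr : 0 ≤ r) :
    fluxPair a P F G (damped γ r ψ) - fluxPair a P F' G' (damped γ r ψ) =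
      fluxPair a P (F - F') G (damped γ r ψ) + fluxPair a P F' (G - G') (damped γ r ψ) := by
  obtain ⟨C, hC⟩ := h.exists_fluxPair_damped_le Φ ψ
  have hFF := h.fnNorm_sub_ne_top hF hF'
  have hGG := h.fnNorm_sub_ne_top hG hG'
  rw [fluxPair_add_left (h.isFourierMeasure hFF) (h.isFourierMeasure hF') (h.isFourierMeasure hF)
    (sub_add_cancel F F').symm (hC _ _ hFF hG r hr).1 (hC _ _ hF' hG r hr).1 (hC _ _ hF hG r hr).1,
    fluxPair_add_right (h.isFourierMeasure hGG) (h.isFourierMeasure hG') (h.isFourierMeasure hG)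
    (sub_add_cancel G G').symm (hC _ _ hF' hGG r hr).1 (hC _ _ hF' hG' r hr).1
    (hC _ _ hF' hG r hr).1]
  ring

end Admissible

theorem fluxPair_add_test {n : ℕ} {a : Fin n → Fin n → ℂ} {P : Fin n → Space n → ℂ}
    {F G : DistModPoly n} {χ χ' : Space n → ℂ} (h : FluxIntegrable a P F G χ)
    (h' : FluxIntegrable a P F G χ') :
    fluxPair a P F G (fun ξ => χ ξ + χ' ξ) = fluxPair a P F G χ + fluxPair a P F G χ' := by
  unfold fluxPair
  rw [← mul_add, ← Finset.sum_add_distrib]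
  congr 1
  refine Finset.sum_congr rfl fun k _ => ?_
  rw [← integral_add (h k) (h' k)]
  refine integral_congr_ae (.of_forall fun z => ?_)
  simp only [fluxIntegrand]
  ring

theorem fluxPair_smul_test {n : ℕ} (a : Fin n → Fin n → ℂ) (P : Fin n → Space n → ℂ)
    (F G : DistModPoly n) (c : ℂ) (χ : Space n → ℂ) :
    fluxPair a P F G (fun ξ => c * χ ξ) = c * fluxPair a P F G χ := by
  unfold fluxPair
  rw [mul_left_comm]
  congr 1
  rw [Finset.mul_sum]
  refine Finset.sum_congr rfl fun k _ => ?_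
  rw [← integral_const_mul]
  refine integral_congr_ae (.of_forall fun z => ?_)
  simp only [fluxIntegrand]
  ring

/-! ### Time measurability -/

/-- `θ` is bounded by `A` and everywhere a limit of simple functions. -/
structure StronglyBounded {n : ℕ} (Φ : LittlewoodPaley n) (p : ℝ≥0∞) (μ s : ℝ)
    (θ : ℝ → DistModPoly n) (A : ℝ≥0∞) : Prop where
  bound : ∀ τ, fnNorm Φ p μ s (θ τ) ≤ A
  approx : ∃ u : ℕ → SimpleFunc ℝ (DistModPoly n), ∀ τ,
    Tendsto (fun m => fnNorm Φ p μ s (u m τ - θ τ)) atTop (𝓝 0)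

theorem fnNorm_le_supNorm {n : ℕ} (Φ : LittlewoodPaley n) (p : ℝ≥0∞) (μ s : ℝ)
    (θ : ℝ → DistModPoly n) {t : ℝ} (ht : 0 < t) :
    fnNorm Φ p μ s (θ t) ≤ supNorm Φ p μ s θ :=
  le_iSup₂_of_le (f := fun (t : ℝ) (_ : 0 < t) => fnNorm Φ p μ s (θ t)) t ht le_rfl

/-- Setting θ to zero off a measurable set of full measure in (0,∞) turns almost everywhere
approximation into approximation at every time, as kernels in τ require. -/
theorem MemLinfty.exists_stronglyBounded {n : ℕ} {Φ : LittlewoodPaley n} {p : ℝ≥0∞} {μ s : ℝ}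
    (hp : 1 ≤ p) {θ : ℝ → DistModPoly n} (h : MemLinfty Φ p μ s θ) :
    ∃ θ' : ℝ → DistModPoly n, StronglyBounded Φ p μ s θ' (supNorm Φ p μ s θ) ∧
      ∀ᵐ τ ∂volume.restrict (Set.Ioi (0 : ℝ)), θ' τ = θ τ := by
  obtain ⟨-, u, hu⟩ := h
  obtain ⟨S, hS, hSm, hS'⟩ := hu.exists_measurable_mem
  have hm : MeasurableSet (S ∩ Set.Ioi 0) := hSm.inter measurableSet_Ioi
  refine ⟨(S ∩ Set.Ioi 0).indicator θ, ⟨fun τ => ?_, fun m => (u m).restrict (S ∩ Set.Ioi 0),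
    fun τ => ?_⟩, ?_⟩
  · by_cases hτ : τ ∈ S ∩ Set.Ioi 0
    · rw [Set.indicator_of_mem hτ]
      exact fnNorm_le_supNorm Φ p μ s θ hτ.2
    · simp [Set.indicator_of_notMem hτ, fnNorm_zero Φ hp]
  · simp only [SimpleFunc.restrict_apply _ hm]
    by_cases hτ : τ ∈ S ∩ Set.Ioi 0
    · simpa only [Set.indicator_of_mem hτ] using hS' τ hτ.1
    · simp [Set.indicator_of_notMem hτ, fnNorm_zero Φ hp]
  · filter_upwards [hS, ae_restrict_mem measurableSet_Ioi] with τ h1 h2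
    exact Set.indicator_of_mem (show τ ∈ S ∩ Set.Ioi 0 from ⟨h1, h2⟩) θ

/-- On a bounded set E the mass |F̂|(E) changes by at most a constant times the norm of the change
in F, so the function is a pointwise limit of simple functions of τ. -/
theorem StronglyBounded.measurable_var_of_subset_ball {n : ℕ} {Φ : LittlewoodPaley n} {p : ℝ≥0∞}
    {μ s : ℝ} (hp : 1 ≤ p) (hs : 0 < n - (n - μ) / p.toReal - s) {θ : ℝ → DistModPoly n}
    {A : ℝ≥0∞} (hA : A ≠ ∞) (h : StronglyBounded Φ p μ s θ A) {E : Set (Space n)} {R : ℝ}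
    (hR : 1 ≤ R) (hER : E ⊆ Metric.ball 0 R) :
    Measurable fun τ => (fourierMeasure (θ τ)).var E := by
  obtain ⟨u, hu⟩ := h.approx
  obtain ⟨C, hC⟩ := exists_shellBound_fourierMeasure Φ hp hs
  obtain ⟨D, hD⟩ := ShellBound.measure_ball_le (n := n) (μ := μ) hp hs
  have hle : ∀ F, fnNorm Φ p μ s F ≠ ∞ → (fourierMeasure F).var E ≤
      D * (C * fnNorm Φ p μ s F) * ENNReal.ofReal (R ^ (n - (n - μ) / p.toReal - s)) := fun F hF =>
    (measure_mono hER).trans (hD _ _ (hC F hF).2 R hR)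
  refine measurable_of_tendsto_metrizable (f := fun m τ => (fourierMeasure (u m τ)).var E)
    (fun m => ((u m).map fun F => (fourierMeasure F).var E).measurable) ?_
  rw [tendsto_pi_nhds]
  intro τ
  have hθ : fnNorm Φ p μ s (θ τ) ≠ ∞ := ne_top_of_le_ne_top hA (h.bound τ)
  set Δ : ℕ → ℝ≥0∞ := fun m => D * (C * fnNorm Φ p μ s (u m τ - θ τ)) *
    ENNReal.ofReal (R ^ (n - (n - μ) / p.toReal - s)) with hΔ
  have hΔ0 : Tendsto Δ atTop (𝓝 0) := by
    have h1 := ENNReal.Tendsto.const_mul (a := (C : ℝ≥0∞)) (hu τ) (Or.inr ENNReal.coe_ne_top)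
    have h2 := ENNReal.Tendsto.const_mul (a := (D : ℝ≥0∞)) h1 (Or.inr ENNReal.coe_ne_top)
    have h3 := ENNReal.Tendsto.mul_const
      (b := ENNReal.ofReal (R ^ (n - (n - μ) / p.toReal - s))) h2 (Or.inr ENNReal.ofReal_ne_top)
    simpa using h3
  have hfin : (fourierMeasure (θ τ)).var E ≠ ∞ :=
    ne_top_of_le_ne_top (by finiteness) (hle _ hθ)
  have hev : ∀ᶠ m in atTop, fnNorm Φ p μ s (u m τ - θ τ) < ∞ :=
    (hu τ).eventually (gt_mem_nhds (by simp))
  have lo : Tendsto (fun m => (fourierMeasure (θ τ)).var E - Δ m) atTop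
      (𝓝 ((fourierMeasure (θ τ)).var E)) := by
    simpa using ENNReal.Tendsto.sub (tendsto_const_nhds (x := (fourierMeasure (θ τ)).var E)) hΔ0
      (Or.inl hfin)
  have hi : Tendsto (fun m => (fourierMeasure (θ τ)).var E + Δ m) atTop
      (𝓝 ((fourierMeasure (θ τ)).var E)) := by
    simpa using tendsto_const_nhds.add hΔ0
  refine tendsto_of_tendsto_of_tendsto_of_le_of_le' lo hi ?_ ?_
  · filter_upwards [hev] with m hm
    rw [tsub_le_iff_right]
    have hu' : fnNorm Φ p μ s (u m τ) ≠ ∞ := by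
      have := fnNorm_add_le Φ (μ := μ) (s := s) hp (u m τ - θ τ) (θ τ)
      rw [sub_add_cancel] at this
      exact ne_top_of_le_ne_top (ENNReal.add_ne_top.2 ⟨hm.ne, hθ⟩) this
    have hm' : fnNorm Φ p μ s (θ τ - u m τ) ≠ ∞ := by rw [fnNorm_sub_comm]; exact hm.ne
    have h1 := (hC _ hu').1.var_le_add (hC _ hm').1 (hC _ hθ).1 (add_sub_cancel _ _).symm E
    refine h1.trans ?_
    rw [Measure.add_apply]
    gcongr
    refine (hle _ hm').trans ?_
    rw [fnNorm_sub_comm]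
  · filter_upwards [hev] with m hm
    have hu' : fnNorm Φ p μ s (u m τ) ≠ ∞ := by
      have := fnNorm_add_le Φ (μ := μ) (s := s) hp (u m τ - θ τ) (θ τ)
      rw [sub_add_cancel] at this
      exact ne_top_of_le_ne_top (ENNReal.add_ne_top.2 ⟨hm.ne, hθ⟩) this
    have h1 := (hC _ hθ).1.var_le_add (hC _ hm.ne).1 (hC _ hu').1 (add_sub_cancel _ _).symm E
    refine h1.trans ?_
    rw [Measure.add_apply]
    gcongr
    exact hle _ hm.ne

/-- Disjoint annuli cut the total variations into pieces of finite mass, uniformly in τ; the sum of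
these finite kernels is s-finite. -/
theorem StronglyBounded.exists_kernel {n : ℕ} {Φ : LittlewoodPaley n} {p : ℝ≥0∞}
    {μ s : ℝ} (hp : 1 ≤ p) (hs : 0 < n - (n - μ) / p.toReal - s) {θ : ℝ → DistModPoly n}
    {A : ℝ≥0∞} (hA : A ≠ ∞) (h : StronglyBounded Φ p μ s θ A) :
    ∃ κ : Kernel ℝ (Space n), IsSFiniteKernel κ ∧ ∀ τ, κ τ = (fourierMeasure (θ τ)).var := by
  set B : ℕ → Set (Space n) := disjointed fun k : ℕ => Metric.ball (0 : Space n) (k + 1 : ℝ) with hB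
  have hBm : ∀ k, MeasurableSet (B k) := fun k =>
    MeasurableSet.disjointed (fun _ => measurableSet_ball) k
  have hBs : ∀ k, B k ⊆ Metric.ball (0 : Space n) (k + 1 : ℝ) := fun k => disjointed_subset _ k
  have hBd : Pairwise (Function.onFun Disjoint B) := disjoint_disjointed _
  have hBu : ⋃ k, B k = Set.univ := by
    rw [hB, iUnion_disjointed]
    refine Set.eq_univ_of_forall fun x => Set.mem_iUnion.2 ?_
    obtain ⟨k, hk⟩ := exists_nat_gt ‖x‖
    exact ⟨k, by simpa using hk.trans (lt_add_one _)⟩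
  have hsum : ∀ m : Measure (Space n), m = Measure.sum fun k => m.restrict (B k) := fun m => by
    rw [← Measure.restrict_iUnion hBd hBm, hBu, Measure.restrict_univ]
  have hR : ∀ k : ℕ, (1 : ℝ) ≤ k + 1 := fun k => by simp
  let κ : ℕ → Kernel ℝ (Space n) := fun k =>
    { toFun := fun τ => (fourierMeasure (θ τ)).var.restrict (B k)
      measurable' := by
        refine Measure.measurable_of_measurable_coe _ fun E hE => ?_
        simp only [Measure.restrict_apply hE]
        exact h.measurable_var_of_subset_ball hp hs hA (hR k)
          (Set.inter_subset_right.trans (hBs k)) }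
  have hκ : ∀ k τ, κ k τ = (fourierMeasure (θ τ)).var.restrict (B k) := fun _ _ => rfl
  obtain ⟨C, hC⟩ := exists_shellBound_fourierMeasure Φ hp hs
  obtain ⟨D, hD⟩ := ShellBound.measure_ball_le (n := n) (μ := μ) hp hs
  have hfin : ∀ k, IsFiniteKernel (κ k) := by
    intro k
    refine ⟨⟨D * (C * A) * ENNReal.ofReal ((k + 1 : ℝ) ^ (n - (n - μ) / p.toReal - s)),
      by finiteness, fun τ => ?_⟩⟩
    rw [hκ, Measure.restrict_apply_univ]
    refine (measure_mono (hBs k)).trans ((hD _ _ (hC (θ τ)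
      (ne_top_of_le_ne_top hA (h.bound τ))).2 _ (hR k)).trans ?_)
    gcongr
    exact h.bound τ
  refine ⟨Kernel.sum κ, inferInstance, fun τ => ?_⟩
  rw [Kernel.sum_apply]
  exact (hsum _).symm

theorem measurable_fluxPair_damped {n : ℕ} {γ : ℝ} {a : Fin n → Fin n → ℂ}
    {P : Fin n → Space n → ℂ} (hPm : ∀ j, Measurable (P j)) (F G : DistModPoly n)
    (ψ : testAwayZero n) {r : ℝ → ℝ} (hr : Measurable r) :
    Measurable fun τ : ℝ => fluxPair a P F G (damped γ (r τ) ψ) := by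
  unfold fluxPair
  refine Measurable.const_mul (Finset.measurable_sum _ fun k _ => ?_) _
  refine (StronglyMeasurable.integral_prod_right (f := fun (τ : ℝ) z =>
    fluxIntegrand a P k F G (damped γ (r τ) ψ) z) ?_).measurable
  refine Measurable.stronglyMeasurable ?_
  unfold Function.uncurry fluxIntegrand
  have hk : Measurable fun z : ℝ × Space n × Space n => (((z.2.1 + z.2.2) k : ℝ) : ℂ) :=
    Complex.measurable_ofReal.comp
      ((EuclideanSpace.proj (𝕜 := ℝ) k).continuous.measurable.comp
        (measurable_add.comp measurable_snd))
  have hd : Measurable fun z : ℝ × Space n × Space n => damped γ (r z.1) ψ (z.2.1 + z.2.2) :=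
    (measurable_damped_uncurry γ ψ).comp
      ((hr.comp measurable_fst).prodMk (measurable_add.comp measurable_snd))
  have h1 : Measurable fun z : ℝ × Space n × Space n => z.2.1 := measurable_fst.comp measurable_snd
  have h2 : Measurable fun z : ℝ × Space n × Space n => z.2.2 := measurable_snd.comp measurable_snd
  exact ((hk.const_mul _).mul hd).mul (((measurable_velocitySymbol a P hPm k).comp h1).mul
    ((fourierMeasure F).measurable_phase.comp h1)) |>.mul
      ((fourierMeasure G).measurable_phase.comp h2)

/-- The phases need not depend measurably on τ. The flux is instead the pointwise limit of the
fluxes of simple approximations, by bilinearity and the uniform flux bound. -/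
theorem StronglyBounded.measurable_fluxPair {n : ℕ} {γ β μ : ℝ} {p : ℝ≥0∞}
    {a : Fin n → Fin n → ℂ} {P : Fin n → Space n → ℂ} (h : Admissible n γ β μ p a P)
    {Φ : LittlewoodPaley n} {θ φ : ℝ → DistModPoly n} {A B : ℝ≥0∞}
    (hθ : StronglyBounded Φ p μ (critIndex n γ β μ p) θ A) (hA : A ≠ ∞)
    (hφ : StronglyBounded Φ p μ (critIndex n γ β μ p) φ B) (hB : B ≠ ∞) (ψ : testAwayZero n)
    {r : ℝ → ℝ} (hr : Measurable r) (hr0 : ∀ τ, 0 ≤ r τ) :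
    Measurable fun τ => fluxPair a P (θ τ) (φ τ) (damped γ (r τ) ψ) := by
  obtain ⟨u, hu⟩ := hθ.approx
  obtain ⟨v, hv⟩ := hφ.approx
  obtain ⟨C, hC⟩ := h.exists_fluxPair_damped_le Φ ψ
  refine measurable_of_tendsto_metrizable
    (f := fun m τ => fluxPair a P (u m τ) (v m τ) (damped γ (r τ) ψ)) (fun m => ?_) ?_
  · exact SimpleFunc.measurable_bind ((u m).pair (v m))
      (fun c τ => fluxPair a P c.1 c.2 (damped γ (r τ) ψ))
      fun c => measurable_fluxPair_damped h.measurable_symbol c.1 c.2 ψ hr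
  rw [tendsto_pi_nhds]
  intro τ
  set N := fnNorm Φ p μ (critIndex n γ β μ p) with hN
  have fθ : N (θ τ) ≠ ∞ := ne_top_of_le_ne_top hA (hθ.bound τ)
  have fφ : N (φ τ) ≠ ∞ := ne_top_of_le_ne_top hB (hφ.bound τ)
  have eu : ∀ᶠ m in atTop, N (u m τ - θ τ) < 1 := (hu τ).eventually (gt_mem_nhds (by simp))
  have ev : ∀ᶠ m in atTop, N (v m τ - φ τ) < 1 := (hv τ).eventually (gt_mem_nhds (by simp))
  have lim : Tendsto (fun m => (C : ℝ≥0∞) * N (u m τ - θ τ) * (1 + N (φ τ)) +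
      C * N (θ τ) * N (v m τ - φ τ)) atTop (𝓝 0) := by
    have h1 := ENNReal.Tendsto.mul_const (b := 1 + N (φ τ))
      (ENNReal.Tendsto.const_mul (a := (C : ℝ≥0∞)) (hu τ) (Or.inr ENNReal.coe_ne_top))
      (Or.inr (by finiteness))
    have h2 := ENNReal.Tendsto.const_mul (a := (C : ℝ≥0∞) * N (θ τ)) (hv τ)
      (Or.inr (by finiteness))
    simpa using h1.add h2
  rw [tendsto_iff_edist_tendsto_0]
  refine tendsto_of_tendsto_of_tendsto_of_le_of_le' tendsto_const_nhds lim
    (.of_forall fun _ => zero_le) ?_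
  filter_upwards [eu, ev] with m hum hvm
  have tri : ∀ F F', N F ≤ N (F - F') + N F' := fun F F' => by
    have := fnNorm_add_le Φ (μ := μ) (s := critIndex n γ β μ p) h.one_le (F - F') F'
    rwa [sub_add_cancel] at this
  have fu : N (u m τ) ≠ ∞ := ne_top_of_le_ne_top
    (ENNReal.add_ne_top.2 ⟨(hum.trans ENNReal.one_lt_top).ne, fθ⟩) (tri _ (θ τ))
  have bv : N (v m τ) ≤ 1 + N (φ τ) := (tri _ (φ τ)).trans (by gcongr)
  have fv : N (v m τ) ≠ ∞ := ne_top_of_le_ne_top (by finiteness) bv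
  rw [edist_eq_enorm_sub, h.fluxPair_sub fu fθ fv fφ ψ (hr0 τ)]
  refine (enorm_add_le _ _).trans (add_le_add ?_ ?_)
  · refine (hC _ _ (h.fnNorm_sub_ne_top fu fθ) fv _ (hr0 τ)).2.trans ?_
    gcongr
  · exact (hC _ _ fθ (h.fnNorm_sub_ne_top fv fφ) _ (hr0 τ)).2

/-! ### The Duhamel integral -/

/-- M is the image under addition of frequencies of a weighted composition-product, so integration
in time yields one positive measure to which shell bounds apply. -/
theorem exists_measure_time_flux {n : ℕ} (σ : ℝ) (ν : Measure ℝ) [SFinite ν]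
    (κ η : Kernel ℝ (Space n)) [IsSFiniteKernel κ] [IsSFiniteKernel η]
    {e : ℝ × Space n → ℝ≥0∞} (he : Measurable e) :
    ∃ M : Measure (Space n), ∀ ω : Space n → ℝ≥0∞, Measurable ω →
      ∫⁻ y, ω y ∂M = ∫⁻ τ, ∫⁻ y, e (τ, y) * ω y ∂fluxMeasure σ (κ τ) (η τ) ∂ν := by
  set wt : ℝ × Space n × Space n → ℝ≥0∞ := fun q =>
    ENNReal.ofReal (‖q.2.1‖ ^ σ) * ‖q.2.1 + q.2.2‖ₑ * e (q.1, q.2.1 + q.2.2) with hwt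
  have hadd : Measurable fun q : ℝ × Space n × Space n => q.2.1 + q.2.2 :=
    measurable_add.comp measurable_snd
  have hwm : Measurable wt :=
    ((measurable_fluxWeight σ).comp measurable_snd).mul (he.comp (measurable_fst.prodMk hadd))
  refine ⟨((ν ⊗ₘ (κ ×ₖ η)).withDensity wt).map fun q => q.2.1 + q.2.2, fun ω hω => ?_⟩
  have h1 : Measurable fun q : ℝ × Space n × Space n => ω (q.2.1 + q.2.2) := hω.comp hadd
  rw [lintegral_map hω hadd, lintegral_withDensity_eq_lintegral_mul _ hwm h1,
    Measure.lintegral_compProd (hwm.mul h1)]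
  refine lintegral_congr fun τ => ?_
  have h2 : Measurable fun y => e (τ, y) * ω y := (he.comp measurable_prodMk_left).mul hω
  rw [lintegral_fluxMeasure_prod _ _ _ h2, Kernel.prod_apply]
  refine lintegral_congr fun z => ?_
  simp only [hwt, Pi.mul_apply, mul_assoc]

theorem ShellBound.smul {n : ℕ} {p : ℝ≥0∞} {μ s : ℝ} {m : Measure (Space n)} {A : ℝ≥0∞}
    (h : ShellBound p μ s m A) (c : ℝ≥0∞) : ShellBound p μ s (c • m) (c * A) :=
  ⟨by simp [h.1], fun j => by
    rw [Measure.restrict_smul, mul_assoc]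
    exact (h.2 j).smul c⟩

/-- The weight `exp (-(t-τ) |y|^(2γ))`. -/
def heatWeight {n : ℕ} (γ t : ℝ) (z : ℝ × Space n) : ℝ≥0∞ :=
  ENNReal.ofReal (Real.exp (-(t - z.1) * ‖z.2‖ ^ (2 * γ)))

theorem measurable_heatWeight {n : ℕ} (γ t : ℝ) : Measurable (heatWeight (n := n) γ t) := by
  refine (Real.measurable_exp.comp ?_).ennreal_ofReal
  exact (measurable_const.sub measurable_fst).neg.mul (measurable_snd.norm.pow_const _)

theorem enorm_damped {n : ℕ} (γ t τ : ℝ) (ψ : testAwayZero n) (y : Space n) :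
    ‖damped γ (t - τ) ψ y‖ₑ = heatWeight γ t (τ, y) * ‖ψ.1 y‖ₑ := by
  rw [damped, enorm_mul, heatWeight, ← ofReal_norm (Complex.ofReal _), Complex.norm_real,
    Real.norm_of_nonneg (Real.exp_pos _).le]

/-- Time integration against `exp (-(t-τ) |y|^(2γ))` gains `2γ` derivatives. -/
theorem ShellBound.of_time_integral {n : ℕ} {p : ℝ≥0∞} {μ s γ t T : ℝ} (hγ : 0 ≤ γ) (hT : T ≤ t)
    {A L : ℝ≥0∞}
    (hL : ∀ x : ℝ, 0 < x → ENNReal.ofReal x *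
      ∫⁻ τ in Set.Ioc 0 T, ENNReal.ofReal (Real.exp (-(t - τ) * x)) ≤ L)
    {D : ℝ → Measure (Space n)} (hD : ∀ τ, ShellBound p μ s (D τ) A) {M : Measure (Space n)}
    (hM : ∀ ω : Space n → ℝ≥0∞, Measurable ω →
      ∫⁻ y, ω y ∂M = ∫⁻ τ in Set.Ioc 0 T, ∫⁻ y, heatWeight γ t (τ, y) * ω y ∂D τ) :
    ShellBound p μ (s + 2 * γ) M (A * L) := by
  refine ⟨?_, fun j x R hR h hh hs hd => ?_⟩
  · rw [← lintegral_indicator_one (measurableSet_singleton 0),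
      hM _ (measurable_one.indicator (measurableSet_singleton 0))]
    refine (lintegral_congr fun τ => ?_).trans lintegral_zero
    refine lintegral_eq_zero_of_ae_eq_zero ?_
    filter_upwards [(hD τ).ae_ne_zero] with y hy
    rw [Set.indicator_of_notMem (by simpa using hy), mul_zero]
    rfl
  · rw [← lintegral_indicator (measurableSet_shell j), hM _ (hh.indicator (measurableSet_shell j))]
    -- X is the least value of ‖y‖^(2γ) on shell j, so the heat weight there is at most
    -- exp(-(t-τ)X); dividing `hL` by X yields the factor 2^(-2γj).
    set X : ℝ := (2 : ℝ) ^ ((j : ℝ) * (2 * γ)) with hX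
    have hX0 : 0 < X := by positivity
    set N : ℝ≥0∞ := A * twoPow (-(j * s)) * ENNReal.ofReal (R ^ (μ / p.toReal)) * dualNorm p h
      with hN
    have hin : ∀ τ ∈ Set.Ioc 0 T, ∫⁻ y, heatWeight γ t (τ, y) * (shell n j).indicator h y ∂D τ ≤
        ENNReal.ofReal (Real.exp (-(t - τ) * X)) * N := by
      intro τ hτ
      have h1 := (hD τ).2 j x R hR h hh hs hd
      rw [← lintegral_indicator (measurableSet_shell j)] at h1
      refine le_trans ?_ (mul_le_mul_right h1 _)
      rw [← lintegral_const_mul' _ _ ENNReal.ofReal_ne_top]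
      refine lintegral_mono fun y => ?_
      by_cases hy : y ∈ shell n j
      · refine mul_le_mul_left (ENNReal.ofReal_le_ofReal (Real.exp_le_exp.2 ?_)) _
        have h2 : X ≤ ‖y‖ ^ (2 * γ) := by
          rw [hX, Real.rpow_mul two_pos.le, Real.rpow_intCast]
          exact Real.rpow_le_rpow (by positivity) hy.1 (by positivity)
        have h3 : 0 ≤ t - τ := by linarith [hτ.2]
        have := mul_le_mul_of_nonneg_left h2 h3
        linarith
      · simp [Set.indicator_of_notMem hy]
    refine (setLIntegral_mono' measurableSet_Ioc hin).trans ?_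
    have hNm : Measurable fun τ : ℝ => ENNReal.ofReal (Real.exp (-(t - τ) * X)) :=
      (Real.measurable_exp.comp
        ((measurable_const.sub measurable_id).neg.mul_const _)).ennreal_ofReal
    rw [lintegral_mul_const _ hNm]
    have h4 : ∫⁻ τ in Set.Ioc 0 T, ENNReal.ofReal (Real.exp (-(t - τ) * X)) ≤
        twoPow (-(j * (2 * γ))) * L := by
      have h5 := mul_le_mul_right (hL X hX0) (twoPow (-(j * (2 * γ))))
      rw [← mul_assoc] at h5
      have h6 : twoPow (-(j * (2 * γ))) * ENNReal.ofReal X = 1 := twoPow_neg_mul _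
      rwa [h6, one_mul] at h5
    refine (mul_le_mul_left h4 _).trans_eq ?_
    have e : -((j : ℝ) * (s + 2 * γ)) = -(j * s) + -(j * (2 * γ)) := by ring
    rw [hN, e, twoPow_add]
    ring

namespace Admissible

variable {n : ℕ} {γ β μ : ℝ} {p : ℝ≥0∞} {a : Fin n → Fin n → ℂ} {P : Fin n → Space n → ℂ}

theorem integrableOn_fluxPair (h : Admissible n γ β μ p a P) {Φ : LittlewoodPaley n}
    {θ φ : ℝ → DistModPoly n} {A B : ℝ≥0∞}
    (hθ : StronglyBounded Φ p μ (critIndex n γ β μ p) θ A) (hA : A ≠ ∞)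
    (hφ : StronglyBounded Φ p μ (critIndex n γ β μ p) φ B) (hB : B ≠ ∞) (ψ : testAwayZero n)
    {t T : ℝ} (hT : T ≤ t) :
    IntegrableOn (fun τ => fluxPair a P (θ τ) (φ τ) (damped γ (t - τ) ψ)) (Set.Ioc 0 T) := by
  -- The maximum keeps the damping parameter nonnegative at all times and agrees with t - τ on the
  -- interval of integration.
  have hm := hθ.measurable_fluxPair h hA hφ hB ψ (r := fun τ => max (t - τ) 0)
    ((measurable_const.sub measurable_id).max measurable_const) fun τ => le_max_right _ _
  have he : ∀ τ ∈ Set.Ioc 0 T, max (t - τ) 0 = t - τ := fun τ hτ =>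
    max_eq_left (by linarith [hτ.2])
  obtain ⟨C, hC⟩ := h.exists_fluxPair_damped_le Φ ψ
  have hi : IntegrableOn (fun τ => fluxPair a P (θ τ) (φ τ) (damped γ (max (t - τ) 0) ψ))
      (Set.Ioc 0 T) := by
    refine ⟨hm.aestronglyMeasurable, ?_⟩
    refine (lintegral_mono (g := fun _ => (C : ℝ≥0∞) * A * B) fun τ => ?_).trans_lt ?_
    · refine (hC _ _ (ne_top_of_le_ne_top hA (hθ.bound τ))
        (ne_top_of_le_ne_top hB (hφ.bound τ)) _ (le_max_right _ _)).2.trans ?_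
      exact mul_le_mul' (mul_le_mul' le_rfl (hθ.bound τ)) (hφ.bound τ)
    · rw [lintegral_const, Measure.restrict_apply_univ, Real.volume_Ioc]
      exact ENNReal.mul_lt_top (by finiteness) ENNReal.ofReal_lt_top
  exact hi.congr_fun (fun τ hτ => by simp only [he τ hτ]) measurableSet_Ioc

/-- The functional is dominated by the time-integrated flux measure, whose index is s - 2γ + 2γ = s,
so it comes from a complex measure with the required shell bound. Keeping L free covers both the
full integral and its early part. -/
theorem exists_duhamel_stronglyBounded (h : Admissible n γ β μ p a P) (Φ : LittlewoodPaley n) :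
    ∃ C : NNReal, ∀ (θ φ : ℝ → DistModPoly n) (A B : ℝ≥0∞), A ≠ ∞ → B ≠ ∞ →
      StronglyBounded Φ p μ (critIndex n γ β μ p) θ A →
      StronglyBounded Φ p μ (critIndex n γ β μ p) φ B →
      ∀ (t T : ℝ), T ≤ t → ∀ L : ℝ≥0∞, L ≠ ∞ →
      (∀ x : ℝ, 0 < x → ENNReal.ofReal x *
        ∫⁻ τ in Set.Ioc 0 T, ENNReal.ofReal (Real.exp (-(t - τ) * x)) ≤ L) →
      ∃ b : DistModPoly n,
        (∀ ψ : testAwayZero n, hat b ψ =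
          -∫ τ in Set.Ioc 0 T, fluxPair a P (θ τ) (φ τ) (damped γ (t - τ) ψ)) ∧
        fnNorm Φ p μ (critIndex n γ β μ p) b ≤ C * L * A * B := by
  obtain ⟨C, hC⟩ := h.exists_flux Φ
  obtain ⟨C', hC'⟩ := exists_fnNorm_le_of_shellBound (μ := μ) (s := critIndex n γ β μ p) Φ h.one_le
  refine ⟨C' * (C * C), fun θ φ A B hA hB hθ hφ t T hT L hLt hL => ?_⟩
  have fθ : ∀ τ, fnNorm Φ p μ (critIndex n γ β μ p) (θ τ) ≠ ∞ := fun τ =>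
    ne_top_of_le_ne_top hA (hθ.bound τ)
  have fφ : ∀ τ, fnNorm Φ p μ (critIndex n γ β μ p) (φ τ) ≠ ∞ := fun τ =>
    ne_top_of_le_ne_top hB (hφ.bound τ)
  obtain ⟨κ, hκs, hκ⟩ := hθ.exists_kernel h.one_le h.index_gap hA
  obtain ⟨η, hηs, hη⟩ := hφ.exists_kernel h.one_le h.index_gap hB
  obtain ⟨M, hM⟩ := exists_measure_time_flux (β - 1) (volume.restrict (Set.Ioc 0 T)) κ η
    (measurable_heatWeight (n := n) γ t)
  simp only [hκ, hη] at hM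
  have hD : ∀ τ, ShellBound p μ (critIndex n γ β μ p - 2 * γ)
      (fluxMeasure (β - 1) (fourierMeasure (θ τ)).var (fourierMeasure (φ τ)).var)
      (C * A * B) := by
    intro τ
    refine (hC _ _ (fθ τ) (fφ τ)).1.mono le_rfl ?_
    gcongr
    · exact hθ.bound τ
    · exact hφ.bound τ
  have hMS := (ShellBound.of_time_integral (by linarith [h.gain]) hT hL hD hM).smul C
  rw [sub_add_cancel] at hMS
  have hfin : (C : ℝ≥0∞) * (C * A * B * L) ≠ ∞ := by finiteness
  have htemp := hMS.hasTemperateGrowth h.one_le h.index_gap hfin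
  have hint := fun ψ => h.integrableOn_fluxPair hθ hA hφ hB ψ hT
  have hfi : ∀ (ψ : testAwayZero n), ∀ τ ∈ Set.Ioc 0 T,
      FluxIntegrable a P (θ τ) (φ τ) (damped γ (t - τ) ψ) := by
    intro ψ τ hτ
    obtain ⟨D, hD⟩ := h.exists_fluxPair_damped_le Φ ψ
    exact (hD _ _ (fθ τ) (fφ τ) _ (by linarith [hτ.2])).1
  let S : testAwayZero n →ₗ[ℂ] ℂ :=
    { toFun := fun ψ => -∫ τ in Set.Ioc 0 T, fluxPair a P (θ τ) (φ τ) (damped γ (t - τ) ψ)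
      map_add' := by
        intro ψ ψ'
        rw [← neg_add, ← integral_add (hint ψ) (hint ψ')]
        congr 1
        refine setIntegral_congr_fun measurableSet_Ioc fun τ hτ => ?_
        have e : damped γ (t - τ) (ψ + ψ') = fun ξ =>
            damped γ (t - τ) ψ ξ + damped γ (t - τ) ψ' ξ := by
          funext ξ
          simp [damped, mul_add]
        simp only [e]
        exact fluxPair_add_test (hfi ψ τ hτ) (hfi ψ' τ hτ)
      map_smul' := by
        intro c ψ
        rw [RingHom.id_apply, smul_eq_mul, mul_neg, ← integral_const_mul]
        congr 1
        refine integral_congr_ae (.of_forall fun τ => ?_)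
        have e : damped γ (t - τ) (c • ψ) = fun ξ => c * damped γ (t - τ) ψ ξ := by
          funext ξ
          simp [damped, mul_left_comm]
        simp only [e]
        exact fluxPair_smul_test a P _ _ c _ }
  have hS : ∀ ψ, S ψ = -∫ τ in Set.Ioc 0 T, fluxPair a P (θ τ) (φ τ) (damped γ (t - τ) ψ) :=
    fun _ => rfl
  have hSb : ∀ ψ, ‖S ψ‖ ≤ ∫ ξ, ‖ψ.1 ξ‖ ∂((C : ℝ≥0∞) • M) := by
    intro ψ
    have i1 : Integrable (ψ.1 : Space n → ℂ) ((C : ℝ≥0∞) • M) := ψ.1.integrable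
    have h1 : ‖S ψ‖ₑ ≤ ∫⁻ ξ, ‖ψ.1 ξ‖ₑ ∂((C : ℝ≥0∞) • M) := by
      rw [hS, enorm_neg, lintegral_smul_measure, smul_eq_mul,
        hM _ (measurable_testAwayZero ψ).enorm, ← lintegral_const_mul' _ _ ENNReal.coe_ne_top]
      refine (enorm_integral_le_lintegral_enorm _).trans (lintegral_mono fun τ => ?_)
      simp only [← enorm_damped]
      exact ((hC _ _ (fθ τ) (fφ τ)).2 _ (measurable_damped γ _ ψ)).1
    rw [integral_norm_eq_lintegral_enorm i1.aestronglyMeasurable, ← toReal_enorm]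
    exact ENNReal.toReal_mono i1.2.ne h1
  obtain ⟨ν, hν, hνS⟩ := exists_radonMeasure_of_bound htemp S hSb
  obtain ⟨b, hb⟩ := exists_hat_eq_pair ν
  refine ⟨b, fun ψ => by rw [hb, ← hνS, hS], ?_⟩
  refine (hC' b ν _ hb (hMS.mono hν le_rfl)).trans_eq ?_
  push_cast
  ring

end Admissible

/-! ### The bilinear estimate -/

/-- The left side equals 1 - exp(-tx). -/
theorem ofReal_mul_lintegral_exp_le_one {t x : ℝ} (ht : 0 ≤ t) (hx : 0 < x) :
    ENNReal.ofReal x * ∫⁻ τ in Set.Ioc 0 t, ENNReal.ofReal (Real.exp (-(t - τ) * x)) ≤ 1 := by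
  have hc : Continuous fun τ : ℝ => Real.exp (-(t - τ) * x) := by fun_prop
  have hi : IntervalIntegrable (fun τ : ℝ => Real.exp (-(t - τ) * x)) volume 0 t :=
    hc.intervalIntegrable _ _
  rw [← ofReal_integral_eq_lintegral_ofReal
    ((intervalIntegrable_iff_integrableOn_Ioc_of_le ht).1 hi)
    (.of_forall fun τ => (Real.exp_pos _).le), ← intervalIntegral.integral_of_le ht,
    ← ENNReal.ofReal_mul hx.le, ENNReal.ofReal_le_one, ← intervalIntegral.integral_const_mul,
    intervalIntegral.integral_eq_sub_of_hasDerivAt (f := fun τ => Real.exp (-(t - τ) * x))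
      (fun τ _ => ?_) (hi.const_mul x)]
  · have := Real.exp_pos (-(t - 0) * x)
    simp only [sub_self, neg_zero, zero_mul, Real.exp_zero]
    linarith
  · have h1 : HasDerivAt (fun τ : ℝ => -(t - τ) * x) x τ := by
      simpa using (((hasDerivAt_id τ).const_sub t).neg.mul_const x)
    simpa [mul_comm] using h1.exp

/-- For τ ≤ T the integrand is at most exp(-(t-T)x), and y exp(-y) ≤ 1 is applied with y = (t-T)x.
-/
theorem ofReal_mul_lintegral_exp_le {t T x : ℝ} (hT : 0 ≤ T) (hTt : T < t) (hx : 0 < x) :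
    ENNReal.ofReal x * ∫⁻ τ in Set.Ioc 0 T, ENNReal.ofReal (Real.exp (-(t - τ) * x)) ≤
      ENNReal.ofReal (T / (t - T)) := by
  have h0 : 0 < t - T := by linarith
  have h1 : ∫⁻ τ in Set.Ioc 0 T, ENNReal.ofReal (Real.exp (-(t - τ) * x)) ≤
      ∫⁻ _ in Set.Ioc 0 T, ENNReal.ofReal (Real.exp (-(t - T) * x)) := by
    refine setLIntegral_mono' measurableSet_Ioc fun τ hτ =>
      ENNReal.ofReal_le_ofReal (Real.exp_le_exp.2 ?_)
    have : τ * x ≤ T * x := mul_le_mul_of_nonneg_right hτ.2 hx.le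
    linarith
  rw [lintegral_const, Measure.restrict_apply_univ, Real.volume_Ioc, sub_zero,
    ← ENNReal.ofReal_mul (Real.exp_pos _).le] at h1
  refine (mul_le_mul_right h1 _).trans ?_
  rw [← ENNReal.ofReal_mul hx.le]
  refine ENNReal.ofReal_le_ofReal ?_
  rw [le_div_iff₀ h0]
  have h2 : (t - T) * x * Real.exp (-(t - T) * x) ≤ 1 := by
    rw [neg_mul, Real.exp_neg, mul_inv_le_iff₀ (Real.exp_pos _)]
    linarith [Real.add_one_le_exp ((t - T) * x)]
  calc x * (Real.exp (-(t - T) * x) * T) * (t - T) =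
        T * ((t - T) * x * Real.exp (-(t - T) * x)) := by ring
    _ ≤ T := mul_le_of_le_one_right hT h2

namespace Admissible

variable {n : ℕ} {γ β μ : ℝ} {p : ℝ≥0∞} {a : Fin n → Fin n → ℂ} {P : Fin n → Space n → ℂ}

theorem exists_duhamel (h : Admissible n γ β μ p a P) (Φ : LittlewoodPaley n) :
    ∃ C : NNReal, ∀ θ φ : ℝ → DistModPoly n, MemLinfty Φ p μ (critIndex n γ β μ p) θ →
      MemLinfty Φ p μ (critIndex n γ β μ p) φ → ∀ (t T : ℝ), T ≤ t → ∀ L : ℝ≥0∞, L ≠ ∞ →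
      (∀ x : ℝ, 0 < x → ENNReal.ofReal x *
        ∫⁻ τ in Set.Ioc 0 T, ENNReal.ofReal (Real.exp (-(t - τ) * x)) ≤ L) →
      (∀ ψ, IntegrableOn (fun τ => fluxPair a P (θ τ) (φ τ) (damped γ (t - τ) ψ))
        (Set.Ioc 0 T)) ∧
      ∃ b : DistModPoly n,
        (∀ ψ : testAwayZero n, hat b ψ =
          -∫ τ in Set.Ioc 0 T, fluxPair a P (θ τ) (φ τ) (damped γ (t - τ) ψ)) ∧
        fnNorm Φ p μ (critIndex n γ β μ p) b ≤ C * L *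
          supNorm Φ p μ (critIndex n γ β μ p) θ * supNorm Φ p μ (critIndex n γ β μ p) φ := by
  obtain ⟨C, hC⟩ := h.exists_duhamel_stronglyBounded Φ
  refine ⟨C, fun θ φ hθ hφ t T hT L hLt hL => ?_⟩
  obtain ⟨θ', h1, e1⟩ := hθ.exists_stronglyBounded h.one_le
  obtain ⟨φ', h2, e2⟩ := hφ.exists_stronglyBounded h.one_le
  have e : ∀ ψ, ∀ᵐ τ ∂volume.restrict (Set.Ioc (0 : ℝ) T),
      fluxPair a P (θ' τ) (φ' τ) (damped γ (t - τ) ψ) =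
        fluxPair a P (θ τ) (φ τ) (damped γ (t - τ) ψ) := by
    intro ψ
    have hsub : Set.Ioc (0 : ℝ) T ⊆ Set.Ioi 0 := fun _ hτ => hτ.1
    filter_upwards [ae_restrict_of_ae_restrict_of_subset hsub e1,
      ae_restrict_of_ae_restrict_of_subset hsub e2] with τ hτ1 hτ2
    rw [hτ1, hτ2]
  obtain ⟨b, hb, hbn⟩ := hC θ' φ' _ _ hθ.1.ne hφ.1.ne h1 h2 t T hT L hLt hL
  exact ⟨fun ψ => (h.integrableOn_fluxPair h1 hθ.1.ne h2 hφ.1.ne ψ hT).congr (e ψ),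
    b, fun ψ => by rw [hb, integral_congr_ae (e ψ)], hbn⟩

theorem exists_bilinearEstimate (h : Admissible n γ β μ p a P) (Φ : LittlewoodPaley n) :
    ∃ K : ℝ, 0 < K ∧ BilinearEstimate Φ p μ (critIndex n γ β μ p) γ a P K := by
  obtain ⟨C, hC⟩ := h.exists_duhamel Φ
  -- The added 1 only ensures that the constant is positive.
  refine ⟨C + 1, by positivity, fun θ φ hθ hφ => ?_⟩
  have key : ∀ t : ℝ, ∃ b : DistModPoly n, 0 < t → IsDuhamel γ a P θ φ t b ∧
      fnNorm Φ p μ (critIndex n γ β μ p) b ≤ C *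
        supNorm Φ p μ (critIndex n γ β μ p) θ * supNorm Φ p μ (critIndex n γ β μ p) φ := by
    intro t
    by_cases ht : 0 < t
    · obtain ⟨hi, b, hb, hbn⟩ := hC θ φ hθ hφ t t le_rfl 1 ENNReal.one_ne_top
        fun x hx => ofReal_mul_lintegral_exp_le_one ht.le hx
      refine ⟨b, fun _ => ⟨fun ψ => ⟨?_, ?_, ?_⟩, by simpa using hbn⟩⟩
      · filter_upwards [ae_restrict_mem measurableSet_Ioc] with τ hτ
        have fθ := ne_top_of_le_ne_top hθ.1.ne (fnNorm_le_supNorm Φ p μ _ θ hτ.1)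
        have fφ := ne_top_of_le_ne_top hφ.1.ne (fnNorm_le_supNorm Φ p μ _ φ hτ.1)
        obtain ⟨D, hD⟩ := h.exists_fluxPair_damped_le Φ ψ
        exact ⟨⟨_, h.isFourierMeasure fθ⟩, ⟨_, h.isFourierMeasure fφ⟩,
          (hD _ _ fθ fφ _ (by linarith [hτ.2])).1⟩
      · exact (intervalIntegrable_iff_integrableOn_Ioc_of_le ht.le).2 (hi ψ)
      · rw [hb, intervalIntegral.integral_of_le ht.le]
    · exact ⟨0, fun h => absurd h ht⟩
  choose b hb using key
  refine ⟨b, fun t ht => (hb t ht).1, iSup₂_le fun t ht => (hb t ht).2.trans ?_⟩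
  gcongr
  rw [ENNReal.ofReal_add (by positivity) one_pos.le, ENNReal.ofReal_coe_nnreal]
  exact le_self_add

end Admissible

/-! ### Asymptotic stability -/

section Norm

variable {n : ℕ} {Φ : LittlewoodPaley n} {p : ℝ≥0∞} {μ s : ℝ}

/-- Composing w with simple functions of time that converge to the identity gives simple functions
converging wherever w is continuous. Asking this only almost everywhere admits the jump of a cut-off
at time T. -/
theorem memLinfty_of_ae_continuous {w : ℝ → DistModPoly n} (hw : supNorm Φ p μ s w < ∞)
    (hc : ∀ᵐ t ∂volume.restrict (Set.Ioi (0 : ℝ)),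
      Tendsto (fun τ => fnNorm Φ p μ s (w τ - w t)) (𝓝 t) (𝓝 0)) :
    MemLinfty Φ p μ s w := by
  have h1 : (1 : ℝ) ∈ Set.Ioi (0 : ℝ) := Set.mem_Ioi.2 one_pos
  refine ⟨hw, fun m => (SimpleFunc.approxOn id measurable_id (Set.Ioi (0 : ℝ)) 1 h1 m).map w, ?_⟩
  filter_upwards [hc, ae_restrict_mem measurableSet_Ioi] with t ht ht0
  exact ht.comp (SimpleFunc.tendsto_approxOn measurable_id h1 (subset_closure ht0))

theorem MemBC.memLinfty {w : ℝ → DistModPoly n} (hw : MemBC Φ p μ s w) : MemLinfty Φ p μ s w :=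
  memLinfty_of_ae_continuous hw.1 <| by
    filter_upwards [ae_restrict_mem measurableSet_Ioi] with t ht using hw.2 t ht

theorem supNorm_sub_le (hp : 1 ≤ p) (θ φ : ℝ → DistModPoly n) :
    supNorm Φ p μ s (θ - φ) ≤ supNorm Φ p μ s θ + supNorm Φ p μ s φ :=
  iSup₂_le fun _ ht => (fnNorm_sub_le Φ hp _ _).trans
    (add_le_add (fnNorm_le_supNorm Φ p μ s θ ht) (fnNorm_le_supNorm Φ p μ s φ ht))

theorem MemBC.sub (hp : 1 ≤ p) {θ φ : ℝ → DistModPoly n} (hθ : MemBC Φ p μ s θ)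
    (hφ : MemBC Φ p μ s φ) : MemBC Φ p μ s (θ - φ) := by
  refine ⟨(supNorm_sub_le hp θ φ).trans_lt (ENNReal.add_lt_top.2 ⟨hθ.1, hφ.1⟩), fun t ht => ?_⟩
  have h1 := (hθ.2 t ht).add (hφ.2 t ht)
  rw [add_zero] at h1
  refine tendsto_of_tendsto_of_tendsto_of_le_of_le tendsto_const_nhds h1 (fun _ => zero_le)
    fun τ => ?_
  have e : (θ - φ) τ - (θ - φ) t = (θ τ - θ t) - (φ τ - φ t) := by
    simp only [Pi.sub_apply]; abel
  simp only [e]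
  exact fnNorm_sub_le Φ hp _ _

theorem supNorm_indicator_le (hp : 1 ≤ p) (w : ℝ → DistModPoly n) (T : ℝ) :
    supNorm Φ p μ s ((Set.Ioi T).indicator w) ≤ ⨆ (τ : ℝ) (_ : T < τ), fnNorm Φ p μ s (w τ) := by
  refine iSup₂_le fun t _ => ?_
  by_cases h : T < t
  · rw [Set.indicator_of_mem (show t ∈ Set.Ioi T from h)]
    exact le_iSup₂_of_le (f := fun (τ : ℝ) (_ : T < τ) => fnNorm Φ p μ s (w τ)) t h le_rfl
  · rw [Set.indicator_of_notMem (show t ∉ Set.Ioi T from h), fnNorm_zero Φ hp]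
    exact zero_le

theorem MemBC.memLinfty_indicator (hp : 1 ≤ p) {w : ℝ → DistModPoly n} (hw : MemBC Φ p μ s w)
    {T : ℝ} (hT : 0 < T) : MemLinfty Φ p μ s ((Set.Ioi T).indicator w) := by
  have hle : (⨆ (τ : ℝ) (_ : T < τ), fnNorm Φ p μ s (w τ)) ≤ supNorm Φ p μ s w :=
    iSup₂_le fun τ hτ => fnNorm_le_supNorm Φ p μ s w (hT.trans hτ)
  refine memLinfty_of_ae_continuous
    (((supNorm_indicator_le hp w T).trans hle).trans_lt hw.1) ?_
  have hne : ∀ᵐ t ∂volume.restrict (Set.Ioi (0 : ℝ)), t ≠ T :=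
    ae_restrict_of_ae (by simp [ae_iff])
  filter_upwards [hne, ae_restrict_mem measurableSet_Ioi] with t h1 h2
  rcases lt_or_gt_of_ne h1 with h | h
  · refine tendsto_const_nhds.congr' ?_
    filter_upwards [gt_mem_nhds h] with τ hτ
    rw [Set.indicator_of_notMem (show τ ∉ Set.Ioi T from hτ.not_gt),
      Set.indicator_of_notMem (show t ∉ Set.Ioi T from h.not_gt), sub_zero, fnNorm_zero Φ hp]
  · refine (hw.2 t h2).congr' ?_
    filter_upwards [lt_mem_nhds h] with τ hτ
    rw [Set.indicator_of_mem (show τ ∈ Set.Ioi T from hτ),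
      Set.indicator_of_mem (show t ∈ Set.Ioi T from h)]

end Norm

/-! ### Two limit arguments. -/

section Limits

theorem exists_mul_ofReal_div_le {C η : ℝ≥0∞} (hC : C ≠ ∞) (hη : η ≠ 0) :
    ∃ δ : ℝ, 0 < δ ∧ δ < 1 ∧ C * ENNReal.ofReal (δ / (1 - δ)) ≤ η := by
  have h1 : Tendsto (fun δ : ℝ => δ / (1 - δ)) (𝓝 0) (𝓝 0) := by
    have : ContinuousAt (fun δ : ℝ => δ / (1 - δ)) 0 := by
      refine ContinuousAt.div continuousAt_id (by fun_prop) (by norm_num)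
    simpa using this.tendsto
  have h2 : Tendsto (fun δ : ℝ => C * ENNReal.ofReal (δ / (1 - δ))) (𝓝 0) (𝓝 0) := by
    simpa using ENNReal.Tendsto.const_mul (ENNReal.tendsto_ofReal h1) (Or.inr hC)
  have h3 : ∀ᶠ δ : ℝ in 𝓝[>] 0, C * ENNReal.ofReal (δ / (1 - δ)) < η :=
    (h2.mono_left nhdsWithin_le_nhds).eventually (gt_mem_nhds (pos_iff_ne_zero.2 hη))
  have h4 : ∀ᶠ δ : ℝ in 𝓝[>] 0, δ < 1 := nhdsWithin_le_nhds (gt_mem_nhds one_pos)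
  obtain ⟨δ, ⟨h5, h6⟩, h7⟩ := ((h3.and h4).and self_mem_nhdsWithin).exists
  exact ⟨δ, h7, h6, h5.le⟩

variable {D H : ℝ → ℝ≥0∞} {q C : ℝ≥0∞}

/-- For fixed δ the supremum over τ > δt tends to zero as t grows; the last term is made small
beforehand by the choice of δ. No smallness of q is needed here. -/
theorem tendsto_zero_of_le_add_iSup (hq : q ≠ ∞) (hC : C ≠ ∞)
    (h : ∀ δ t : ℝ, 0 < δ → δ < 1 → 0 < t → H t ≤ D t +
      (q * ⨆ (τ : ℝ) (_ : δ * t < τ), D τ) + C * ENNReal.ofReal (δ / (1 - δ)))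
    (hD : Tendsto D atTop (𝓝 0)) : Tendsto H atTop (𝓝 0) := by
  have key : ∀ η : ℝ≥0∞, 0 < η → ∀ᶠ t in atTop, H t ≤ (2 + q) * η := by
    intro η hη
    obtain ⟨δ, hδ, hδ1, hCδ⟩ := exists_mul_ofReal_div_le hC hη.ne'
    obtain ⟨t₀, ht₀⟩ := eventually_atTop.1 (ENNReal.tendsto_nhds_zero.1 hD η hη)
    have h1 : Tendsto (fun t : ℝ => δ * t) atTop atTop := tendsto_id.const_mul_atTop hδ
    filter_upwards [eventually_gt_atTop 0, eventually_ge_atTop t₀,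
      h1.eventually (eventually_ge_atTop t₀)] with t h2 h3 h4
    calc H t ≤ D t + (q * ⨆ (τ : ℝ) (_ : δ * t < τ), D τ) + C * ENNReal.ofReal (δ / (1 - δ)) :=
          h δ t hδ hδ1 h2
      _ ≤ η + q * η + η := by
          gcongr
          · exact ht₀ t h3
          · exact iSup₂_le fun τ hτ => ht₀ τ (h4.trans hτ.le)
      _ = (2 + q) * η := by ring
  refine ENNReal.tendsto_nhds_zero.2 fun η hη => ?_
  have h2q : (2 + q) ≠ ∞ := by finiteness
  filter_upwards [key (η / (2 + q)) (ENNReal.div_pos hη.ne' h2q)] with t ht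
  exact ht.trans ENNReal.mul_div_le

/-- The upper limit l of D satisfies l ≤ q l + 3η for every η > 0; as q < 1 and l is finite, it
vanishes. -/
theorem tendsto_zero_of_le_add_mul_iSup {A : ℝ≥0∞} (hq : q < 1) (hC : C ≠ ∞) (hA : A ≠ ∞)
    (hDA : ∀ t, 0 < t → D t ≤ A)
    (h : ∀ δ t : ℝ, 0 < δ → δ < 1 → 0 < t → D t ≤ H t +
      (q * ⨆ (τ : ℝ) (_ : δ * t < τ), D τ) + C * ENNReal.ofReal (δ / (1 - δ)))
    (hH : Tendsto H atTop (𝓝 0)) : Tendsto D atTop (𝓝 0) := by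
  set S : ℝ → ℝ≥0∞ := fun T => ⨆ (τ : ℝ) (_ : T < τ), D τ with hS
  have hSle : ∀ T τ, T < τ → D τ ≤ S T := fun T τ hτ =>
    le_iSup₂_of_le (f := fun (τ : ℝ) (_ : T < τ) => D τ) τ hτ le_rfl
  set l : ℝ≥0∞ := ⨅ T : Set.Ioi (0 : ℝ), S T with hl
  have hl_le : ∀ T : ℝ, 0 < T → l ≤ S T := fun T hT =>
    iInf_le (fun T : Set.Ioi (0 : ℝ) => S T) ⟨T, hT⟩
  have hlA : l ≠ ∞ := ne_top_of_le_ne_top hA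
    ((hl_le 1 one_pos).trans (iSup₂_le fun τ hτ => hDA τ (one_pos.trans hτ)))
  have key : ∀ η : ℝ≥0∞, 0 < η → l ≤ q * l + 3 * η := by
    intro η hη
    obtain ⟨δ, hδ, hδ1, hCδ⟩ := exists_mul_ofReal_div_le hC hη.ne'
    obtain ⟨t₀, ht₀⟩ := eventually_atTop.1 (ENNReal.tendsto_nhds_zero.1 hH η hη)
    obtain ⟨⟨T, hT⟩, hTl⟩ := iInf_lt_iff.1 (show l < l + η from
      ENNReal.lt_add_right hlA hη.ne')
    have hT' : (0 : ℝ) < T := hT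
    -- Beyond T/δ one has δt ≥ T, so the supremum over τ > δt is already below l + η; beyond t₀ the
    -- term H is below η.
    have hpos : 0 < max (T / δ) t₀ := lt_max_of_lt_left (by positivity)
    refine (hl_le _ hpos).trans (iSup₂_le fun t ht => ?_)
    have h1 : T / δ < t := (le_max_left _ _).trans_lt ht
    have h2 : t₀ ≤ t := (le_max_right _ _).trans ht.le
    have h3 : T ≤ δ * t := by
      rw [div_lt_iff₀ hδ] at h1
      linarith
    calc D t ≤ H t + q * S (δ * t) + C * ENNReal.ofReal (δ / (1 - δ)) :=
          h δ t hδ hδ1 (hpos.trans ht)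
      _ ≤ η + q * (l + η) + η := by
          gcongr
          · exact ht₀ t h2
          · exact (iSup₂_le fun τ hτ => hSle T τ (h3.trans_lt hτ)).trans hTl.le
      _ = q * l + (2 + q) * η := by ring
      _ ≤ q * l + 3 * η := by
          gcongr
          calc (2 : ℝ≥0∞) + q ≤ 2 + 1 := by gcongr
            _ = 3 := by norm_num
  have hql : l ≤ q * l := by
    refine ENNReal.le_of_forall_pos_le_add fun η hη _ => ?_
    refine (key (η / 3) (ENNReal.div_pos (by simpa using hη.ne') (by simp))).trans ?_
    gcongr
    exact ENNReal.mul_div_le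
  have hl0 : l = 0 := by
    by_contra hne
    have : q * l < 1 * l := ENNReal.mul_lt_mul_left hne hlA hq
    rw [one_mul] at this
    exact absurd hql this.not_ge
  refine ENNReal.tendsto_nhds_zero.2 fun η hη => ?_
  obtain ⟨⟨T, hT⟩, hTl⟩ := iInf_lt_iff.1 (show l < η by rw [hl0]; exact hη)
  filter_upwards [eventually_gt_atTop T] with t ht
  exact (hSle T t ht).trans hTl.le

end Limits

/-! ### Splitting the Duhamel integral and the remainder. -/

theorem fourierMeasure_zero_var {n : ℕ} : (fourierMeasure (0 : DistModPoly n)).var = 0 := by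
  have h := IsFourierMeasure.zero.var_le
    (isFourierMeasure_fourierMeasure ⟨_, IsFourierMeasure.zero (n := n)⟩)
  have h0 : (default : RadonMeasure n).var = 0 := rfl
  rw [h0] at h
  exact le_antisymm h (Measure.zero_le _)

theorem fluxPair_zero_left {n : ℕ} (a : Fin n → Fin n → ℂ) (P : Fin n → Space n → ℂ)
    (G : DistModPoly n) (χ : Space n → ℂ) : fluxPair a P 0 G χ = 0 := by
  simp [fluxPair, fourierMeasure_zero_var]

theorem fluxPair_zero_right {n : ℕ} (a : Fin n → Fin n → ℂ) (P : Fin n → Space n → ℂ)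
    (F : DistModPoly n) (χ : Space n → ℂ) : fluxPair a P F 0 χ = 0 := by
  simp [fluxPair, fourierMeasure_zero_var]

theorem setIntegral_Ioc_eq_indicator_add {f : ℝ → ℂ} {t T : ℝ} (hT : 0 ≤ T) (hTt : T ≤ t)
    (hf : IntegrableOn f (Set.Ioc 0 t)) :
    ∫ τ in Set.Ioc 0 t, f τ =
      (∫ τ in Set.Ioc 0 t, (Set.Ioi T).indicator f τ) + ∫ τ in Set.Ioc 0 T, f τ := by
  rw [setIntegral_indicator measurableSet_Ioi, Set.Ioc_inter_Ioi, sup_of_le_right hT, add_comm,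
    ← setIntegral_union (Set.Ioc_disjoint_Ioc_of_le le_rfl) measurableSet_Ioc
      (hf.mono_set (Set.Ioc_subset_Ioc_right hTt)) (hf.mono_set (Set.Ioc_subset_Ioc_left hT)),
    Set.Ioc_union_Ioc_eq_Ioc hT hTt]

theorem hat_heat {n : ℕ} {γ t : ℝ} (ht : 0 ≤ t) (F : DistModPoly n) (ψ : testAwayZero n) :
    hat (heat γ t F) ψ = (fourierMeasure F).pair (damped γ t ψ) := by
  refine hat_invFourierOf (c := 1) _ ?_ (fun ξ => ?_) ψ
  · refine Complex.measurable_ofReal.comp (Real.measurable_exp.comp ?_)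
    exact (measurable_norm.pow_const _).const_mul _
  · rw [Complex.norm_real, Real.norm_of_nonneg (Real.exp_pos _).le, Real.exp_le_one_iff]
    have : 0 ≤ ‖ξ‖ ^ (2 * γ) := by positivity
    nlinarith

theorem integrable_damped {n : ℕ} {γ t : ℝ} (ht : 0 ≤ t) (ψ : testAwayZero n)
    (ν : RadonMeasure n) : Integrable (damped γ t ψ) ν.var :=
  (integrable_testAwayZero ψ ν).mono (measurable_damped γ t ψ).aestronglyMeasurable
    (.of_forall fun ξ => by
      have := enorm_damped_le (γ := γ) ht ψ ξ
      rwa [enorm_le_iff_norm_le] at this)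

/-- `heat` is defined through a chosen measure, so its linearity rests on uniqueness of Fourier
measures, extended from test functions to their damped versions. -/
theorem hat_heat_sub {n : ℕ} {γ t : ℝ} (ht : 0 ≤ t) {F G : DistModPoly n}
    (hF : IsFourierMeasure F (fourierMeasure F)) (hG : IsFourierMeasure G (fourierMeasure G))
    (hFG : IsFourierMeasure (F - G) (fourierMeasure (F - G))) (ψ : testAwayZero n) :
    hat (heat γ t (F - G)) ψ = hat (heat γ t F) ψ - hat (heat γ t G) ψ := by
  rw [hat_heat ht, hat_heat ht, hat_heat ht, hFG.pair_add hG hF (sub_add_cancel F G).symm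
    (integrable_damped ht ψ _) (integrable_damped ht ψ _)]
  ring

namespace Admissible

variable {n : ℕ} {γ β μ : ℝ} {p : ℝ≥0∞} {a : Fin n → Fin n → ℂ} {P : Fin n → Space n → ℂ}

/-- The Duhamel integral of `d` against `φ`, split at the time `T` in the first factor. -/
theorem exists_duhamel_split (h : Admissible n γ β μ p a P) (Φ : LittlewoodPaley n) {K : ℝ}
    (hK : BilinearEstimate Φ p μ (critIndex n γ β μ p) γ a P K) :
    ∃ C : NNReal, ∀ d φ : ℝ → DistModPoly n, MemBC Φ p μ (critIndex n γ β μ p) d →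
      MemBC Φ p μ (critIndex n γ β μ p) φ → ∀ t T : ℝ, 0 < T → T < t →
      (∃ b : DistModPoly n,
        (∀ ψ, IntegrableOn (fun τ => fluxPair a P (d τ) (φ τ) (damped γ (t - τ) ψ))
          (Set.Ioc 0 t)) ∧
        (∀ ψ : testAwayZero n, hat b ψ =
          -∫ τ in Set.Ioc 0 t, fluxPair a P (d τ) (φ τ) (damped γ (t - τ) ψ)) ∧
        fnNorm Φ p μ (critIndex n γ β μ p) b ≤
          ENNReal.ofReal K * (⨆ (τ : ℝ) (_ : T < τ), fnNorm Φ p μ (critIndex n γ β μ p) (d τ)) *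
            supNorm Φ p μ (critIndex n γ β μ p) φ +
          C * ENNReal.ofReal (T / (t - T)) * supNorm Φ p μ (critIndex n γ β μ p) d *
            supNorm Φ p μ (critIndex n γ β μ p) φ) ∧
      (∃ b : DistModPoly n,
        (∀ ψ, IntegrableOn (fun τ => fluxPair a P (φ τ) (d τ) (damped γ (t - τ) ψ))
          (Set.Ioc 0 t)) ∧
        (∀ ψ : testAwayZero n, hat b ψ =
          -∫ τ in Set.Ioc 0 t, fluxPair a P (φ τ) (d τ) (damped γ (t - τ) ψ)) ∧
        fnNorm Φ p μ (critIndex n γ β μ p) b ≤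
          ENNReal.ofReal K * supNorm Φ p μ (critIndex n γ β μ p) φ *
            (⨆ (τ : ℝ) (_ : T < τ), fnNorm Φ p μ (critIndex n γ β μ p) (d τ)) +
          C * ENNReal.ofReal (T / (t - T)) * supNorm Φ p μ (critIndex n γ β μ p) φ *
            supNorm Φ p μ (critIndex n γ β μ p) d) := by
  obtain ⟨C, hC⟩ := h.exists_duhamel Φ
  refine ⟨C, fun d φ hd hφ t T hT hTt => ?_⟩
  have ht : 0 < t := hT.trans hTt
  have hw := hd.memLinfty_indicator h.one_le hT
  have hwS := supNorm_indicator_le (Φ := Φ) (μ := μ) (s := critIndex n γ β μ p) h.one_le d T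
  have hL := fun (x : ℝ) (hx : 0 < x) => ofReal_mul_lintegral_exp_le hT.le hTt hx
  have h1 := fun (x : ℝ) (hx : 0 < x) => ofReal_mul_lintegral_exp_le_one ht.le hx
  constructor
  · have hi := (hC d φ hd.memLinfty hφ.memLinfty t t le_rfl 1 ENNReal.one_ne_top h1).1
    obtain ⟨-, b₂, hb₂, hn₂⟩ := hC d φ hd.memLinfty hφ.memLinfty t T hTt.le _
      ENNReal.ofReal_ne_top hL
    -- The late part is the full Duhamel integral of d cut off to τ > T, so the given constant K
    -- multiplies it, which is what the smallness condition refers to. The early part may carry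
    -- another constant.
    obtain ⟨b₁, hb₁, hn₁⟩ := hK _ φ hw hφ.memLinfty
    refine ⟨b₁ t + b₂, hi, fun ψ => ?_, (fnNorm_add_le Φ h.one_le _ _).trans (add_le_add ?_ hn₂)⟩
    · rw [map_add, LinearMap.add_apply, (hb₁ t ht ψ).2.2, hb₂,
        setIntegral_Ioc_eq_indicator_add hT.le hTt.le (hi ψ), neg_add,
        intervalIntegral.integral_of_le ht.le]
      congr 3
      funext τ
      by_cases hτ : τ ∈ Set.Ioi T
      · rw [Set.indicator_of_mem hτ, Set.indicator_of_mem hτ]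
      · rw [Set.indicator_of_notMem hτ, Set.indicator_of_notMem hτ, fluxPair_zero_left]
    · refine (fnNorm_le_supNorm Φ p μ _ b₁ ht).trans (hn₁.trans ?_)
      gcongr
  · have hi := (hC φ d hφ.memLinfty hd.memLinfty t t le_rfl 1 ENNReal.one_ne_top h1).1
    obtain ⟨-, b₂, hb₂, hn₂⟩ := hC φ d hφ.memLinfty hd.memLinfty t T hTt.le _
      ENNReal.ofReal_ne_top hL
    obtain ⟨b₁, hb₁, hn₁⟩ := hK φ _ hφ.memLinfty hw
    refine ⟨b₁ t + b₂, hi, fun ψ => ?_, (fnNorm_add_le Φ h.one_le _ _).trans (add_le_add ?_ hn₂)⟩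
    · rw [map_add, LinearMap.add_apply, (hb₁ t ht ψ).2.2, hb₂,
        setIntegral_Ioc_eq_indicator_add hT.le hTt.le (hi ψ), neg_add,
        intervalIntegral.integral_of_le ht.le]
      congr 3
      funext τ
      by_cases hτ : τ ∈ Set.Ioi T
      · rw [Set.indicator_of_mem hτ, Set.indicator_of_mem hτ]
      · rw [Set.indicator_of_notMem hτ, Set.indicator_of_notMem hτ, fluxPair_zero_right]
    · refine (fnNorm_le_supNorm Φ p μ _ b₁ ht).trans (hn₁.trans ?_)
      gcongr

/-- The difference of two small solutions is the linear evolution of the difference of the data,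
up to a remainder controlled by the difference at late times. -/
theorem exists_remainder (h : Admissible n γ β μ p a P) (Φ : LittlewoodPaley n) {K ε : ℝ}
    (hK0 : 0 < K) (hε : 0 < ε) (hK : BilinearEstimate Φ p μ (critIndex n γ β μ p) γ a P K)
    {θ₀ φ₀ : DistModPoly n} (hθ₀ : fnNorm Φ p μ (critIndex n γ β μ p) θ₀ ≠ ∞)
    (hφ₀ : fnNorm Φ p μ (critIndex n γ β μ p) φ₀ ≠ ∞) {θ φ : ℝ → DistModPoly n}
    (hθ : IsSmallSolution Φ p μ (critIndex n γ β μ p) γ a P ε θ₀ θ)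
    (hφ : IsSmallSolution Φ p μ (critIndex n γ β μ p) γ a P ε φ₀ φ) :
    ∃ C : ℝ≥0∞, C ≠ ∞ ∧ ∀ δ t : ℝ, 0 < δ → δ < 1 → 0 < t → ∃ e : DistModPoly n,
      hat (θ t - φ t) = hat (heat γ t (θ₀ - φ₀) + e) ∧
      fnNorm Φ p μ (critIndex n γ β μ p) e ≤ ENNReal.ofReal (4 * ε * K) *
        (⨆ (τ : ℝ) (_ : δ * t < τ), fnNorm Φ p μ (critIndex n γ β μ p) (θ τ - φ τ)) +
        C * ENNReal.ofReal (δ / (1 - δ)) := by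
  obtain ⟨C, hC⟩ := h.exists_duhamel_split Φ hK
  set N := fnNorm Φ p μ (critIndex n γ β μ p) with hN
  set E := ENNReal.ofReal (2 * ε) with hE
  have hd : MemBC Φ p μ (critIndex n γ β μ p) (θ - φ) := hθ.memBC.sub h.one_le hφ.memBC
  have hdE : supNorm Φ p μ (critIndex n γ β μ p) (θ - φ) ≤ E + E :=
    (supNorm_sub_le h.one_le θ φ).trans (add_le_add hθ.bound hφ.bound)
  refine ⟨C * (E + E) * E + C * E * (E + E), by finiteness, fun δ t hδ hδ1 ht => ?_⟩
  have hT : 0 < δ * t := by positivity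
  have hTt : δ * t < t := by nlinarith
  -- With T = δt the early factor no longer depends on t.
  have hq : δ * t / (t - δ * t) = δ / (1 - δ) := by
    have : 1 - δ ≠ 0 := by linarith
    have : t - δ * t ≠ 0 := by linarith
    field_simp
  obtain ⟨⟨b₁, i₁, hb₁, hn₁⟩, -⟩ := hC _ _ hd hθ.memBC t _ hT hTt
  obtain ⟨-, ⟨b₂, i₂, hb₂, hn₂⟩⟩ := hC _ _ hd hφ.memBC t _ hT hTt
  rw [hq] at hn₁ hn₂
  refine ⟨b₁ + b₂, ?_, ?_⟩
  · obtain ⟨bθ, hbθ, eθ⟩ := hθ.mild t ht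
    obtain ⟨bφ, hbφ, eφ⟩ := hφ.mild t ht
    ext ψ
    obtain ⟨-, iθ, vθ⟩ := hbθ ψ
    obtain ⟨-, iφ, vφ⟩ := hbφ ψ
    rw [intervalIntegrable_iff_integrableOn_Ioc_of_le ht.le] at iθ iφ
    rw [intervalIntegral.integral_of_le ht.le] at vθ vφ
    -- This is the identity θθ - φφ = (θ - φ)θ + φ(θ - φ) for the flux, integrated in time.
    have key : (∫ τ in Set.Ioc 0 t, fluxPair a P (θ τ) (θ τ) (damped γ (t - τ) ψ)) -
        ∫ τ in Set.Ioc 0 t, fluxPair a P (φ τ) (φ τ) (damped γ (t - τ) ψ) =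
        (∫ τ in Set.Ioc 0 t, fluxPair a P ((θ - φ) τ) (θ τ) (damped γ (t - τ) ψ)) +
        ∫ τ in Set.Ioc 0 t, fluxPair a P (φ τ) ((θ - φ) τ) (damped γ (t - τ) ψ) := by
      rw [← integral_sub iθ iφ, ← integral_add (i₁ ψ) (i₂ ψ)]
      refine setIntegral_congr_fun measurableSet_Ioc fun τ hτ => ?_
      have fθ := ne_top_of_le_ne_top hθ.memBC.1.ne (fnNorm_le_supNorm Φ p μ _ θ hτ.1)
      have fφ := ne_top_of_le_ne_top hφ.memBC.1.ne (fnNorm_le_supNorm Φ p μ _ φ hτ.1)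
      exact h.fluxPair_sub fθ fφ fθ fφ ψ (by linarith [hτ.2])
    rw [eθ, eφ]
    simp only [map_sub, map_add, LinearMap.sub_apply, LinearMap.add_apply]
    rw [vθ, vφ, hb₁, hb₂, hat_heat_sub ht.le (h.isFourierMeasure hθ₀) (h.isFourierMeasure hφ₀)
      (h.isFourierMeasure (h.fnNorm_sub_ne_top hθ₀ hφ₀))]
    linear_combination -key
  · refine (fnNorm_add_le Φ h.one_le b₁ b₂).trans ((add_le_add hn₁ hn₂).trans ?_)
    set S := ⨆ (τ : ℝ) (_ : δ * t < τ), N ((θ - φ) τ) with hS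
    set X := ENNReal.ofReal (δ / (1 - δ))
    -- Each of the two bilinear terms contributes K · 2ε.
    have e : ENNReal.ofReal (4 * ε * K) = ENNReal.ofReal K * E + ENNReal.ofReal K * E := by
      rw [hE, ← ENNReal.ofReal_mul hK0.le, ← ENNReal.ofReal_add (by positivity) (by positivity)]
      congr 1
      ring
    calc _ ≤ ENNReal.ofReal K * S * E + C * X * (E + E) * E +
          (ENNReal.ofReal K * E * S + C * X * E * (E + E)) := by
          gcongr
          · exact hθ.bound
          · exact hθ.bound
          · exact hφ.bound
          · exact hφ.bound
      _ = ENNReal.ofReal (4 * ε * K) * S + (C * (E + E) * E + C * E * (E + E)) * X := by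
          rw [e]
          ring

end Admissible

/-! ### Parameters and conclusion. -/

/-- The lower bound on p says (n - μ)/p < n + β + 1 - 4γ, which is 2γ - 1 < s. For p = ∞ the left
side is 0 and the upper bound on γ suffices. -/
theorem admissible_of_parameters {n : ℕ} {γ β μ : ℝ} {p : ℝ≥0∞}
    (hγ : 1 / 2 < γ) (hβγ : β < 2 * γ) (hγn : 2 * γ < (n + β + 1) / 2)
    (hμn : μ < n) (hp1 : 1 ≤ p) (hp : ENNReal.ofReal ((n - μ) / (n + β + 1 - 4 * γ)) < p)
    {a : Fin n → Fin n → ℂ} {P : Fin n → Space n → ℂ} (hPm : ∀ j, Measurable (P j))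
    {C : ℝ} (hP : ∀ j, ∀ᵐ ξ : Space n, ‖P j ξ‖ ≤ C * ‖ξ‖ ^ β)
    (hP1 : p = 1 → ∀ j, ∀ ξ : Space n, ξ ≠ 0 → ‖P j ξ‖ ≤ C * ‖ξ‖ ^ β) :
    Admissible n γ β μ p a P := by
  refine ⟨hp1, by linarith, by linarith, ?_, hPm, C, hP, hP1⟩
  have h0 : 0 < n + β + 1 - 4 * γ := by linarith
  have h1 : (n - μ) / p.toReal < n + β + 1 - 4 * γ := by
    rcases eq_or_ne p ∞ with rfl | hpt
    · simpa using h0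
    · have h2 := (ENNReal.ofReal_lt_iff_lt_toReal (by
        have : 0 < n - μ := by linarith
        positivity) hpt).1 hp
      have h3 : 0 < p.toReal := ENNReal.toReal_pos (by positivity) hpt
      rw [div_lt_iff₀ h0] at h2
      rw [div_lt_iff₀ h3]
      linarith
  unfold critIndex
  linarith

end ActiveScalar

end

theorem theorem3p2 {n : ℕ} (hn : 1 ≤ n) (γ β μ : ℝ) (p : ℝ≥0∞)
    (hγ : 1 / 2 < γ) (hβ : 0 ≤ β) (hβγ : β < 2 * γ) (hγn : 2 * γ < (n + β + 1) / 2)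
    (hμ : 0 ≤ μ) (hμn : μ < n) (hp1 : 1 ≤ p)
    (hp : ENNReal.ofReal ((n - μ) / (n + β + 1 - 4 * γ)) < p)
    (a : Fin n → Fin n → ℂ) (P : Fin n → Space n → ℂ) (hPm : ∀ j, Measurable (P j))
    (C : ℝ) (hP : ∀ j, ∀ᵐ ξ : Space n, ‖P j ξ‖ ≤ C * ‖ξ‖ ^ β)
    (hP1 : p = 1 → ∀ j, ∀ ξ : Space n, ξ ≠ 0 → ‖P j ξ‖ ≤ C * ‖ξ‖ ^ β)
    (Φ : LittlewoodPaley n) :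
    (∃ K : ℝ, 0 < K ∧ BilinearEstimate Φ p μ (critIndex n γ β μ p) γ a P K) ∧
    ∀ K : ℝ, 0 < K → BilinearEstimate Φ p μ (critIndex n γ β μ p) γ a P K →
    ∀ ε : ℝ, 0 < ε → ε < 1 / (4 * K) →
    ∀ θ₀ φ₀ : DistModPoly n,
      fnNorm Φ p μ (critIndex n γ β μ p) θ₀ ≤ ENNReal.ofReal ε →
      fnNorm Φ p μ (critIndex n γ β μ p) φ₀ ≤ ENNReal.ofReal ε →
    ∀ θ φ : ℝ → DistModPoly n,
      IsSmallSolution Φ p μ (critIndex n γ β μ p) γ a P ε θ₀ θ →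
      IsSmallSolution Φ p μ (critIndex n γ β μ p) γ a P ε φ₀ φ →
      (Tendsto (fun t => fnNorm Φ p μ (critIndex n γ β μ p) (θ t - φ t)) atTop (𝓝 0) ↔
        Tendsto (fun t => fnNorm Φ p μ (critIndex n γ β μ p) (heat γ t (θ₀ - φ₀)))
          atTop (𝓝 0)) := by
  have h : Admissible n γ β μ p a P :=
    admissible_of_parameters hγ hβγ hγn hμn hp1 hp hPm hP hP1
  refine ⟨h.exists_bilinearEstimate Φ, fun K hK0 hK ε hε hεK θ₀ φ₀ hθ₀ hφ₀ θ φ hθ hφ => ?_⟩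
  obtain ⟨C', hC', hrem⟩ := h.exists_remainder Φ hK0 hε hK
    (ne_top_of_le_ne_top ENNReal.ofReal_ne_top hθ₀)
    (ne_top_of_le_ne_top ENNReal.ofReal_ne_top hφ₀) hθ hφ
  have hq : ENNReal.ofReal (4 * ε * K) < 1 := by
    rw [lt_div_iff₀ (by positivity)] at hεK
    rw [ENNReal.ofReal_lt_one]
    linarith
  constructor
  · refine tendsto_zero_of_le_add_iSup hq.ne_top hC' fun δ t hδ hδ1 ht => ?_
    obtain ⟨e, he, hen⟩ := hrem δ t hδ hδ1 ht
    -- The same remainder serves both directions: here it is moved to the other side.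
    have h1 : hat (heat γ t (θ₀ - φ₀)) = hat (θ t - φ t - e) := by
      rw [map_sub, he, map_add, add_sub_cancel_right]
    rw [fnNorm_congr Φ h1, add_assoc]
    exact (fnNorm_sub_le Φ hp1 _ _).trans (by gcongr)
  · refine tendsto_zero_of_le_add_mul_iSup hq hC'
      (hθ.memBC.sub hp1 hφ.memBC).1.ne
      (fun t ht => fnNorm_le_supNorm Φ p μ _ (θ - φ) ht) fun δ t hδ hδ1 ht => ?_
    obtain ⟨e, he, hen⟩ := hrem δ t hδ hδ1 ht
    rw [fnNorm_congr Φ he, add_assoc]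
    exact (fnNorm_add_le Φ hp1 _ _).trans (by gcongr)
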